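/- **Setting.** Let $X_1,\dots,X_{n_x}\sim\mu$ and $Y_1,\dots,Y_{n_y}\sim\nu$ be independent i.i.d. samples in $\mathbb R^d$, $n=n_x+n_y$. The indices of each sample are partitioned, deterministically or at random but independently of the data, into a fitting part ($I_X^{f},I_Y^{f}$, sizes $n_x^{f},n_y^{f}$) and a test part ($I_X^{t},I_Y^{t}$, sizes $n_x^{t},n_y^{t}$); $\mathcal D_{fit}$ denotes the fitting observations (and the partition). For $D\in\mathbb N$, widths $\mathbf p=(p_0,\dots,p_{D+1})$ and $s,B\ge0$, let $\mathcal N(D,\mathbf p,s,B)$ be the set of functions $\phi=L_D\circ\sigma\circ L_{D-1}\circ\cdots\circ\sigma\circ L_0:\mathbb R^{p_0}\to\mathbb R^{p_{D+1}}$, $L_\ell(x)=A_\ell x+b_\ell$ with $A_\ell\in\mathbb R^{p_{\ell+1}\times p_\ell}$, $\sigma(x)=\max(x,0)$ coordinatewise, such that all entries of all $A_\ell,b_\ell$ are at most $1$ in absolute value, the total number of nonzero entries of all $A_\ell,b_\ell$ is at most $s$, and $\|\phi\|_\infty\le B$. Let $(k_j,\tau_j)$, $j=1,\dots,m$ ($m\ge1$),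 be candidate pairs with $1\le k_j\le d$ and $k_j\le\tau_j\le k_jd^{1/2}$, and put $\mathcal S_j=\{U\in\mathbb R^{d\times k_j}:U^\top U=I,\ \sum_{i,l}|U_{il}|\le\tau_j\}$. For each $j$, let $\hat U_j$ and $\hat f_j$ be (measurable functions of $\mathcal D_{fit}$ with) $$\hat U_j\in\arg\max_{U\in\mathcal S_j}\ \min_{\pi}\sum_{i\in I_X^f}\sum_{l\in I_Y^f}\pi_{il}\|U^\top(X_i-Y_l)\|_2,\qquad \hat f_j\in\arg\max_{f\in\mathcal N_j}\Big\{\frac1{n_x^f}\sum_{i\in I_X^f}f(\hat U_j^\top X_i)-\frac1{n_y^f}\sum_{l\in I_Y^f}f(\hat U_j^\top Y_l)\Big\},$$ where $\pi$ ranges over the couplings of the uniform distributions on $I_X^f$ and $I_Y^f$, and $\mathcal N_j=\mathcal N(D_j,\mathbf p_j,s_j,B_j)$ is a class of scalar networks on $\mathbb R^{k_j}$. Put $\hat g_j(x)=\hat f_j(\hat U_j^\top x)$, $\hat S_{n,j}=\frac1{n_x^t}\sum_{i\in I_X^t}\hat g_j(X_i)-\frac1{n_y^t}\sum_{l\in I_Y^t}\hat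 g_j(Y_l)$, $\hat S_n=(\hat S_{n,1},\dots,\hat S_{n,m})^\top$, $\rho_n=(n_x^tn_y^t/(n_x^t+n_y^t))^{1/2}$, $$\Sigma^{(1)}=\mathrm{Var}\{\rho_n\hat S_n\mid\mathcal D_{fit}\},\qquad \hat\Sigma^{(1)}=\frac{n_y^t}{n_x^t+n_y^t}\hat C_X+\frac{n_x^t}{n_x^t+n_y^t}\hat C_Y,$$ where $\hat C_X$, $\hat C_Y$ are the empirical covariance matrices (normalised by $1/n_x^t$, $1/n_y^t$) of $(\hat g_1,\dots,\hat g_m)$ over the test observations of $X$ and of $Y$; and $$T_n^{(1)}=\max_{j=1,\dots,m}\rho_n\big|e_j^\top(\hat\Sigma^{(1)})^{-1/2}\hat S_n\big|$$ (with the pseudo-inverse square root if $\hat\Sigma^{(1)}$ is singular). **Assumptions.** (1) $n_x/n$, $n_x^f/n_x$, $n_y^f/n_y\in[c_1,c_2]$ for constants $0<c_1\le c_2<1$. (2) Almost surely, all eigenvalues of $\Sigma^{(1)}$ lie in $[c_1',c_2']$, for constants $0<c_1',c_2'<\infty$. All five numbers $m,c_1,c_2,c_1',c_2'$ are fixed.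 The null hypothesis $\mu=\nu$ holds. Let $Z\sim N(0,I_m)$. **Corollary.** (i) Along any sequence of such experiments with $n\to\infty$ (the dimension $d$, the distribution $\mu=\nu$, the candidate pairs and the network classes may vary with $n$) for which the sup-norm bounds of the network classes satisfy $B_j=o(n^{1/2})$ for each $j$ (for instance, $B_j$ bounded, or $B_j$ as in (ii) with $\eta^2k_j\tau_j^2\log(dn)=o(n)$), $T_n^{(1)}$ converges in distribution to $\max_{j}|Z_j|$. (ii) There is a constant $c>0$ depending only on $m,c_1,c_2,c_1',c_2'$ such that the following holds. Let $\eta>0$, $\theta_n=\eta\sqrt{2\log(dn)}$, and for each $j$, with $(k,\tau)=(k_j,\tau_j)$, let $\mathcal N_j=\mathcal N\big(D,(k,2k,6(k+1)N,\dots,6(k+1)N,1),s,4k^{1/2}\tau\theta_n\big)$, where $D=D_j$, $N=N_j$, $s=s_j$ satisfy $D\asymp\log n$, $s\asymp ND$, $N\ge 2^k\vee(4k^{1/2}\tau\theta_n+1)e^k$ and $N\asymp n^{k/(2+k)}(\log n)^{-3k/(2+k)}$ ($c$ does not depend on the constants implied by $\asymp$). Then, with $k_\circ=\max_jk_j$ and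 $\tau_\circ=\max_j\tau_j$, $$\sup_{t\in\mathbb R}\Big|\mathbb P(T_n^{(1)}\le t)-\mathbb P\big(\max_{j}|Z_j|\le t\big)\Big|\le c\,\frac{k_\circ^{3/2}(\eta\tau_\circ)^3(\log(dn))^{3/2}+k_\circ(\eta\tau_\circ)^2\log(dn)\log n}{n^{1/2}}.$$ -/

import Mathlib

open MeasureTheory ProbabilityTheory Filter Topology
open scoped Matrix

noncomputable section

namespace NeuralWasserstein

/-! ### ReLU networks -/

/-- Weight matrices and bias vectors for the width vector `p`; only the layers `0, …, D` of a
network with `D` hidden layers are ever used. -/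
structure NetParams (p : ℕ → ℕ) where
  A : ∀ l : ℕ, Matrix (Fin (p (l + 1))) (Fin (p l)) ℝ
  b : ∀ l : ℕ, Fin (p (l + 1)) → ℝ

/-- `L_l ∘ σ ∘ L_{l-1} ∘ ⋯ ∘ σ ∘ L_0` with `L_l x = A_l x + b_l` and `σ = max(·, 0)`. -/
def NetParams.eval {p : ℕ → ℕ} (w : NetParams p) (x : Fin (p 0) → ℝ) :
    ∀ l : ℕ, Fin (p (l + 1)) → ℝ
  | 0 => w.A 0 *ᵥ x + w.b 0
  | l + 1 => w.A (l + 1) *ᵥ (fun i => max (w.eval x l i) 0) + w.b (l + 1)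

/-- The class `N(D, p, s, B)` of scalar networks on `ℝ^k` (so `p 0 = k` and `p (D + 1) = 1`). -/
def networkClass (k D : ℕ) (p : ℕ → ℕ) (s B : ℝ) : Set ((Fin k → ℝ) → ℝ) :=
  {f | ∃ (w : NetParams p) (h0 : p 0 = k) (h1 : p (D + 1) = 1),
    (∀ x, f x = w.eval (fun i => x (Fin.cast h0 i)) D (Fin.cast h1.symm 0)) ∧
    (∀ l ≤ D, (∀ i j, |w.A l i j| ≤ 1) ∧ ∀ i, |w.b l i| ≤ 1) ∧
    ((∑ l ∈ Finset.range (D + 1),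
        ({q : Fin (p (l + 1)) × Fin (p l) | w.A l q.1 q.2 ≠ 0}.ncard
          + {i : Fin (p (l + 1)) | w.b l i ≠ 0}.ncard) : ℕ) : ℝ) ≤ s ∧
    ∀ x, |f x| ≤ B}

/-! ### Projections, transport and the split sample -/

/-- `Uᵀ x`. -/
def proj {d k : ℕ} (U : Matrix (Fin d) (Fin k) ℝ) (x : EuclideanSpace ℝ (Fin d)) : Fin k → ℝ :=
  Uᵀ *ᵥ (fun i => x i)

/-- The `ℓ₁`-constrained Stiefel set `{U ∈ ℝ^{d × k} : Uᵀ U = I_k, ‖U‖₁ ≤ τ}`. -/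
def sparseStiefel (d k : ℕ) (τ : ℝ) : Set (Matrix (Fin d) (Fin k) ℝ) :=
  {U | Uᵀ * U = 1 ∧ ∑ i, ∑ l, |U i l| ≤ τ}

/-- Couplings of the uniform measures on the finite index sets `I` and `J`. -/
def couplings {a b : ℕ} (I : Finset (Fin a)) (J : Finset (Fin b)) :
    Set (Matrix (Fin a) (Fin b) ℝ) :=
  {π | (∀ i ∈ I, ∀ j ∈ J, 0 ≤ π i j) ∧
    (∀ j ∈ J, ∑ i ∈ I, π i j = 1 / (J.card : ℝ)) ∧
    (∀ i ∈ I, ∑ j ∈ J, π i j = 1 / (I.card : ℝ))}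

/-- `min_π ∑_{i ∈ I} ∑_{j ∈ J} π_{ij} ‖Uᵀ (x_i - y_j)‖₂`. -/
def transportCost {a b d k : ℕ} (I : Finset (Fin a)) (J : Finset (Fin b))
    (x : Fin a → EuclideanSpace ℝ (Fin d)) (y : Fin b → EuclideanSpace ℝ (Fin d))
    (U : Matrix (Fin d) (Fin k) ℝ) : ℝ :=
  ⨅ π : couplings I J, ∑ i ∈ I, ∑ j ∈ J, π.1 i j * ‖WithLp.toLp 2 (proj U (x i - y j))‖

/-- `|I|⁻¹ ∑_{i ∈ I} g(x_i) - |J|⁻¹ ∑_{j ∈ J} g(y_j)`. -/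
def meanDiff {a b : ℕ} {E : Type*} (I : Finset (Fin a)) (J : Finset (Fin b))
    (x : Fin a → E) (y : Fin b → E) (g : E → ℝ) : ℝ :=
  (I.card : ℝ)⁻¹ * ∑ i ∈ I, g (x i) - (J.card : ℝ)⁻¹ * ∑ j ∈ J, g (y j)

/-- Empirical covariance of `g` and `h` (normalised by `|I|`) over `x_i`, `i ∈ I`. -/
def empCov {a : ℕ} {E : Type*} (I : Finset (Fin a)) (x : Fin a → E) (g h : E → ℝ) : ℝ :=
  (I.card : ℝ)⁻¹ * ∑ i ∈ I, (g (x i) - (I.card : ℝ)⁻¹ * ∑ i' ∈ I, g (x i')) *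
    (h (x i) - (I.card : ℝ)⁻¹ * ∑ i' ∈ I, h (x i'))

/-- The inverse square root `A^{-1/2}` of a symmetric positive definite matrix, by functional
calculus (on a singular positive semidefinite matrix: the pseudo-inverse of the square root). -/
def invSqrt {m : ℕ} (A : Matrix (Fin m) (Fin m) ℝ) : Matrix (Fin m) (Fin m) ℝ :=
  cfc (fun t : ℝ => (√t)⁻¹) A

/-- A partition of the indices of both samples: `true` marks the fitting part. -/
abbrev Split (nx ny : ℕ) : Type := (Fin nx → Bool) × (Fin ny → Bool)

/-- Indices of the fitting part. -/
def fitSet {a : ℕ} (s : Fin a → Bool) : Finset (Fin a) := Finset.univ.filter fun i => s i = true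

/-- Indices of the test part. -/
def testSet {a : ℕ} (s : Fin a → Bool) : Finset (Fin a) := Finset.univ.filter fun i => s i = false

/-- The fitting data: the split together with the observations, those with a test index being
erased (set to `0`). A function of the fitting data is thus a function of the split and of the
fitting observations alone. -/
abbrev FitData (nx ny d : ℕ) : Type :=
  Split nx ny × (Fin nx → EuclideanSpace ℝ (Fin d)) × (Fin ny → EuclideanSpace ℝ (Fin d))

/-- Erase the observations with a test index. -/
def mask {a d : ℕ} (s : Fin a → Bool) (x : Fin a → EuclideanSpace ℝ (Fin d)) :
    Fin a → EuclideanSpace ℝ (Fin d) :=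
  fun i => if s i = true then x i else 0

/-- The fitting data of a sample `(x, y)` under the split `s`. -/
def observed {nx ny d : ℕ} (s : Split nx ny) (x : Fin nx → EuclideanSpace ℝ (Fin d))
    (y : Fin ny → EuclideanSpace ℝ (Fin d)) : FitData nx ny d :=
  (s, mask s.1 x, mask s.2 y)

/-! ### The two-sample experiment and the test statistic -/

universe u

/-- Two independent i.i.d. samples in `ℝ^d`, a random split of the indices that is independent
of them, `m` candidate pairs `(k_j, τ_j)` with one network class each, and the estimators
`Û_j`, `f̂_j` computed from the fitting data. -/
structure Experiment (m : ℕ) where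
  Ω : Type u
  [measΩ : MeasurableSpace Ω]
  P : Measure Ω
  [probP : IsProbabilityMeasure P]
  /-- Dimension and sample sizes. -/
  d : ℕ
  nx : ℕ
  ny : ℕ
  /-- The two populations. -/
  μ : Measure (EuclideanSpace ℝ (Fin d))
  ν : Measure (EuclideanSpace ℝ (Fin d))
  [probμ : IsProbabilityMeasure μ]
  [probν : IsProbabilityMeasure ν]
  /-- The samples. -/
  X : Fin nx → Ω → EuclideanSpace ℝ (Fin d)
  Y : Fin ny → Ω → EuclideanSpace ℝ (Fin d)
  measurable_X : ∀ i, Measurable (X i)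
  measurable_Y : ∀ j, Measurable (Y j)
  law_X : ∀ i, P.map (X i) = μ
  law_Y : ∀ j, P.map (Y j) = ν
  indep : iIndepFun (Sum.elim X Y) P
  /-- The random partition into fitting and test indices. -/
  split : Ω → Split nx ny
  measurable_split : Measurable split
  indep_split : IndepFun split (fun ω => (fun i => X i ω, fun j => Y j ω)) P
  /-- The candidate pairs. -/
  k : Fin m → ℕ
  τ : Fin m → ℝ
  one_le_k : ∀ j, 1 ≤ k j
  k_le_d : ∀ j, k j ≤ d
  k_le_τ : ∀ j, (k j : ℝ) ≤ τ j
  τ_le : ∀ j, τ j ≤ k j * √d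
  /-- The network classes `N(D_j, p_j, s_j, B_j)`. -/
  D : Fin m → ℕ
  p : Fin m → ℕ → ℕ
  s : Fin m → ℝ
  B : Fin m → ℝ
  /-- The estimators, as functions of the fitting data. -/
  U : ∀ j, FitData nx ny d → Matrix (Fin d) (Fin (k j)) ℝ
  f : ∀ j, FitData nx ny d → (Fin (k j) → ℝ) → ℝ
  measurable_U : ∀ j i l, Measurable fun F => U j F i l
  measurable_f : ∀ j, Measurable (Function.uncurry (f j))
  /-- `Û_j` maximises the empirical projected Wasserstein distance over the constraint set. -/
  U_mem : ∀ j, ∀ᵐ ω ∂P,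
    U j (observed (split ω) (fun i => X i ω) (fun i => Y i ω))
      ∈ sparseStiefel d (k j) (τ j)
  U_max : ∀ j, ∀ᵐ ω ∂P, ∀ V ∈ sparseStiefel d (k j) (τ j),
    transportCost (fitSet (split ω).1) (fitSet (split ω).2) (fun i => X i ω) (fun i => Y i ω) V
    ≤ transportCost (fitSet (split ω).1) (fitSet (split ω).2) (fun i => X i ω) (fun i => Y i ω)
      (U j (observed (split ω) (fun i => X i ω) (fun i => Y i ω)))
  /-- `f̂_j` maximises the empirical mean difference of the projected data over the network
  class. -/
  f_mem : ∀ j, ∀ᵐ ω ∂P,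
    f j (observed (split ω) (fun i => X i ω) (fun i => Y i ω))
      ∈ networkClass (k j) (D j) (p j) (s j) (B j)
  f_max : ∀ j, ∀ᵐ ω ∂P, ∀ h ∈ networkClass (k j) (D j) (p j) (s j) (B j),
    meanDiff (fitSet (split ω).1) (fitSet (split ω).2) (fun i => X i ω) (fun i => Y i ω)
      (fun z => h (proj
        (U j (observed (split ω) (fun i => X i ω) (fun i => Y i ω))) z))
    ≤ meanDiff (fitSet (split ω).1) (fitSet (split ω).2) (fun i => X i ω) (fun i => Y i ω)
      (fun z =>
        f j (observed (split ω) (fun i => X i ω) (fun i => Y i ω)) (proj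
        (U j (observed (split ω) (fun i => X i ω) (fun i => Y i ω))) z))

attribute [instance] Experiment.measΩ Experiment.probP Experiment.probμ Experiment.probν

namespace Experiment

variable {m : ℕ} (e : Experiment.{u} m)

/-- Total sample size. -/
def n : ℕ := e.nx + e.ny

/-- The realised fitting data. -/
def fitData (ω : e.Ω) : FitData e.nx e.ny e.d :=
  observed (e.split ω) (fun i => e.X i ω) (fun i => e.Y i ω)

/-- `ĝ_j = f̂_j ∘ Û_j` computed from the fitting data `F`. -/
def g (F : FitData e.nx e.ny e.d) (j : Fin m) (z : EuclideanSpace ℝ (Fin e.d)) : ℝ :=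
  e.f j F (proj (e.U j F) z)

/-- Number of test observations of the first sample. -/
def nxTest (s : Split e.nx e.ny) : ℝ := (testSet s.1).card

/-- Number of test observations of the second sample. -/
def nyTest (s : Split e.nx e.ny) : ℝ := (testSet s.2).card

/-- `(n_x^{test} n_y^{test} / (n_x^{test} + n_y^{test}))^{1/2}`. -/
def scale (s : Split e.nx e.ny) : ℝ :=
  √(e.nxTest s * e.nyTest s / (e.nxTest s + e.nyTest s))

/-- The vector `Ŝ_n`, evaluated with the functions `ĝ_j` obtained from the fitting data `F`
on the test part of a sample `(x, y)`. -/
def S (F : FitData e.nx e.ny e.d)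
    (q : (Fin e.nx → EuclideanSpace ℝ (Fin e.d)) × (Fin e.ny → EuclideanSpace ℝ (Fin e.d))) :
    Fin m → ℝ :=
  fun j => meanDiff (testSet F.1.1) (testSet F.1.2) q.1 q.2 (e.g F j)

/-- `Σ = Var{scale · Ŝ_n | fitting data = F}`: given the fitting data the functions `ĝ_j` are
fixed and the test observations are independent with laws `μ` and `ν`. -/
def Sigma (F : FitData e.nx e.ny e.d) : Matrix (Fin m) (Fin m) ℝ :=
  Matrix.of fun j l =>
    covariance (fun q => e.scale F.1 * e.S F q j) (fun q => e.scale F.1 * e.S F q l)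
      ((Measure.pi fun _ : Fin e.nx => e.μ).prod (Measure.pi fun _ : Fin e.ny => e.ν))

/-- The sample estimate `Σ̂` of `Σ`. -/
def SigmaHat (ω : e.Ω) : Matrix (Fin m) (Fin m) ℝ :=
  Matrix.of fun j l =>
    e.nyTest (e.split ω) / (e.nxTest (e.split ω) + e.nyTest (e.split ω)) *
      empCov (testSet (e.split ω).1) (fun i => e.X i ω)
        (e.g (e.fitData ω) j) (e.g (e.fitData ω) l) +
    e.nxTest (e.split ω) / (e.nxTest (e.split ω) + e.nyTest (e.split ω)) *
      empCov (testSet (e.split ω).2) (fun i => e.Y i ω)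
        (e.g (e.fitData ω) j) (e.g (e.fitData ω) l)

/-- The max-type statistic `max_j scale · |e_jᵀ Σ̂^{-1/2} Ŝ_n|`. -/
def T (ω : e.Ω) : ℝ :=
  ⨆ j : Fin m, e.scale (e.split ω) *
    |(invSqrt (e.SigmaHat ω) *ᵥ
      e.S (e.fitData ω) (fun i => e.X i ω, fun i => e.Y i ω)) j|

/-- `c₁ ≤ n_x / n ≤ c₂`, and the same for the fitting proportions of both samples. -/
def SampleSizes (c₁ c₂ : ℝ) : Prop :=
  (e.nx : ℝ) / (e.nx + e.ny) ∈ Set.Icc c₁ c₂ ∧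
  ∀ᵐ ω ∂e.P, ((fitSet (e.split ω).1).card : ℝ) / e.nx ∈ Set.Icc c₁ c₂ ∧
    ((fitSet (e.split ω).2).card : ℝ) / e.ny ∈ Set.Icc c₁ c₂

/-- Almost surely, all eigenvalues of the (symmetric) matrix `Σ` lie in `[c₁', c₂']`. -/
def CovBounds (c₁' c₂' : ℝ) : Prop :=
  ∀ᵐ ω ∂e.P, spectrum ℝ (e.Sigma (e.fitData ω)) ⊆ Set.Icc c₁' c₂'

/-- The truncation level `θ_n = η √(2 log(dn))`. -/
def θ (η : ℝ) : ℝ := η * √(2 * Real.log (e.d * e.n))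

/-- The `j`-th network class is
`N(D, (k, 2k, 6(k+1)N, …, 6(k+1)N, 1), s, 4 k^{1/2} τ θ_n)` with `D ≍ log n`, `s ≍ N D`,
`N ≥ 2^k ∨ (4 k^{1/2} τ θ_n + 1) e^k` and `N ≍ n^{k/(2+k)} (log n)^{-3k/(2+k)}`, where the
constants of proportionality in `≍` are `a₁` and `a₂`. -/
def NetworkStructure (η a₁ a₂ : ℝ) (N : Fin m → ℕ) : Prop :=
  ∀ j, e.p j 0 = e.k j ∧ e.p j 1 = 2 * e.k j ∧
    (∀ l, 2 ≤ l → l ≤ e.D j → e.p j l = 6 * (e.k j + 1) * N j) ∧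
    e.p j (e.D j + 1) = 1 ∧
    e.B j = 4 * √(e.k j) * e.τ j * e.θ η ∧
    (e.D j : ℝ) ∈ Set.Icc (a₁ * Real.log e.n) (a₂ * Real.log e.n) ∧
    e.s j ∈ Set.Icc (a₁ * (N j * e.D j)) (a₂ * (N j * e.D j)) ∧
    max ((2 : ℝ) ^ e.k j) ((4 * √(e.k j) * e.τ j * e.θ η + 1) * Real.exp (e.k j)) ≤ N j ∧
    (N j : ℝ) ∈ Set.Icc
      (a₁ * ((e.n : ℝ) ^ ((e.k j : ℝ) / (2 + e.k j)) *
        Real.log e.n ^ (-(3 * (e.k j : ℝ)) / (2 + e.k j))))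
      (a₂ * ((e.n : ℝ) ^ ((e.k j : ℝ) / (2 + e.k j)) *
        Real.log e.n ^ (-(3 * (e.k j : ℝ)) / (2 + e.k j))))

/-- `k_∘ = max_j k_j`. -/
def kMax : ℝ := ⨆ j, (e.k j : ℝ)

/-- `τ_∘ = max_j τ_j`. -/
def τMax : ℝ := ⨆ j, e.τ j

end Experiment

/-- The law `N(0, I_m)`. -/
abbrev stdNormal (m : ℕ) : Measure (Fin m → ℝ) := Measure.pi fun _ => gaussianReal 0 1

end NeuralWasserstein

end

namespace NeuralWasserstein

/-! ### A concentration inequality for sums of bounded independent variables -/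

theorem inv_one_add_sq_le_three_mul {x y : ℝ} (h : |x - y| ≤ 1) :
    (1 + y ^ 2)⁻¹ ≤ 3 * (1 + x ^ 2)⁻¹ := by
  have h1 : (x - y) ^ 2 ≤ 1 := by
    rw [← sq_abs]; exact pow_le_one₀ (abs_nonneg _) h
  rw [← div_eq_mul_inv, inv_eq_one_div, div_le_div_iff₀ (by positivity) (by positivity)]
  nlinarith [sq_nonneg (x - 2 * y)]

theorem sq_div_le_mul_arctan_sub {x y : ℝ} (h : |x - y| ≤ 1) :
    (x - y) ^ 2 * (1 + y ^ 2)⁻¹ ≤ 3 * ((x - y) * (Real.arctan x - Real.arctan y)) := by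
  have key : ∀ a b : ℝ, a < b → ∃ c ∈ Set.Ioo a b,
      Real.arctan b - Real.arctan a = (1 + c ^ 2)⁻¹ * (b - a) := by
    intro a b hab
    obtain ⟨c, hc, e⟩ := exists_hasDerivAt_eq_slope Real.arctan (fun x => 1 / (1 + x ^ 2)) hab
      Real.continuous_arctan.continuousOn (fun x _ => Real.hasDerivAt_arctan x)
    refine ⟨c, hc, ?_⟩
    rw [inv_eq_one_div, e, div_mul_cancel₀ _ (sub_pos.2 hab).ne']
  have main : ∃ c, |c - y| ≤ 1 ∧ Real.arctan x - Real.arctan y = (1 + c ^ 2)⁻¹ * (x - y) := by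
    rcases lt_trichotomy x y with hxy | hxy | hxy
    · obtain ⟨c, hc, e⟩ := key x y hxy
      refine ⟨c, ?_, by linarith⟩
      rw [abs_le] at *
      constructor <;> linarith [hc.1, hc.2, h.1, h.2]
    · exact ⟨y, by simp, by simp [hxy]⟩
    · obtain ⟨c, hc, e⟩ := key y x hxy
      refine ⟨c, ?_, by linarith⟩
      rw [abs_le] at *
      constructor <;> linarith [hc.1, hc.2, h.1, h.2]
  obtain ⟨c, hc, e⟩ := main
  rw [e]
  have := inv_one_add_sq_le_three_mul hc
  nlinarith [mul_le_mul_of_nonneg_left this (sq_nonneg (x - y))]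

section Sums

variable {Ω : Type*} [MeasurableSpace Ω] {P : Measure Ω}
  {ι : Type*} [Fintype ι]

theorem integrable_of_abs_le [IsFiniteMeasure P] {f : Ω → ℝ} (hf : Measurable f) {C : ℝ} (h : ∀ ω, |f ω| ≤ C) :
    Integrable f P :=
  Integrable.of_bound hf.aestronglyMeasurable C (ae_of_all _ h)

theorem memLp_of_abs_le [IsFiniteMeasure P] {f : Ω → ℝ} (hf : Measurable f) {C : ℝ} (h : ∀ ω, |f ω| ≤ C)
    (p : ENNReal) : MemLp f p P :=
  MemLp.of_bound hf.aestronglyMeasurable C (ae_of_all _ h)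

theorem indepFun_sum_sub {E : Type*} [AddCommGroup E] [MeasurableSpace E] [MeasurableAdd₂ E]
    {ξ : ι → Ω → E} (hm : ∀ i, Measurable (ξ i)) (hind : iIndepFun ξ P) (i : ι) :
    IndepFun (ξ i) (fun ω => (∑ k, ξ k ω) - ξ i ω) P := by
  classical
  have h := (hind.indepFun_finsetSum_of_notMem hm (Finset.notMem_erase i Finset.univ)).symm
  convert h using 1
  ext ω
  rw [Finset.sum_apply, eq_comm, eq_sub_iff_add_eq, Finset.sum_erase_add _ _ (Finset.mem_univ i)]

theorem integral_sq_sum_eq [IsProbabilityMeasure P] {ξ : ι → Ω → ℝ} (hm : ∀ i, Measurable (ξ i)) (hind : iIndepFun ξ P)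
    {β : ℝ} (hβ : ∀ i ω, |ξ i ω| ≤ β) (h0 : ∀ i, ∫ ω, ξ i ω ∂P = 0) :
    ∫ ω, (∑ i, ξ i ω) ^ 2 ∂P = ∑ i, ∫ ω, ξ i ω ^ 2 ∂P := by
  have h := IndepFun.variance_sum (μ := P) (s := Finset.univ) (X := ξ)
    (fun i _ => memLp_of_abs_le (hm i) (hβ i) 2) (fun i _ j _ hij => hind.indepFun hij)
  rw [variance_of_integral_eq_zero] at h
  · simp only [Finset.sum_apply] at h
    rw [h]
    refine Finset.sum_congr rfl fun i _ => ?_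
    rw [variance_of_integral_eq_zero (hm i).aemeasurable (h0 i)]
  · exact Finset.aemeasurable_sum _ fun i _ => (hm i).aemeasurable
  · simp only [Finset.sum_apply]
    rw [integral_finsetSum _ fun i _ => integrable_of_abs_le (hm i) (hβ i)]
    simp [h0]

theorem integral_inv_one_add_sq_le [IsProbabilityMeasure P] {ξ : ι → Ω → ℝ} (hm : ∀ i, Measurable (ξ i))
    (hind : iIndepFun ξ P) {β : ℝ} (hβ : ∀ i ω, |ξ i ω| ≤ β) (h0 : ∀ i, ∫ ω, ξ i ω ∂P = 0)
    (h1 : ∑ i, ∫ ω, ξ i ω ^ 2 ∂P = 1) {τ : ℝ} (hτ : 0 < τ) (hβτ : β ≤ τ) (b : ℝ) :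
    ∫ ω, (1 + (((∑ i, ξ i ω) - b) / τ) ^ 2)⁻¹ ∂P ≤ 15 * τ := by
  set W : Ω → ℝ := fun ω => ∑ i, ξ i ω with hW
  have hWm : Measurable W := Finset.measurable_sum _ fun i _ => hm i
  set z : ℝ → ℝ := fun w => (w - b) / τ with hz
  have hzm : Measurable z := by fun_prop
  set κ : ℝ → ℝ := fun w => (1 + z w ^ 2)⁻¹ with hκ
  have hκm : Measurable κ := by fun_prop
  have hκ0 : ∀ w, 0 < κ w := fun w => by positivity
  have hκ1 : ∀ w, |κ w| ≤ 1 := fun w => by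
    rw [abs_of_pos (hκ0 w)]
    exact inv_le_one_of_one_le₀ (by nlinarith [sq_nonneg (z w)])
  set f : ℝ → ℝ := fun w => Real.arctan (z w) with hf
  have hfm : Measurable f := Real.continuous_arctan.measurable.comp hzm
  have hfb : ∀ w, |f w| ≤ Real.pi / 2 := fun w => abs_le.2
    ⟨(Real.neg_pi_div_two_lt_arctan _).le, (Real.arctan_lt_pi_div_two _).le⟩
  have hdz : ∀ i ω, z (W ω) - z (W ω - ξ i ω) = ξ i ω / τ := fun i ω => by
    simp only [hz]; field_simp; ring
  have hdz1 : ∀ i ω, |z (W ω) - z (W ω - ξ i ω)| ≤ 1 := fun i ω => by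
    rw [hdz, abs_div, abs_of_pos hτ, div_le_one hτ]; exact (hβ i ω).trans hβτ
  have hWb : ∀ ω, |W ω| ≤ ∑ _i : ι, β := fun ω =>
    (Finset.abs_sum_le_sum_abs _ _).trans (Finset.sum_le_sum fun i _ => hβ i ω)
  have hmi : ∀ i, Measurable fun ω => W ω - ξ i ω := fun i => hWm.sub (hm i)
  have iκ : Integrable (fun ω => κ (W ω)) P :=
    integrable_of_abs_le (hκm.comp hWm) (fun ω => hκ1 _)
  have iκi : ∀ i, Integrable (fun ω => κ (W ω - ξ i ω)) P := fun i =>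
    integrable_of_abs_le (hκm.comp (hmi i)) (fun ω => hκ1 _)
  have ib : ∀ (i : ι) (g : Ω → ℝ), Measurable g → (∃ C, ∀ ω, |g ω| ≤ C) →
      Integrable (fun ω => ξ i ω * g ω) P := by
    rintro i g hg ⟨C, hC⟩
    refine integrable_of_abs_le ((hm i).mul hg) (C := β * C) fun ω => ?_
    rw [abs_mul]
    exact mul_le_mul (hβ i ω) (hC ω) (abs_nonneg _) ((abs_nonneg _).trans (hβ i ω))
  have j1 : ∀ i, Integrable (fun ω => ξ i ω * f (W ω)) P := fun i =>
    ib i (fun ω => f (W ω)) (hfm.comp hWm) ⟨_, fun ω => hfb _⟩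
  have j2 : ∀ i, Integrable (fun ω => ξ i ω * f (W ω - ξ i ω)) P := fun i =>
    ib i (fun ω => f (W ω - ξ i ω)) (hfm.comp (hmi i)) ⟨_, fun ω => hfb _⟩
  have step : ∀ i, (∫ ω, ξ i ω ^ 2 ∂P) * ∫ ω, κ (W ω) ∂P ≤
      9 * τ * ∫ ω, ξ i ω * f (W ω) ∂P := by
    intro i
    have hI := indepFun_sum_sub hm hind i
    have e1 : ∫ ω, ξ i ω * f (W ω - ξ i ω) ∂P = 0 := by
      have := (hI.comp measurable_id hfm).integral_fun_mul_eq_mul_integral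
        (hm i).aestronglyMeasurable (hfm.comp (hmi i)).aestronglyMeasurable
      simp only [Function.comp_apply, id] at this
      rw [this, h0 i, zero_mul]
    have e2 : ∫ ω, ξ i ω ^ 2 * κ (W ω - ξ i ω) ∂P =
        (∫ ω, ξ i ω ^ 2 ∂P) * ∫ ω, κ (W ω - ξ i ω) ∂P := by
      have := (hI.comp (measurable_id.pow_const 2) hκm).integral_fun_mul_eq_mul_integral
        ((hm i).pow_const 2).aestronglyMeasurable (hκm.comp (hmi i)).aestronglyMeasurable
      simpa only [Function.comp_apply, id] using this
    have e3 : ∫ ω, κ (W ω) ∂P ≤ 3 * ∫ ω, κ (W ω - ξ i ω) ∂P := by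
      rw [← integral_const_mul]
      refine integral_mono iκ ((iκi i).const_mul 3) fun ω => inv_one_add_sq_le_three_mul ?_
      rw [abs_sub_comm]; exact hdz1 i ω
    have e4 : ∫ ω, ξ i ω ^ 2 * κ (W ω - ξ i ω) ∂P ≤
        ∫ ω, 3 * τ * (ξ i ω * f (W ω) - ξ i ω * f (W ω - ξ i ω)) ∂P := by
      refine integral_mono ?_ (((j1 i).sub (j2 i)).const_mul _) fun ω => ?_
      · have := ib i (fun ω => ξ i ω * κ (W ω - ξ i ω)) ((hm i).mul (hκm.comp (hmi i)))
          ⟨β * 1, fun ω => by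
            rw [abs_mul]
            exact mul_le_mul (hβ i ω) (hκ1 _) (abs_nonneg _) ((abs_nonneg _).trans (hβ i ω))⟩
        refine this.congr (ae_of_all _ fun ω => ?_)
        simp only; ring
      · have := sq_div_le_mul_arctan_sub (hdz1 i ω)
        rw [hdz] at this
        have h2 := mul_le_mul_of_nonneg_left this (sq_nonneg τ)
        have l1 : τ ^ 2 * ((ξ i ω / τ) ^ 2 * (1 + z (W ω - ξ i ω) ^ 2)⁻¹) =
          ξ i ω ^ 2 * κ (W ω - ξ i ω) := by simp only [hκ]; field_simp
        have l2 : τ ^ 2 * (3 * (ξ i ω / τ * (Real.arctan (z (W ω)) -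
          Real.arctan (z (W ω - ξ i ω))))) =
          3 * τ * (ξ i ω * f (W ω) - ξ i ω * f (W ω - ξ i ω)) := by
          simp only [hf]; field_simp
        rw [l1, l2] at h2
        exact h2
    rw [integral_const_mul, integral_sub (j1 i) (j2 i), e1, sub_zero, e2] at e4
    have := mul_le_mul_of_nonneg_left e3 (integral_nonneg (μ := P) fun ω => sq_nonneg (ξ i ω))
    nlinarith
  have hsum := Finset.sum_le_sum fun i (_ : i ∈ Finset.univ) => step i
  rw [← Finset.sum_mul, h1, one_mul, ← Finset.mul_sum,
    ← integral_finsetSum _ fun i _ => j1 i] at hsum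
  have hEW : ∫ ω, ∑ i, ξ i ω * f (W ω) ∂P ≤ Real.pi / 2 := by
    have iW2 : Integrable (fun ω => W ω ^ 2) P :=
      integrable_of_abs_le (hWm.pow_const 2) (C := (∑ _i : ι, β) ^ 2) fun ω => by
        rw [abs_pow]; exact pow_le_pow_left₀ (abs_nonneg _) (hWb ω) 2
    have : ∫ ω, ∑ i, ξ i ω * f (W ω) ∂P ≤ ∫ ω, Real.pi / 2 * ((1 + W ω ^ 2) / 2) ∂P := by
      refine integral_mono (integrable_finsetSum _ fun i _ => j1 i)
        ((((integrable_const 1).add iW2).div_const 2).const_mul _) fun ω => ?_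
      simp only
      rw [← Finset.sum_mul]
      have h1 : W ω * f (W ω) ≤ |W ω| * (Real.pi / 2) := by
        refine (le_abs_self _).trans ?_
        rw [abs_mul]; exact mul_le_mul_of_nonneg_left (hfb _) (abs_nonneg _)
      have h2 : |W ω| ≤ (1 + W ω ^ 2) / 2 := by
        nlinarith [sq_nonneg (|W ω| - 1), sq_abs (W ω)]
      have := mul_le_mul_of_nonneg_right h2 (by positivity : 0 ≤ Real.pi / 2)
      simp only [hW] at *
      linarith
    refine this.trans ?_
    rw [integral_const_mul, integral_div, integral_add (integrable_const _) iW2,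
      integral_sq_sum_eq hm hind hβ h0, h1]
    simp
  have : Real.pi < 3.15 := Real.pi_lt_d2
  calc _ ≤ _ := hsum
    _ ≤ 9 * τ * (Real.pi / 2) := mul_le_mul_of_nonneg_left hEW (by positivity)
    _ ≤ 15 * τ := by nlinarith

end Sums

/-! ### Bounded measurable functions -/

/-- `f` is measurable and bounded. -/
def BddMeas {Ω : Type*} [MeasurableSpace Ω] (f : Ω → ℝ) : Prop :=
  Measurable f ∧ ∃ C, ∀ ω, |f ω| ≤ C

namespace BddMeas

variable {Ω Ω' : Type*} [MeasurableSpace Ω] [MeasurableSpace Ω'] {f g : Ω → ℝ}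

theorem integrable (hf : BddMeas f) (P : Measure Ω) [IsFiniteMeasure P] : Integrable f P :=
  integrable_of_abs_le hf.1 hf.2.choose_spec

theorem memLp (hf : BddMeas f) (P : Measure Ω) [IsFiniteMeasure P] (p : ENNReal) :
    MemLp f p P :=
  memLp_of_abs_le hf.1 hf.2.choose_spec p

theorem mul (hf : BddMeas f) (hg : BddMeas g) : BddMeas fun ω => f ω * g ω := by
  obtain ⟨C, hC⟩ := hf.2
  obtain ⟨C', hC'⟩ := hg.2
  refine ⟨hf.1.mul hg.1, C * C', fun ω => ?_⟩
  rw [abs_mul]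
  exact mul_le_mul (hC ω) (hC' ω) (abs_nonneg _) ((abs_nonneg _).trans (hC ω))

theorem sub (hf : BddMeas f) (hg : BddMeas g) : BddMeas fun ω => f ω - g ω := by
  obtain ⟨C, hC⟩ := hf.2
  obtain ⟨C', hC'⟩ := hg.2
  exact ⟨hf.1.sub hg.1, C + C', fun ω => (abs_sub _ _).trans (add_le_add (hC ω) (hC' ω))⟩

theorem add (hf : BddMeas f) (hg : BddMeas g) : BddMeas fun ω => f ω + g ω := by
  obtain ⟨C, hC⟩ := hf.2
  obtain ⟨C', hC'⟩ := hg.2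
  exact ⟨hf.1.add hg.1, C + C', fun ω => (abs_add_le _ _).trans (add_le_add (hC ω) (hC' ω))⟩

theorem abs (hf : BddMeas f) : BddMeas fun ω => |f ω| := by
  obtain ⟨C, hC⟩ := hf.2
  exact ⟨continuous_abs.measurable.comp hf.1, C, fun ω => by rw [abs_abs]; exact hC ω⟩

theorem const (c : ℝ) : BddMeas fun _ : Ω => c := ⟨measurable_const, |c|, fun _ => le_rfl⟩

theorem pow (hf : BddMeas f) (n : ℕ) : BddMeas fun ω => f ω ^ n := by
  obtain ⟨C, hC⟩ := hf.2
  refine ⟨hf.1.pow_const n, C ^ n, fun ω => ?_⟩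
  rw [abs_pow]
  exact pow_le_pow_left₀ (abs_nonneg _) (hC ω) n

theorem sum {κ : Type*} (s : Finset κ) {f : κ → Ω → ℝ} (hf : ∀ k, BddMeas (f k)) :
    BddMeas fun ω => ∑ k ∈ s, f k ω := by
  choose C hC using fun k => (hf k).2
  exact ⟨Finset.measurable_sum _ fun k _ => (hf k).1, ∑ k ∈ s, C k, fun ω =>
    (Finset.abs_sum_le_sum_abs _ _).trans (Finset.sum_le_sum fun k _ => hC k ω)⟩

theorem comp (hf : BddMeas f) {X : Ω' → Ω} (hX : Measurable X) : BddMeas fun ω => f (X ω) :=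
  ⟨hf.1.comp hX, hf.2.choose, fun _ => hf.2.choose_spec _⟩

end BddMeas

theorem integral_mul_of_indepFun {Ω E F : Type*} [MeasurableSpace Ω] [MeasurableSpace E]
    [MeasurableSpace F] {P : Measure Ω} {X : Ω → E} {Y : Ω → F} (h : IndepFun X Y P)
    (hX : Measurable X) (hY : Measurable Y) {f : E → ℝ} {g : F → ℝ} (hf : Measurable f)
    (hg : Measurable g) :
    ∫ ω, f (X ω) * g (Y ω) ∂P = (∫ ω, f (X ω) ∂P) * ∫ ω, g (Y ω) ∂P :=
  (h.comp hf hg).integral_fun_mul_eq_mul_integral (hf.comp hX).aestronglyMeasurable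
    (hg.comp hY).aestronglyMeasurable

/-! ### The Stein discrepancy of a sum of independent vectors -/

section Stein

variable {Ω : Type*} [MeasurableSpace Ω] {P : Measure Ω} [IsProbabilityMeasure P]
  {ι : Type*} [Fintype ι] {m : ℕ}

theorem abs_integral_stein_le {ξ : ι → Ω → Fin m → ℝ} (hm : ∀ i, Measurable (ξ i))
    (hind : iIndepFun ξ P) {β : ℝ} (hβ : ∀ i ω j, |ξ i ω j| ≤ β)
    (h0 : ∀ i j, ∫ ω, ξ i ω j ∂P = 0)
    (hcov : ∀ j l, ∑ i, ∫ ω, ξ i ω j * ξ i ω l ∂P = if j = l then 1 else 0)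
    {u1 : Fin m → (Fin m → ℝ) → ℝ} {u2 : Fin m → Fin m → (Fin m → ℝ) → ℝ} {K : (Fin m → ℝ) → ℝ}
    (hu1 : ∀ j, BddMeas (u1 j)) (hu2 : ∀ j l, BddMeas (u2 j l)) (hK : BddMeas K)
    (hr1 : ∀ j x h, (∀ l, |h l| ≤ β) →
      |u1 j (x + h) - u1 j x - ∑ l, h l * u2 j l x| ≤ K x * ∑ l, h l ^ 2)
    (hr2 : ∀ j l x h, (∀ l, |h l| ≤ β) → |u2 j l (x + h) - u2 j l x| ≤ K x * β)
    {κ : ℝ} (hκ : ∀ i, ∫ ω, K ((∑ k, ξ k ω) - ξ i ω) ∂P ≤ κ) :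
    |∫ ω, ∑ j, (u2 j j (∑ k, ξ k ω) - (∑ k, ξ k ω) j * u1 j (∑ k, ξ k ω)) ∂P| ≤
      2 * m ^ 2 * β * κ := by
  set W : Ω → Fin m → ℝ := fun ω => ∑ k, ξ k ω with hW
  have hWm : Measurable W := Finset.measurable_sum _ fun i _ => hm i
  set V : ι → Ω → Fin m → ℝ := fun i ω => W ω - ξ i ω with hV
  have hVm : ∀ i, Measurable (V i) := fun i => hWm.sub (hm i)
  have hVI : ∀ i, IndepFun (ξ i) (V i) P := indepFun_sum_sub hm hind
  have hVW : ∀ i ω, V i ω + ξ i ω = W ω := fun i ω => by simp [hV]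
  have bξ : ∀ i j, BddMeas fun ω => ξ i ω j := fun i j =>
    ⟨(measurable_pi_apply j).comp (hm i), β, fun ω => hβ i ω j⟩
  have b1 : ∀ j, BddMeas fun ω => u1 j (W ω) := fun j => (hu1 j).comp hWm
  have b2 : ∀ j l, BddMeas fun ω => u2 j l (W ω) := fun j l => (hu2 j l).comp hWm
  have b1V : ∀ i j, BddMeas fun ω => u1 j (V i ω) := fun i j => (hu1 j).comp (hVm i)
  have b2V : ∀ i j l, BddMeas fun ω => u2 j l (V i ω) := fun i j l => (hu2 j l).comp (hVm i)
  have bKV : ∀ i, BddMeas fun ω => K (V i ω) := fun i => hK.comp (hVm i)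
  have mc : ∀ j : Fin m, Measurable fun x : Fin m → ℝ => x j := fun j => measurable_pi_apply j
  have hvar : ∀ l, ∑ i, ∫ ω, ξ i ω l ^ 2 ∂P = 1 := fun l => by
    simpa [sq] using hcov l l
  have main : ∀ j, |(∫ ω, u2 j j (W ω) ∂P) - ∫ ω, W ω j * u1 j (W ω) ∂P| ≤
      2 * m * β * κ := by
    intro j
    have eW : ∫ ω, W ω j * u1 j (W ω) ∂P = ∑ i, ∫ ω, ξ i ω j * u1 j (W ω) ∂P := by
      rw [← integral_finsetSum _ fun i _ => ((bξ i j).mul (b1 j)).integrable P]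
      refine integral_congr_ae (ae_of_all _ fun ω => ?_)
      simp only [hW, Finset.sum_apply, Finset.sum_mul]
    have e2 : ∫ ω, u2 j j (W ω) ∂P =
        ∑ i, ∑ l, (∫ ω, ξ i ω j * ξ i ω l ∂P) * ∫ ω, u2 j l (W ω) ∂P := by
      rw [Finset.sum_comm]
      simp only [← Finset.sum_mul, hcov]
      simp
    have term : ∀ i, |∑ l, (∫ ω, ξ i ω j * ξ i ω l ∂P) * (∫ ω, u2 j l (W ω) ∂P) -
        ∫ ω, ξ i ω j * u1 j (W ω) ∂P| ≤
        β * κ * (∑ l, ∫ ω, ξ i ω l ^ 2 ∂P) +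
          ∑ l, ((∫ ω, ξ i ω j ^ 2 ∂P) + ∫ ω, ξ i ω l ^ 2 ∂P) / 2 * (κ * β) := by
      intro i
      have t1 : |(∫ ω, ξ i ω j * u1 j (W ω) ∂P) -
          ∑ l, (∫ ω, ξ i ω j * ξ i ω l ∂P) * ∫ ω, u2 j l (V i ω) ∂P| ≤
          β * κ * (∑ l, ∫ ω, ξ i ω l ^ 2 ∂P) := by
        have s1 : ∫ ω, ξ i ω j * u1 j (V i ω) ∂P = 0 := by
          rw [integral_mul_of_indepFun (hVI i) (hm i) (hVm i) (mc j) (hu1 j).1, h0, zero_mul]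
        have s2 : ∀ l, ∫ ω, ξ i ω j * ξ i ω l * u2 j l (V i ω) ∂P =
            (∫ ω, ξ i ω j * ξ i ω l ∂P) * ∫ ω, u2 j l (V i ω) ∂P := fun l =>
          integral_mul_of_indepFun (hVI i) (hm i) (hVm i) ((mc j).mul (mc l)) (hu2 j l).1
        have s3 : (∫ ω, ξ i ω j * u1 j (W ω) ∂P) -
            ∑ l, (∫ ω, ξ i ω j * ξ i ω l ∂P) * ∫ ω, u2 j l (V i ω) ∂P =
            ∫ ω, ξ i ω j * (u1 j (W ω) - u1 j (V i ω) - ∑ l, ξ i ω l * u2 j l (V i ω)) ∂P := by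
          have e : ∀ ω, ξ i ω j * (u1 j (W ω) - u1 j (V i ω) - ∑ l, ξ i ω l * u2 j l (V i ω)) =
              ξ i ω j * u1 j (W ω) - ξ i ω j * u1 j (V i ω) -
                ∑ l, ξ i ω j * ξ i ω l * u2 j l (V i ω) := fun ω => by
            rw [mul_sub, mul_sub, Finset.mul_sum]
            simp only [mul_assoc]
          simp only [e]
          rw [integral_sub ((((bξ i j).mul (b1 j)).sub ((bξ i j).mul (b1V i j))).integrable P)
            ((BddMeas.sum _ fun l => ((bξ i j).mul (bξ i l)).mul (b2V i j l)).integrable P),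
            integral_sub (((bξ i j).mul (b1 j)).integrable P)
              (((bξ i j).mul (b1V i j)).integrable P), s1, sub_zero,
            integral_finsetSum _ fun l _ =>
              (((bξ i j).mul (bξ i l)).mul (b2V i j l)).integrable P]
          simp only [s2]
        have s4 : ∫ ω, β * ((∑ l, ξ i ω l ^ 2) * K (V i ω)) ∂P =
            β * ((∑ l, ∫ ω, ξ i ω l ^ 2 ∂P) * ∫ ω, K (V i ω) ∂P) := by
          rw [integral_const_mul, integral_mul_of_indepFun (f := fun x => ∑ l, x l ^ 2) (hVI i)
            (hm i) (hVm i) (Finset.measurable_sum _ fun l _ => (mc l).pow_const 2) hK.1,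
            integral_finsetSum _ fun l _ => ((bξ i l).pow 2).integrable P]
        have s5 : |∫ ω, ξ i ω j * (u1 j (W ω) - u1 j (V i ω) -
            ∑ l, ξ i ω l * u2 j l (V i ω)) ∂P| ≤ ∫ ω, β * ((∑ l, ξ i ω l ^ 2) * K (V i ω)) ∂P := by
          refine abs_integral_le_integral_abs.trans ?_
          refine integral_mono
            (((bξ i j).mul (((b1 j).sub (b1V i j)).sub
              (BddMeas.sum _ fun l => (bξ i l).mul (b2V i j l)))).abs.integrable P)
            (((BddMeas.const β).mul ((BddMeas.sum _ fun l => (bξ i l).pow 2).mul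
              (bKV i))).integrable P) fun ω => ?_
          simp only
          rw [abs_mul]
          have := hr1 j (V i ω) (ξ i ω) (hβ i ω)
          rw [hVW] at this
          refine mul_le_mul (hβ i ω j) (this.trans_eq (mul_comm _ _)) (abs_nonneg _)
            ((abs_nonneg _).trans (hβ i ω j))
        rw [s3]
        refine s5.trans ?_
        rw [s4, mul_assoc]
        have hβ0 : 0 ≤ β := by
          obtain ⟨ω⟩ : Nonempty Ω := P.nonempty_of_neZero
          exact (abs_nonneg _).trans (hβ i ω j)
        refine mul_le_mul_of_nonneg_left ?_ hβ0
        rw [mul_comm κ]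
        exact mul_le_mul_of_nonneg_left (hκ i)
          (Finset.sum_nonneg fun l _ => integral_nonneg fun ω => sq_nonneg _)
      have t2 : ∀ l, |(∫ ω, ξ i ω j * ξ i ω l ∂P) * (∫ ω, u2 j l (W ω) ∂P) -
          (∫ ω, ξ i ω j * ξ i ω l ∂P) * ∫ ω, u2 j l (V i ω) ∂P| ≤
          ((∫ ω, ξ i ω j ^ 2 ∂P) + ∫ ω, ξ i ω l ^ 2 ∂P) / 2 * (κ * β) := by
        intro l
        rw [← mul_sub, abs_mul]
        refine mul_le_mul ?_ ?_ (abs_nonneg _) (div_nonneg (add_nonneg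
          (integral_nonneg fun ω => sq_nonneg _) (integral_nonneg fun ω => sq_nonneg _)) two_pos.le)
        · refine abs_integral_le_integral_abs.trans ?_
          rw [← integral_add (((bξ i j).pow 2).integrable P) (((bξ i l).pow 2).integrable P),
            ← integral_div]
          refine integral_mono (((bξ i j).mul (bξ i l)).abs.integrable P)
            (((((bξ i j).pow 2).add ((bξ i l).pow 2)).integrable P).div_const 2) fun ω => ?_
          simp only
          rw [abs_le]
          constructor <;> nlinarith [sq_nonneg (ξ i ω j - ξ i ω l), sq_nonneg (ξ i ω j + ξ i ω l)]
        · rw [← integral_sub ((b2 j l).integrable P) ((b2V i j l).integrable P)]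
          refine abs_integral_le_integral_abs.trans ?_
          have : ∫ ω, |u2 j l (W ω) - u2 j l (V i ω)| ∂P ≤ ∫ ω, K (V i ω) * β ∂P := by
            refine integral_mono (((b2 j l).sub (b2V i j l)).abs.integrable P)
              (((bKV i).mul (BddMeas.const β)).integrable P) fun ω => ?_
            have := hr2 j l (V i ω) (ξ i ω) (hβ i ω)
            rwa [hVW] at this
          refine this.trans ?_
          rw [integral_mul_const]
          obtain ⟨ω⟩ : Nonempty Ω := P.nonempty_of_neZero
          exact mul_le_mul_of_nonneg_right (hκ i) ((abs_nonneg _).trans (hβ i ω j))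
      have t3 := (Finset.abs_sum_le_sum_abs _ _).trans
        (Finset.sum_le_sum fun l (_ : l ∈ Finset.univ) => t2 l)
      rw [Finset.sum_sub_distrib] at t3
      rw [abs_sub_comm] at t1
      have := (abs_sub_le _ _ _).trans (add_le_add t3 t1)
      linarith
    rw [eW, e2, ← Finset.sum_sub_distrib]
    refine (Finset.abs_sum_le_sum_abs _ _).trans ((Finset.sum_le_sum fun i _ => term i).trans ?_)
    have f1 : ∑ i, (∑ l : Fin m, ∫ ω, ξ i ω l ^ 2 ∂P) = m := by
      rw [Finset.sum_comm]; simp [hvar]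
    have f2 : ∑ i, ∑ l : Fin m, ((∫ ω, ξ i ω j ^ 2 ∂P) + ∫ ω, ξ i ω l ^ 2 ∂P) / 2 * (κ * β) =
        m * (κ * β) := by
      rw [Finset.sum_comm]
      simp only [← Finset.sum_mul, ← Finset.sum_div, Finset.sum_add_distrib, hvar]
      simp
    rw [Finset.sum_add_distrib, ← Finset.mul_sum, f1, f2]
    linarith
  have bu : ∀ j, BddMeas fun ω => W ω j := fun j => by
    have := BddMeas.sum Finset.univ fun i => bξ i j
    simpa only [hW, Finset.sum_apply] using this
  rw [integral_finsetSum _ fun j _ => ((b2 j j).sub ((bu j).mul (b1 j))).integrable P]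
  refine (Finset.abs_sum_le_sum_abs _ _).trans ?_
  calc _ ≤ ∑ _j : Fin m, 2 * m * β * κ := Finset.sum_le_sum fun j _ => by
        rw [integral_sub ((b2 j j).integrable P) (((bu j).mul (b1 j)).integrable P)]
        exact main j
    _ = 2 * m ^ 2 * β * κ := by simp; ring

end Stein

/-! ### The standard normal distribution function and its derivatives -/

/-- The standard normal density. -/
noncomputable def normalPDF (z : ℝ) : ℝ := gaussianPDFReal 0 1 z

/-- The standard normal distribution function. -/
noncomputable def normalCDF (z : ℝ) : ℝ := (gaussianReal 0 1).real (Set.Iic z)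

theorem normalPDF_eq (z : ℝ) :
    normalPDF z = (√(2 * Real.pi))⁻¹ * Real.exp (-z ^ 2 / 2) := by
  simp [normalPDF, gaussianPDFReal]

theorem continuous_normalPDF : Continuous normalPDF := by
  simp only [funext normalPDF_eq]
  fun_prop

theorem normalCDF_eq (z : ℝ) : normalCDF z = ∫ x in Set.Iic z, normalPDF x := by
  rw [normalCDF, measureReal_def, gaussianReal_apply_eq_integral _ one_ne_zero,
    ENNReal.toReal_ofReal (integral_nonneg fun x => gaussianPDFReal_nonneg _ _ _)]
  rfl

theorem normalCDF_sub (a b : ℝ) : normalCDF b - normalCDF a = ∫ x in a..b, normalPDF x := by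
  have h : Integrable normalPDF := integrable_gaussianPDFReal 0 1
  rw [normalCDF_eq, normalCDF_eq, intervalIntegral.integral_Iic_sub_Iic h.integrableOn h.integrableOn]

theorem hasDerivAt_normalCDF (z : ℝ) : HasDerivAt normalCDF (normalPDF z) z := by
  have h := (continuous_normalPDF.integral_hasStrictDerivAt 0 z).hasDerivAt.const_add (normalCDF 0)
  refine h.congr_of_eventuallyEq (Eventually.of_forall fun y => ?_)
  simp only [← normalCDF_sub]; ring

theorem hasDerivAt_normalPDF (z : ℝ) : HasDerivAt normalPDF (-z * normalPDF z) z := by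
  have h : HasDerivAt (fun z : ℝ => -z ^ 2 / 2) (-z) z := by
    exact ((hasDerivAt_pow 2 z).neg.div_const 2).congr_deriv (by simp; ring)
  have := h.exp.const_mul (√(2 * Real.pi))⁻¹
  simp only [funext normalPDF_eq]
  exact this.congr_deriv (by ring)

theorem one_add_sq_sq_mul_exp_le (z : ℝ) : (1 + z ^ 2) ^ 2 * Real.exp (-z ^ 2 / 2) ≤ 8 := by
  have h := Real.quadratic_le_exp_of_nonneg (by positivity : 0 ≤ z ^ 2 / 2)
  have h2 : Real.exp (-z ^ 2 / 2) * Real.exp (z ^ 2 / 2) = 1 := by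
    rw [← Real.exp_add]; simp [neg_div]
  have h3 := Real.exp_pos (-z ^ 2 / 2)
  nlinarith [mul_le_mul_of_nonneg_left h h3.le, sq_nonneg z, mul_pos h3 h3,
    mul_nonneg h3.le (sq_nonneg z)]

theorem exp_neg_sq_le (z : ℝ) : Real.exp (-z ^ 2 / 2) ≤ 8 * (1 + z ^ 2)⁻¹ := by
  rw [← div_eq_mul_inv, le_div_iff₀ (by positivity)]
  refine le_trans ?_ (one_add_sq_sq_mul_exp_le z)
  have h3 := Real.exp_pos (-z ^ 2 / 2)
  rw [mul_comm]
  exact mul_le_mul_of_nonneg_right (by nlinarith [sq_nonneg z, sq_nonneg (z ^ 2)]) h3.le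

theorem normalPDF_nonneg (z : ℝ) : 0 ≤ normalPDF z := gaussianPDFReal_nonneg _ _ _

theorem normalPDF_le_exp (z : ℝ) : normalPDF z ≤ Real.exp (-z ^ 2 / 2) := by
  rw [normalPDF_eq]
  refine mul_le_of_le_one_left (Real.exp_pos _).le (inv_le_one_of_one_le₀ ?_)
  rw [Real.one_le_sqrt]
  linarith [Real.pi_gt_three]

theorem mul_normalPDF_le {z c : ℝ} (hc : |c| ≤ 1 + z ^ 2) :
    |c * normalPDF z| ≤ 8 * (1 + z ^ 2)⁻¹ := by
  rw [← div_eq_mul_inv, le_div_iff₀ (by positivity), abs_mul, abs_of_nonneg (normalPDF_nonneg z)]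
  calc |c| * normalPDF z * (1 + z ^ 2) ≤ (1 + z ^ 2) * Real.exp (-z ^ 2 / 2) * (1 + z ^ 2) := by
        gcongr
        · exact normalPDF_nonneg z
        · exact normalPDF_le_exp z
    _ = (1 + z ^ 2) ^ 2 * Real.exp (-z ^ 2 / 2) := by ring
    _ ≤ 8 := one_add_sq_sq_mul_exp_le z

theorem normalPDF_le_one (z : ℝ) : normalPDF z ≤ 1 :=
  (normalPDF_le_exp z).trans (Real.exp_le_one_iff.2 (by nlinarith [sq_nonneg z]))

theorem normalCDF_nonneg (z : ℝ) : 0 ≤ normalCDF z := measureReal_nonneg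

theorem normalCDF_le_one (z : ℝ) : normalCDF z ≤ 1 := measureReal_le_one

theorem monotone_normalCDF : Monotone normalCDF := fun _ _ h =>
  measureReal_mono (Set.Iic_subset_Iic.2 h)

theorem hasSubgaussianMGF_id_gaussianReal :
    HasSubgaussianMGF (id : ℝ → ℝ) 1 (gaussianReal 0 1) where
  integrable_exp_mul t := integrable_exp_mul_gaussianReal t
  mgf_le t := by rw [mgf_id_gaussianReal]; simp

theorem one_sub_normalCDF_le {z : ℝ} (hz : 0 ≤ z) : 1 - normalCDF z ≤ Real.exp (-z ^ 2 / 2) := by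
  have h := hasSubgaussianMGF_id_gaussianReal.measure_ge_le hz
  have h1 : 1 - normalCDF z = (gaussianReal 0 1).real (Set.Iic z)ᶜ := by
    rw [probReal_compl_eq_one_sub measurableSet_Iic]; rfl
  rw [h1]
  refine (measureReal_mono fun x hx => ?_).trans (h.trans_eq (by simp))
  simpa using le_of_lt (by simpa using hx)

theorem normalCDF_le_exp {z : ℝ} (hz : z ≤ 0) : normalCDF z ≤ Real.exp (-z ^ 2 / 2) := by
  have h := hasSubgaussianMGF_id_gaussianReal.neg.measure_ge_le (neg_nonneg.2 hz)
  refine (measureReal_mono fun x hx => ?_).trans (h.trans_eq (by simp))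
  simpa using hx

/-- The derivatives of order at most three of the normal distribution function. -/
noncomputable def normalDeriv : ℕ → ℝ → ℝ
  | 0, z => normalCDF z
  | 1, z => normalPDF z
  | 2, z => -z * normalPDF z
  | 3, z => (z ^ 2 - 1) * normalPDF z
  | _, _ => 0

theorem hasDerivAt_normalDeriv {r : ℕ} (hr : r ≤ 2) (z : ℝ) :
    HasDerivAt (normalDeriv r) (normalDeriv (r + 1) z) z := by
  interval_cases r
  · exact hasDerivAt_normalCDF z
  · exact hasDerivAt_normalPDF z
  · have := (hasDerivAt_neg z).mul (hasDerivAt_normalPDF z)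
    refine (this.congr_deriv ?_).congr_of_eventuallyEq (Eventually.of_forall fun y => rfl)
    simp only [normalDeriv]
    ring

theorem measurable_normalDeriv (r : ℕ) : Measurable (normalDeriv r) := by
  have h := continuous_normalPDF.measurable
  match r with
  | 0 => exact monotone_normalCDF.measurable
  | 1 => exact h
  | 2 => exact measurable_id.neg.mul h
  | 3 => exact ((measurable_id.pow_const 2).sub_const 1).mul h
  | n + 4 => exact measurable_const

theorem abs_normalDeriv_succ_le (r : ℕ) (z : ℝ) :
    |normalDeriv (r + 1) z| ≤ 8 * (1 + z ^ 2)⁻¹ := by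
  match r with
  | 0 =>
    have := mul_normalPDF_le (z := z) (c := 1) (by simp [sq_nonneg])
    simpa [normalDeriv] using this
  | 1 =>
    refine mul_normalPDF_le (z := z) (c := -z) ?_
    rw [abs_neg, abs_le]
    constructor <;> nlinarith [sq_nonneg (z - 1), sq_nonneg (z + 1)]
  | 2 =>
    refine mul_normalPDF_le (z := z) (c := z ^ 2 - 1) ?_
    rw [abs_le]
    constructor <;> nlinarith [sq_nonneg z]
  | n + 3 => simp only [normalDeriv, abs_zero]; positivity


/-! ### Smoothed indicators of cubes -/

section Box

variable {m : ℕ} {a θ : ℝ}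

/-- The `r`-th derivative of `x ↦ P(|x cos θ + Z sin θ| ≤ a)`, `Z` standard normal. -/
noncomputable def boxDeriv (a θ : ℝ) (r : ℕ) (x : ℝ) : ℝ :=
  (-(Real.cos θ / Real.sin θ)) ^ r *
    (normalDeriv r ((a - x * Real.cos θ) / Real.sin θ) -
      normalDeriv r ((-a - x * Real.cos θ) / Real.sin θ))

/-- A weight concentrated where `|x cos θ|` is within `sin θ` of `a`. -/
noncomputable def layer (a θ x : ℝ) : ℝ :=
  (1 + ((a - x * Real.cos θ) / Real.sin θ) ^ 2)⁻¹ +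
    (1 + ((-a - x * Real.cos θ) / Real.sin θ) ^ 2)⁻¹

theorem layer_nonneg (a θ x : ℝ) : 0 ≤ layer a θ x := by unfold layer; positivity

theorem layer_le_two (a θ x : ℝ) : layer a θ x ≤ 2 := by
  have h : ∀ z : ℝ, (1 + z ^ 2)⁻¹ ≤ 1 := fun z =>
    inv_le_one_of_one_le₀ (by nlinarith [sq_nonneg z])
  unfold layer
  linarith [h ((a - x * Real.cos θ) / Real.sin θ), h ((-a - x * Real.cos θ) / Real.sin θ)]

theorem measurable_layer (a θ : ℝ) : Measurable (layer a θ) := by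
  unfold layer; fun_prop

theorem bddMeas_layer (a θ : ℝ) : BddMeas (layer a θ) :=
  ⟨measurable_layer a θ, 2, fun x => by
    rw [abs_of_nonneg (layer_nonneg a θ x)]; exact layer_le_two a θ x⟩

theorem layer_le_three_mul (hs : 0 < Real.sin θ) (hc : 0 ≤ Real.cos θ) {x y β : ℝ}
    (h : |x - y| ≤ β) (hβ : β * (Real.cos θ / Real.sin θ) ≤ 1) :
    layer a θ y ≤ 3 * layer a θ x := by
  have key : ∀ b : ℝ, |(b - x * Real.cos θ) / Real.sin θ - (b - y * Real.cos θ) / Real.sin θ| ≤ 1 := by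
    intro b
    have : (b - x * Real.cos θ) / Real.sin θ - (b - y * Real.cos θ) / Real.sin θ =
        -((x - y) * (Real.cos θ / Real.sin θ)) := by ring
    rw [this, abs_neg, abs_mul, abs_of_nonneg (div_nonneg hc hs.le)]
    exact (mul_le_mul_of_nonneg_right h (div_nonneg hc hs.le)).trans hβ
  have h1 := inv_one_add_sq_le_three_mul (key a)
  have h2 := inv_one_add_sq_le_three_mul (key (-a))
  unfold layer
  linarith

theorem measurable_boxDeriv (a θ : ℝ) (r : ℕ) : Measurable (boxDeriv a θ r) := by
  have := measurable_normalDeriv r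
  unfold boxDeriv
  fun_prop

theorem abs_boxDeriv_zero_le (a θ x : ℝ) : |boxDeriv a θ 0 x| ≤ 1 := by
  simp only [boxDeriv, pow_zero, one_mul, normalDeriv]
  rw [abs_le]
  constructor <;> linarith [normalCDF_nonneg ((a - x * Real.cos θ) / Real.sin θ),
    normalCDF_le_one ((a - x * Real.cos θ) / Real.sin θ),
    normalCDF_nonneg ((-a - x * Real.cos θ) / Real.sin θ),
    normalCDF_le_one ((-a - x * Real.cos θ) / Real.sin θ)]

theorem abs_boxDeriv_succ_le (hs : 0 < Real.sin θ) (hc : 0 ≤ Real.cos θ) (r : ℕ) (x : ℝ) :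
    |boxDeriv a θ (r + 1) x| ≤ (16 * (Real.cos θ / Real.sin θ)) ^ (r + 1) * layer a θ x := by
  have hk : 0 ≤ Real.cos θ / Real.sin θ := div_nonneg hc hs.le
  rw [boxDeriv, abs_mul, abs_pow, abs_neg, abs_of_nonneg hk, mul_pow, mul_comm ((16 : ℝ) ^ _),
    mul_assoc]
  refine mul_le_mul_of_nonneg_left ?_ (pow_nonneg hk _)
  refine (abs_sub _ _).trans ((add_le_add (abs_normalDeriv_succ_le _ _)
    (abs_normalDeriv_succ_le _ _)).trans ?_)
  rw [← mul_add]
  refine mul_le_mul_of_nonneg_right ?_ (layer_nonneg a θ x)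
  calc (8 : ℝ) ≤ 16 ^ 1 := by norm_num
    _ ≤ 16 ^ (r + 1) := pow_le_pow_right₀ (by norm_num) (by omega)

theorem abs_boxDeriv_le (hs : 0 < Real.sin θ) (hc : 0 ≤ Real.cos θ) (r : ℕ) (x : ℝ) :
    |boxDeriv a θ r x| ≤ (32 * (Real.cos θ / Real.sin θ)) ^ r := by
  rcases r with _ | r
  · simpa using abs_boxDeriv_zero_le a θ x
  · have hk : 0 ≤ Real.cos θ / Real.sin θ := div_nonneg hc hs.le
    refine (abs_boxDeriv_succ_le hs hc r x).trans ?_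
    calc _ ≤ (16 * (Real.cos θ / Real.sin θ)) ^ (r + 1) * 2 ^ (r + 1) := by
          refine mul_le_mul_of_nonneg_left ((layer_le_two a θ x).trans ?_) (by positivity)
          calc (2 : ℝ) = 2 ^ 1 := by norm_num
            _ ≤ 2 ^ (r + 1) := pow_le_pow_right₀ (by norm_num) (by omega)
      _ = _ := by rw [← mul_pow]; ring_nf

theorem hasDerivAt_boxDeriv {r : ℕ} (hr : r ≤ 2) (x : ℝ) :
    HasDerivAt (boxDeriv a θ r) (boxDeriv a θ (r + 1) x) x := by
  have key : ∀ b : ℝ, HasDerivAt (fun x => normalDeriv r ((b - x * Real.cos θ) / Real.sin θ))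
      (-(Real.cos θ / Real.sin θ) * normalDeriv (r + 1) ((b - x * Real.cos θ) / Real.sin θ)) x := by
    intro b
    have h1 : HasDerivAt (fun x : ℝ => (b - x * Real.cos θ) / Real.sin θ)
        (-(Real.cos θ / Real.sin θ)) x :=
      ((((hasDerivAt_id x).mul_const (Real.cos θ)).const_sub b).div_const _).congr_deriv
        (by simp [neg_div])
    exact ((hasDerivAt_normalDeriv hr _).comp x h1).congr_deriv (by ring)
  have := ((key a).sub (key (-a))).const_mul ((-(Real.cos θ / Real.sin θ)) ^ r)
  exact this.congr_deriv (by rw [boxDeriv, pow_succ]; ring)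

/-- Mixed partial derivatives of `x ↦ ∏ l, P(|x l cos θ + Z sin θ| ≤ a)`, of order `v l` in the
`l`-th variable. -/
noncomputable def boxProd (a θ : ℝ) (v : Fin m → ℕ) (x : Fin m → ℝ) : ℝ :=
  ∏ l, boxDeriv a θ (v l) (x l)

theorem bddMeas_boxProd (hs : 0 < Real.sin θ) (hc : 0 ≤ Real.cos θ) (v : Fin m → ℕ) :
    BddMeas (boxProd a θ v) := by
  refine ⟨Finset.measurable_prod _ fun l _ =>
    (measurable_boxDeriv a θ (v l)).comp (measurable_pi_apply l),
    ∏ l, (32 * (Real.cos θ / Real.sin θ)) ^ v l, fun x => ?_⟩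
  rw [boxProd, Finset.abs_prod]
  exact Finset.prod_le_prod (fun _ _ => abs_nonneg _) fun l _ => abs_boxDeriv_le hs hc _ _

theorem abs_boxProd_le (hs : 0 < Real.sin θ) (hc : 0 ≤ Real.cos θ) (v : Fin m → ℕ)
    (x : Fin m → ℝ) :
    |boxProd a θ v x| ≤ (32 * (Real.cos θ / Real.sin θ)) ^ (∑ l, v l) := by
  rw [boxProd, Finset.abs_prod, ← Finset.prod_pow_eq_pow_sum]
  exact Finset.prod_le_prod (fun _ _ => abs_nonneg _) fun l _ => abs_boxDeriv_le hs hc _ _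

theorem abs_boxProd_le_layer (hs : 0 < Real.sin θ) (hc : 0 ≤ Real.cos θ) {v : Fin m → ℕ}
    {j : Fin m} (hj : v j ≠ 0) (x : Fin m → ℝ) :
    |boxProd a θ v x| ≤ (32 * (Real.cos θ / Real.sin θ)) ^ (∑ l, v l) * ∑ l, layer a θ (x l) := by
  have hk : 0 ≤ Real.cos θ / Real.sin θ := div_nonneg hc hs.le
  have h1 : |boxDeriv a θ (v j) (x j)| ≤
      (32 * (Real.cos θ / Real.sin θ)) ^ v j * layer a θ (x j) := by
    obtain ⟨r, hr⟩ := Nat.exists_eq_succ_of_ne_zero hj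
    rw [hr]
    refine (abs_boxDeriv_succ_le hs hc r _).trans
      (mul_le_mul_of_nonneg_right ?_ (layer_nonneg _ _ _))
    exact pow_le_pow_left₀ (by positivity) (by linarith) _
  have h2 : layer a θ (x j) ≤ ∑ l, layer a θ (x l) :=
    Finset.single_le_sum (f := fun l => layer a θ (x l)) (fun l _ => layer_nonneg _ _ _)
      (Finset.mem_univ j)
  rw [boxProd, Finset.abs_prod, ← Finset.mul_prod_erase _ _ (Finset.mem_univ j),
    ← Finset.prod_pow_eq_pow_sum, ← Finset.mul_prod_erase _ _ (Finset.mem_univ j)]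
  have h3 : ∏ l ∈ Finset.univ.erase j, |boxDeriv a θ (v l) (x l)| ≤
      ∏ l ∈ Finset.univ.erase j, (32 * (Real.cos θ / Real.sin θ)) ^ v l :=
    Finset.prod_le_prod (fun _ _ => abs_nonneg _) fun l _ => abs_boxDeriv_le hs hc _ _
  have h4 : 0 ≤ ∏ l ∈ Finset.univ.erase j, (32 * (Real.cos θ / Real.sin θ)) ^ v l :=
    Finset.prod_nonneg fun _ _ => by positivity
  calc _ ≤ ((32 * (Real.cos θ / Real.sin θ)) ^ v j * ∑ l, layer a θ (x l)) *
        ∏ l ∈ Finset.univ.erase j, (32 * (Real.cos θ / Real.sin θ)) ^ v l :=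
        mul_le_mul (h1.trans (mul_le_mul_of_nonneg_left h2 (by positivity))) h3
          (Finset.prod_nonneg fun _ _ => abs_nonneg _)
          (mul_nonneg (by positivity) (Finset.sum_nonneg fun l _ => layer_nonneg _ _ _))
    _ = _ := by ring

theorem hasDerivAt_boxProd_line {v : Fin m → ℕ} (hv : ∀ l, v l ≤ 2)
    (x h : Fin m → ℝ) (s : ℝ) :
    HasDerivAt (fun s : ℝ => boxProd a θ v (x + s • h))
      (∑ l, h l * boxProd a θ (v + Pi.single l 1) (x + s • h)) s := by
  have key : ∀ l ∈ Finset.univ, HasDerivAt (fun s : ℝ => boxDeriv a θ (v l) ((x + s • h) l))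
      (boxDeriv a θ (v l + 1) ((x + s • h) l) * h l) s := by
    intro l _
    have h1 : HasDerivAt (fun s : ℝ => (x + s • h) l) (h l) s := by
      simpa using ((hasDerivAt_id s).mul_const (h l)).const_add (x l)
    exact (hasDerivAt_boxDeriv (hv l) _).comp s h1
  refine (HasDerivAt.fun_finsetProd key).congr_deriv (Finset.sum_congr rfl fun l _ => ?_)
  rw [boxProd, ← Finset.mul_prod_erase _ _ (Finset.mem_univ l), smul_eq_mul]
  have : ∏ k ∈ Finset.univ.erase l, boxDeriv a θ ((v + Pi.single l 1 : Fin m → ℕ) k) ((x + s • h) k) =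
      ∏ k ∈ Finset.univ.erase l, boxDeriv a θ (v k) ((x + s • h) k) :=
    Finset.prod_congr rfl fun k hk => by simp [Finset.ne_of_mem_erase hk]
  rw [this]
  simp only [Pi.add_apply, Pi.single_eq_same]
  ring

theorem exists_sub_eq_deriv {f f' : ℝ → ℝ} (h : ∀ s, HasDerivAt f (f' s) s) {t : ℝ} (ht : 0 < t) :
    ∃ s ∈ Set.Ioo 0 t, f t - f 0 = t * f' s := by
  obtain ⟨c, hc, e⟩ := exists_hasDerivAt_eq_slope f f' ht
    (fun x _ => (h x).continuousAt.continuousWithinAt) (fun x _ => h x)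
  exact ⟨c, hc, by rw [e, sub_zero]; field_simp⟩

/-- Third order bound: partial derivatives on the segment from `x` to `x + h`. -/
theorem abs_boxProd_third_le (hs : 0 < Real.sin θ) (hc : 0 ≤ Real.cos θ) {β : ℝ}
    (hβ : β * (Real.cos θ / Real.sin θ) ≤ 1) (j l k : Fin m) {x h : Fin m → ℝ}
    (hh : ∀ i, |h i| ≤ β) {s : ℝ} (hs0 : 0 ≤ s) (hs1 : s ≤ 1) :
    |boxProd a θ (Pi.single j 1 + Pi.single l 1 + Pi.single k 1) (x + s • h)| ≤
      3 * (32 * (Real.cos θ / Real.sin θ)) ^ 3 * ∑ i, layer a θ (x i) := by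
  have hk : 0 ≤ Real.cos θ / Real.sin θ := div_nonneg hc hs.le
  have h1 := abs_boxProd_le_layer (a := a) hs hc
    (v := Pi.single j 1 + Pi.single l 1 + Pi.single k 1) (j := j) (by simp) (x + s • h)
  have h2 : ∑ i, (Pi.single j 1 + Pi.single l 1 + Pi.single k 1 : Fin m → ℕ) i = 3 := by
    simp [Finset.sum_add_distrib]
  rw [h2] at h1
  refine h1.trans ?_
  rw [mul_comm (3 : ℝ), mul_assoc]
  refine mul_le_mul_of_nonneg_left ?_ (by positivity)
  rw [Finset.mul_sum]
  refine Finset.sum_le_sum fun i _ => layer_le_three_mul hs hc (β := β) ?_ hβ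
  have : x i - (x + s • h) i = -(s * h i) := by simp
  rw [this, abs_neg, abs_mul, abs_of_nonneg hs0]
  exact (mul_le_of_le_one_left (abs_nonneg _) hs1).trans (hh i)

theorem single_add_single_le_two (j l i : Fin m) :
    (Pi.single j 1 + Pi.single l 1 : Fin m → ℕ) i ≤ 2 := by
  simp only [Pi.add_apply, Pi.single_apply]
  split_ifs <;> simp

theorem abs_sum_le_card_mul {β : ℝ} {h c : Fin m → ℝ} {K : ℝ} (hh : ∀ i, |h i| ≤ β)
    (hc : ∀ i, |c i| ≤ K) : |∑ i, h i * c i| ≤ m * β * K := by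
  refine (Finset.abs_sum_le_sum_abs _ _).trans ?_
  calc ∑ i, |h i * c i| ≤ ∑ _i : Fin m, β * K := Finset.sum_le_sum fun i _ => by
        rw [abs_mul]
        exact mul_le_mul (hh i) (hc i) (abs_nonneg _) ((abs_nonneg _).trans (hh i))
    _ = m * β * K := by simp; ring

theorem abs_boxProd_second_sub_le (hs : 0 < Real.sin θ) (hc : 0 ≤ Real.cos θ) {β : ℝ}
    (hβ : β * (Real.cos θ / Real.sin θ) ≤ 1) (j l : Fin m) (x h : Fin m → ℝ)
    (hh : ∀ i, |h i| ≤ β) :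
    |boxProd a θ (Pi.single j 1 + Pi.single l 1) (x + h) -
      boxProd a θ (Pi.single j 1 + Pi.single l 1) x| ≤
      (3 * m * (32 * (Real.cos θ / Real.sin θ)) ^ 3 * ∑ i, layer a θ (x i)) * β := by
  have hk : 0 ≤ Real.cos θ / Real.sin θ := div_nonneg hc hs.le
  obtain ⟨s, hs', e⟩ := exists_sub_eq_deriv (fun s => hasDerivAt_boxProd_line (a := a)
    (single_add_single_le_two j l) x h s) one_pos
  simp only [one_smul, zero_smul, add_zero, one_mul] at e
  rw [e]
  refine (abs_sum_le_card_mul hh fun k =>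
    abs_boxProd_third_le hs hc hβ j l k hh hs'.1.le hs'.2.le).trans_eq (by ring)

theorem abs_boxProd_taylor_le (hs : 0 < Real.sin θ) (hc : 0 ≤ Real.cos θ) {β : ℝ}
    (hβ : β * (Real.cos θ / Real.sin θ) ≤ 1) (j : Fin m) (x h : Fin m → ℝ)
    (hh : ∀ i, |h i| ≤ β) :
    |boxProd a θ (Pi.single j 1) (x + h) - boxProd a θ (Pi.single j 1) x -
      ∑ l, h l * boxProd a θ (Pi.single j 1 + Pi.single l 1) x| ≤
      (3 * m * (32 * (Real.cos θ / Real.sin θ)) ^ 3 * ∑ i, layer a θ (x i)) * ∑ l, h l ^ 2 := by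
  have hk : 0 ≤ Real.cos θ / Real.sin θ := div_nonneg hc hs.le
  set L := 3 * (32 * (Real.cos θ / Real.sin θ)) ^ 3 * ∑ i, layer a θ (x i) with hL
  have hL0 : 0 ≤ L :=
    mul_nonneg (by positivity) (Finset.sum_nonneg fun l _ => layer_nonneg _ _ _)
  obtain ⟨s, hs', e⟩ := exists_sub_eq_deriv (fun s => hasDerivAt_boxProd_line (a := a)
    (v := Pi.single j 1) (fun l => by simp only [Pi.single_apply]; split_ifs <;> simp)
    x h s) one_pos
  simp only [one_smul, zero_smul, add_zero, one_mul] at e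
  rw [e, ← Finset.sum_sub_distrib]
  have key : ∀ l, |boxProd a θ (Pi.single j 1 + Pi.single l 1) (x + s • h) -
      boxProd a θ (Pi.single j 1 + Pi.single l 1) x| ≤ (∑ k, |h k|) * L := by
    intro l
    obtain ⟨s₂, hs₂, e₂⟩ := exists_sub_eq_deriv (fun s => hasDerivAt_boxProd_line (a := a)
      (single_add_single_le_two j l) x h s) hs'.1
    simp only [zero_smul, add_zero] at e₂
    rw [e₂, abs_mul, abs_of_pos hs'.1]
    refine (mul_le_of_le_one_left (abs_nonneg _) hs'.2.le).trans ?_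
    refine (Finset.abs_sum_le_sum_abs _ _).trans ?_
    rw [Finset.sum_mul]
    refine Finset.sum_le_sum fun k _ => ?_
    rw [abs_mul]
    exact mul_le_mul_of_nonneg_left
      (abs_boxProd_third_le hs hc hβ j l k hh hs₂.1.le (hs₂.2.le.trans hs'.2.le)) (abs_nonneg _)
  have h1 : |∑ l, (h l * boxProd a θ (Pi.single j 1 + Pi.single l 1) (x + s • h) -
      h l * boxProd a θ (Pi.single j 1 + Pi.single l 1) x)| ≤ (∑ l, |h l|) ^ 2 * L := by
    refine (Finset.abs_sum_le_sum_abs _ _).trans ?_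
    rw [sq, mul_assoc, Finset.sum_mul]
    refine Finset.sum_le_sum fun l _ => ?_
    rw [← mul_sub, abs_mul]
    exact mul_le_mul_of_nonneg_left (key l) (abs_nonneg _)
  have h2 : (∑ l, |h l|) ^ 2 ≤ m * ∑ l, h l ^ 2 := by
    have := sq_sum_le_card_mul_sum_sq (s := Finset.univ) (f := fun l => |h l|)
    simpa using this
  calc _ ≤ _ := h1
    _ ≤ (m * ∑ l, h l ^ 2) * L := mul_le_mul_of_nonneg_right h2 hL0
    _ = _ := by rw [hL]; ring

end Box

/-! ### A Berry–Esseen bound for cubes -/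

theorem abs_prod_sub_prod_le {κ : Type*} (s : Finset κ) {f g : κ → ℝ} (hf : ∀ i, |f i| ≤ 1)
    (hg : ∀ i, |g i| ≤ 1) : |∏ i ∈ s, f i - ∏ i ∈ s, g i| ≤ ∑ i ∈ s, |f i - g i| := by
  classical
  induction s using Finset.induction_on with
  | empty => simp
  | insert a s ha ih =>
    rw [Finset.prod_insert ha, Finset.prod_insert ha, Finset.sum_insert ha]
    have h1 : |∏ i ∈ s, f i| ≤ 1 := by
      rw [Finset.abs_prod]; exact Finset.prod_le_one (fun _ _ => abs_nonneg _) fun i _ => hf i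
    have e : f a * ∏ i ∈ s, f i - g a * ∏ i ∈ s, g i =
        (f a - g a) * ∏ i ∈ s, f i + g a * (∏ i ∈ s, f i - ∏ i ∈ s, g i) := by ring
    rw [e]
    refine (abs_add_le _ _).trans (add_le_add ?_ ?_)
    · rw [abs_mul]; exact mul_le_of_le_one_right (abs_nonneg _) h1
    · rw [abs_mul]; exact (mul_le_of_le_one_left (abs_nonneg _) (hg a)).trans ih

section Angle

variable {m : ℕ} {a θ : ℝ}

theorem hasDerivAt_boxDeriv_angle (hs : Real.sin θ ≠ 0) (hc : Real.cos θ ≠ 0) (x : ℝ) :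
    HasDerivAt (fun θ => boxDeriv a θ 0 x)
      (Real.tan θ * (boxDeriv a θ 2 x - x * boxDeriv a θ 1 x)) θ := by
  have key : ∀ b : ℝ, HasDerivAt (fun θ => normalCDF ((b - x * Real.cos θ) / Real.sin θ))
      (normalPDF ((b - x * Real.cos θ) / Real.sin θ) *
        ((x - b * Real.cos θ) / Real.sin θ ^ 2)) θ := by
    intro b
    have h1 : HasDerivAt (fun θ => (b - x * Real.cos θ) / Real.sin θ)
        ((x - b * Real.cos θ) / Real.sin θ ^ 2) θ := by
      refine (((((Real.hasDerivAt_cos θ).const_mul x).const_sub b)).fun_div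
        (Real.hasDerivAt_sin θ) hs).congr_deriv ?_
      congr 1
      linear_combination x * Real.sin_sq_add_cos_sq θ
    exact (hasDerivAt_normalCDF _).comp θ h1
  have := (key a).sub (key (-a))
  refine (this.congr_deriv ?_).congr_of_eventuallyEq
    (Eventually.of_forall fun y => by simp [boxDeriv, normalDeriv])
  have e : ∀ b : ℝ, (x - b * Real.cos θ) / Real.sin θ ^ 2 =
      x - Real.cos θ / Real.sin θ * ((b - x * Real.cos θ) / Real.sin θ) := by
    intro b
    field_simp
    linear_combination -x * Real.sin_sq_add_cos_sq θ
  rw [e, e]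
  simp only [boxDeriv, normalDeriv, Real.tan_eq_sin_div_cos]
  generalize normalPDF ((a - x * Real.cos θ) / Real.sin θ) = p
  generalize normalPDF ((-a - x * Real.cos θ) / Real.sin θ) = q
  field_simp
  ring

theorem hasDerivAt_boxProd_angle (hs : Real.sin θ ≠ 0) (hc : Real.cos θ ≠ 0) (x : Fin m → ℝ) :
    HasDerivAt (fun θ => boxProd a θ 0 x)
      (Real.tan θ * ∑ j, (boxProd a θ (Pi.single j 1 + Pi.single j 1) x -
        x j * boxProd a θ (Pi.single j 1) x)) θ := by
  have := HasDerivAt.fun_finsetProd (u := Finset.univ)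
    fun j _ => hasDerivAt_boxDeriv_angle (a := a) hs hc (x j)
  refine this.congr_deriv ?_
  rw [Finset.mul_sum]
  refine Finset.sum_congr rfl fun j _ => ?_
  have e : ∀ v : Fin m → ℕ, (∀ k, k ≠ j → v k = 0) → boxProd a θ v x =
      boxDeriv a θ (v j) (x j) * ∏ k ∈ Finset.univ.erase j, boxDeriv a θ 0 (x k) := by
    intro v hv
    rw [boxProd, ← Finset.mul_prod_erase _ _ (Finset.mem_univ j)]
    congr 1
    exact Finset.prod_congr rfl fun k hk => by rw [hv k (Finset.ne_of_mem_erase hk)]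
  rw [e _ fun k hk => by simp [hk], e (Pi.single j 1) fun k hk => by simp [hk]]
  simp only [Pi.add_apply, Pi.single_eq_same, smul_eq_mul]
  ring

theorem continuousAt_boxProd_angle (hs : Real.sin θ ≠ 0) (x : Fin m → ℝ) :
    ContinuousAt (fun θ => boxProd a θ 0 x) θ := by
  have hC : Continuous normalCDF :=
    continuous_iff_continuousAt.2 fun z => (hasDerivAt_normalCDF z).continuousAt
  simp only [boxProd, boxDeriv, Pi.zero_apply, pow_zero, one_mul, normalDeriv]
  refine tendsto_finsetProd _ fun j _ => ?_
  have key : ∀ b : ℝ, ContinuousAt (fun θ => normalCDF ((b - x j * Real.cos θ) / Real.sin θ)) θ :=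
    fun b => hC.continuousAt.comp (ContinuousAt.div (by fun_prop) (by fun_prop) hs)
  exact (key a).sub (key (-a))

theorem abs_boxProd_zero_le (x : Fin m → ℝ) : |boxProd a θ 0 x| ≤ 1 := by
  rw [boxProd, Finset.abs_prod]
  exact Finset.prod_le_one (fun _ _ => abs_nonneg _) fun l _ => abs_boxDeriv_zero_le _ _ _

theorem abs_indicator_sub_boxDeriv_le (ha : 0 ≤ a) (hs : 0 < Real.sin θ) (x : ℝ) :
    |(if |x * Real.cos θ| ≤ a then 1 else 0) - boxDeriv a θ 0 x| ≤ 8 * layer a θ x := by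
  set y := x * Real.cos θ with hy
  have e : (if |y| ≤ a then (1 : ℝ) else 0) = (if y ≤ a then 1 else 0) - if y < -a then 1 else 0 := by
    by_cases h1 : y ≤ a <;> by_cases h2 : y < -a
    · simp [h1, h2, abs_le, not_le.2 h2]
    · simp [h1, h2, abs_le, not_lt.1 h2]
    · exact absurd (h2.le.trans (by linarith)) h1
    · simp [h1, h2, abs_le]
  have h1 : |(if y ≤ a then (1 : ℝ) else 0) - normalCDF ((a - y) / Real.sin θ)| ≤
      8 * (1 + ((a - y) / Real.sin θ) ^ 2)⁻¹ := by
    refine le_trans ?_ (exp_neg_sq_le _)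
    split_ifs with h
    · rw [abs_of_nonneg (by linarith [normalCDF_le_one ((a - y) / Real.sin θ)])]
      exact one_sub_normalCDF_le (div_nonneg (by linarith) hs.le)
    · rw [zero_sub, abs_neg, abs_of_nonneg (normalCDF_nonneg _)]
      exact normalCDF_le_exp (div_nonpos_of_nonpos_of_nonneg (by linarith) hs.le)
  have h2 : |(if y < -a then (1 : ℝ) else 0) - normalCDF ((-a - y) / Real.sin θ)| ≤
      8 * (1 + ((-a - y) / Real.sin θ) ^ 2)⁻¹ := by
    refine le_trans ?_ (exp_neg_sq_le _)
    split_ifs with h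
    · rw [abs_of_nonneg (by linarith [normalCDF_le_one ((-a - y) / Real.sin θ)])]
      exact one_sub_normalCDF_le (div_nonneg (by linarith) hs.le)
    · rw [zero_sub, abs_neg, abs_of_nonneg (normalCDF_nonneg _)]
      exact normalCDF_le_exp (div_nonpos_of_nonpos_of_nonneg (by linarith) hs.le)
  rw [e]
  simp only [boxDeriv, pow_zero, one_mul, normalDeriv, layer, ← hy]
  have := (abs_sub _ _).trans (add_le_add h1 h2)
  rw [mul_add]
  refine le_trans (le_of_eq ?_) this
  congr 1
  ring

end Angle

/-- The probability that a standard normal vector lies in the cube of half side `a`. -/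
noncomputable def cubeProb (m : ℕ) (a : ℝ) : ℝ := (normalCDF a - normalCDF (-a)) ^ m

theorem abs_normalCDF_sub_le_one (x y : ℝ) : |normalCDF x - normalCDF y| ≤ 1 := by
  rw [abs_le]
  constructor <;> linarith [normalCDF_nonneg x, normalCDF_le_one x, normalCDF_nonneg y,
    normalCDF_le_one y]

theorem abs_cubeProb_sub_le (m : ℕ) (a b : ℝ) :
    |cubeProb m a - cubeProb m b| ≤
      m * (|normalCDF a - normalCDF b| + |normalCDF (-a) - normalCDF (-b)|) := by
  have := abs_prod_sub_prod_le (Finset.univ : Finset (Fin m))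
    (f := fun _ => normalCDF a - normalCDF (-a)) (g := fun _ => normalCDF b - normalCDF (-b))
    (fun _ => abs_normalCDF_sub_le_one _ _) (fun _ => abs_normalCDF_sub_le_one _ _)
  simp only [Finset.prod_const, Finset.card_univ, Fintype.card_fin, Finset.sum_const,
    nsmul_eq_mul] at this
  refine this.trans (mul_le_mul_of_nonneg_left ?_ (Nat.cast_nonneg m))
  have e : normalCDF a - normalCDF (-a) - (normalCDF b - normalCDF (-b)) =
    (normalCDF a - normalCDF b) - (normalCDF (-a) - normalCDF (-b)) := by ring
  rw [e]
  exact abs_sub _ _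

theorem abs_normalCDF_sub_le {a b C : ℝ} (h : ∀ x ∈ Set.uIoc a b, normalPDF x ≤ C) :
    |normalCDF b - normalCDF a| ≤ C * |b - a| := by
  rw [normalCDF_sub, ← Real.norm_eq_abs]
  refine intervalIntegral.norm_integral_le_of_norm_le_const fun x hx => ?_
  rw [Real.norm_of_nonneg (normalPDF_nonneg x)]
  exact h x hx

theorem abs_cubeProb_sub_le_abs_sub (m : ℕ) (a b : ℝ) :
    |cubeProb m a - cubeProb m b| ≤ 2 * m * |a - b| := by
  refine (abs_cubeProb_sub_le m a b).trans ?_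
  have h1 := abs_normalCDF_sub_le (a := b) (b := a) (C := 1) fun x _ => normalPDF_le_one x
  have h2 := abs_normalCDF_sub_le (a := -b) (b := -a) (C := 1) fun x _ => normalPDF_le_one x
  have e : -a - -b = -(a - b) := by ring
  rw [e, abs_neg] at h2
  nlinarith [mul_le_mul_of_nonneg_left (add_le_add h1 h2) (Nat.cast_nonneg (α := ℝ) m)]

theorem abs_cubeProb_sub_mul_le (m : ℕ) {a c β : ℝ} (ha : 0 ≤ a) (hc : 0 < c) (hc1 : c ≤ 1)
    (hβ : 1 / c ≤ 1 + β) : |cubeProb m a - cubeProb m (a * c)| ≤ 16 * m * β := by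
  refine (abs_cubeProb_sub_le m a (a * c)).trans ?_
  have hac : a * c ≤ a := mul_le_of_le_one_right ha hc1
  have hac0 : 0 ≤ a * c := mul_nonneg ha hc.le
  have key : ∀ x : ℝ, (a * c) ^ 2 ≤ x ^ 2 → normalPDF x ≤ 8 * (1 + (a * c) ^ 2)⁻¹ := fun x hx =>
    (normalPDF_le_exp x).trans ((exp_neg_sq_le x).trans (by gcongr))
  have hd : a - a * c ≤ a * c * β := by
    have : a * c * (1 / c) ≤ a * c * (1 + β) := mul_le_mul_of_nonneg_left hβ hac0
    have e : a * c * (1 / c) = a := by field_simp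
    linarith
  have hβ0 : 0 ≤ β := by
    have : 1 ≤ 1 / c := by rw [le_div_iff₀ hc]; linarith
    linarith
  have hfin : 8 * (1 + (a * c) ^ 2)⁻¹ * |a - a * c| ≤ 8 * β := by
    rw [abs_of_nonneg (by linarith), mul_assoc]
    refine mul_le_mul_of_nonneg_left ?_ (by norm_num)
    rw [inv_mul_eq_div, div_le_iff₀ (by positivity)]
    nlinarith [sq_nonneg (a * c - 1), mul_nonneg hβ0 (sq_nonneg (a * c - 1))]
  have h1 := abs_normalCDF_sub_le (a := a * c) (b := a) (C := 8 * (1 + (a * c) ^ 2)⁻¹)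
    fun x hx => by
      rw [Set.uIoc_of_le hac] at hx
      exact key x (pow_le_pow_left₀ hac0 hx.1.le 2)
  have h2 := abs_normalCDF_sub_le (a := -(a * c)) (b := -a) (C := 8 * (1 + (a * c) ^ 2)⁻¹)
    fun x hx => by
      rw [Set.uIoc_of_ge (by linarith)] at hx
      refine key x ?_
      nlinarith [hx.2]
  have e : -a - -(a * c) = -(a - a * c) := by ring
  rw [e, abs_neg] at h2
  nlinarith [mul_le_mul_of_nonneg_left (add_le_add (h1.trans hfin) (h2.trans hfin))
    (Nat.cast_nonneg (α := ℝ) m)]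


section BerryEsseen

variable {Ω : Type*} [MeasurableSpace Ω] {P : Measure Ω}
  {ι : Type*} [Fintype ι] {m : ℕ}

/-- A family of independent centred random vectors, bounded by `β`, whose sum has identity
covariance matrix. -/
structure StdSum (P : Measure Ω) (ξ : ι → Ω → Fin m → ℝ) (β : ℝ) : Prop where
  meas : ∀ i, Measurable (ξ i)
  indep : iIndepFun ξ P
  bound : ∀ i ω j, |ξ i ω j| ≤ β
  mean : ∀ i j, ∫ ω, ξ i ω j ∂P = 0
  cov : ∀ j l, ∑ i, ∫ ω, ξ i ω j * ξ i ω l ∂P = if j = l then 1 else 0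

variable {ξ : ι → Ω → Fin m → ℝ} {β : ℝ}

theorem StdSum.measurable_sum (h : StdSum P ξ β) : Measurable fun ω => ∑ k, ξ k ω :=
  Finset.measurable_sum _ fun i _ => h.meas i

theorem StdSum.bddMeas_sum (h : StdSum P ξ β) (j : Fin m) : BddMeas fun ω => (∑ k, ξ k ω) j := by
  have := BddMeas.sum (Finset.univ : Finset ι) (f := fun i ω => ξ i ω j) fun i =>
    ⟨(measurable_pi_apply j).comp (h.meas i), β, fun ω => h.bound i ω j⟩
  simpa only [Finset.sum_apply] using this

theorem StdSum.integral_layer_le [IsProbabilityMeasure P] (h : StdSum P ξ β) {θ : ℝ} (hs : 0 < Real.sin θ)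
    (hc : 0 < Real.cos θ) (hβ : β ≤ Real.tan θ) (a : ℝ) (j : Fin m) :
    ∫ ω, layer a θ ((∑ k, ξ k ω) j) ∂P ≤ 30 * Real.tan θ := by
  have ht : 0 < Real.tan θ := by rw [Real.tan_eq_sin_div_cos]; positivity
  have key : ∀ b : ℝ, ∫ ω, (1 + ((b - (∑ k, ξ k ω) j * Real.cos θ) / Real.sin θ) ^ 2)⁻¹ ∂P ≤
      15 * Real.tan θ := by
    intro b
    have := integral_inv_one_add_sq_le (P := P) (ξ := fun i ω => ξ i ω j)
      (fun i => (measurable_pi_apply j).comp (h.meas i))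
      (h.indep.comp (fun _ x => x j) fun _ => measurable_pi_apply j) (fun i ω => h.bound i ω j)
      (fun i => h.mean i j) (by simpa [sq] using h.cov j j) ht hβ (b / Real.cos θ)
    refine le_trans (le_of_eq (integral_congr_ae (ae_of_all _ fun ω => ?_))) this
    simp only [Finset.sum_apply, Real.tan_eq_sin_div_cos]
    congr 2
    rw [← neg_sq]
    congr 1
    field_simp
    ring
  have hm : Measurable fun ω => (∑ k, ξ k ω) j := (measurable_pi_apply j).comp h.measurable_sum
  have hb : ∀ b : ℝ, BddMeas fun y : ℝ => (1 + ((b - y * Real.cos θ) / Real.sin θ) ^ 2)⁻¹ :=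
    fun b => by
      refine ⟨by fun_prop, 1, fun y => ?_⟩
      rw [abs_of_pos (by positivity)]
      exact inv_le_one_of_one_le₀ (by nlinarith [sq_nonneg ((b - y * Real.cos θ) / Real.sin θ)])
  have hi : ∀ b : ℝ, Integrable
      (fun ω => (1 + ((b - (∑ k, ξ k ω) j * Real.cos θ) / Real.sin θ) ^ 2)⁻¹) P :=
    fun b => ((hb b).comp hm).integrable P
  unfold layer
  rw [integral_add (hi a) (hi (-a))]
  linarith [key a, key (-a)]

theorem StdSum.abs_integral_boxProd_deriv_le [IsProbabilityMeasure P] (h : StdSum P ξ β) {θ : ℝ} (hs : 0 < Real.sin θ)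
    (hc : 0 < Real.cos θ) (hβ : β ≤ Real.tan θ) (a : ℝ) :
    |∫ ω, ∑ j, (boxProd a θ (Pi.single j 1 + Pi.single j 1) (∑ k, ξ k ω) -
        (∑ k, ξ k ω) j * boxProd a θ (Pi.single j 1) (∑ k, ξ k ω)) ∂P| ≤
      17694720 * m ^ 4 * β * (Real.cos θ / Real.sin θ) ^ 2 := by
  set q := Real.cos θ / Real.sin θ with hq
  have hq0 : 0 < q := by positivity
  have htq : Real.tan θ = q⁻¹ := by rw [hq, Real.tan_eq_sin_div_cos, inv_div]
  have hβq : β * q ≤ 1 := by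
    rw [htq] at hβ
    calc β * q ≤ q⁻¹ * q := mul_le_mul_of_nonneg_right hβ hq0.le
      _ = 1 := inv_mul_cancel₀ hq0.ne'
  have bL : ∀ i : Fin m, BddMeas fun x : Fin m → ℝ => layer a θ (x i) := fun i =>
    (bddMeas_layer a θ).comp (measurable_pi_apply i)
  have bK : BddMeas fun x : Fin m → ℝ => 3 * m * (32 * q) ^ 3 * ∑ i, layer a θ (x i) :=
    (BddMeas.const _).mul (BddMeas.sum _ bL)
  have hκ : ∀ i, ∫ ω, 3 * m * (32 * q) ^ 3 *
      ∑ j, layer a θ (((∑ k, ξ k ω) - ξ i ω) j) ∂P ≤ 8847360 * m ^ 2 * q ^ 2 := by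
    intro i
    have bV : ∀ j, BddMeas fun ω => layer a θ (((∑ k, ξ k ω) - ξ i ω) j) := fun j =>
      (bL j).comp (h.measurable_sum.sub (h.meas i))
    have h1 : ∀ j, ∫ ω, layer a θ (((∑ k, ξ k ω) - ξ i ω) j) ∂P ≤ 90 * q⁻¹ := by
      intro j
      have : ∫ ω, layer a θ (((∑ k, ξ k ω) - ξ i ω) j) ∂P ≤
          ∫ ω, 3 * layer a θ ((∑ k, ξ k ω) j) ∂P := by
        refine integral_mono ((bV j).integrable P)
          ((((bL j).comp h.measurable_sum).integrable P).const_mul 3) fun ω => ?_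
        refine layer_le_three_mul hs hc.le (β := β) ?_ hβq
        simpa using h.bound i ω j
      refine this.trans ?_
      rw [integral_const_mul, ← htq]
      linarith [h.integral_layer_le hs hc hβ a j]
    rw [integral_const_mul, integral_finsetSum _ fun j _ => (bV j).integrable P]
    calc _ ≤ 3 * m * (32 * q) ^ 3 * ∑ _j : Fin m, 90 * q⁻¹ :=
          mul_le_mul_of_nonneg_left (Finset.sum_le_sum fun j _ => h1 j) (by positivity)
      _ = _ := by
          simp only [Finset.sum_const, Finset.card_univ, Fintype.card_fin, nsmul_eq_mul]
          field_simp
          ring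
  have := abs_integral_stein_le (P := P) h.meas h.indep h.bound h.mean h.cov
    (u1 := fun j => boxProd a θ (Pi.single j 1))
    (u2 := fun j l => boxProd a θ (Pi.single j 1 + Pi.single l 1))
    (K := fun x => 3 * m * (32 * q) ^ 3 * ∑ i, layer a θ (x i))
    (fun j => bddMeas_boxProd hs hc.le _) (fun j l => bddMeas_boxProd hs hc.le _) bK
    (fun j x h hh => abs_boxProd_taylor_le hs hc.le hβq j x h hh)
    (fun j l x h hh => abs_boxProd_second_sub_le hs hc.le hβq j l x h hh) hκ
  refine this.trans (le_of_eq ?_)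
  ring

theorem abs_tan_mul_sum_boxProd_le {a θ t : ℝ} (hs : 0 < Real.sin θ)
    (ht : Real.sin θ / 2 < Real.sin t) (hct : 0 < Real.cos t) (x : Fin m → ℝ) :
    |Real.tan t * ∑ j, (boxProd a t (Pi.single j 1 + Pi.single j 1) x -
        x j * boxProd a t (Pi.single j 1) x)| ≤ ∑ j, (2048 / Real.sin θ + 32 * |x j|) := by
  have hst : 0 < Real.sin t := by linarith
  have h1 : ∀ j : Fin m, |boxProd a t (Pi.single j 1 + Pi.single j 1) x| ≤
      (32 * (Real.cos t / Real.sin t)) ^ 2 := fun j => by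
    have := abs_boxProd_le (a := a) hst hct.le (Pi.single j 1 + Pi.single j 1) x
    simpa [Finset.sum_add_distrib] using this
  have h2 : ∀ j : Fin m, |boxProd a t (Pi.single j 1) x| ≤
      32 * (Real.cos t / Real.sin t) := fun j => by
    have := abs_boxProd_le (a := a) hst hct.le (Pi.single j 1) x
    simpa using this
  rw [Finset.mul_sum]
  refine (Finset.abs_sum_le_sum_abs _ _).trans (Finset.sum_le_sum fun j _ => ?_)
  have htan : 0 < Real.tan t := by rw [Real.tan_eq_sin_div_cos]; positivity
  rw [abs_mul, abs_of_pos htan]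
  calc _ ≤ Real.tan t * ((32 * (Real.cos t / Real.sin t)) ^ 2 +
        |x j| * (32 * (Real.cos t / Real.sin t))) := by
        refine mul_le_mul_of_nonneg_left ((abs_sub _ _).trans (add_le_add (h1 j) ?_)) htan.le
        rw [abs_mul]
        exact mul_le_mul_of_nonneg_left (h2 j) (abs_nonneg _)
    _ = 1024 * (Real.cos t / Real.sin t) + 32 * |x j| := by
        rw [Real.tan_eq_sin_div_cos]; field_simp
        ring
    _ ≤ _ := by
        have : Real.cos t / Real.sin t ≤ 2 / Real.sin θ := by
          rw [div_le_div_iff₀ hst hs]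
          nlinarith [Real.cos_le_one t]
        have e : 1024 * (2 / Real.sin θ) = 2048 / Real.sin θ := by ring
        linarith

theorem hasDerivAt_integral_boxProd [IsFiniteMeasure P] {W : Ω → Fin m → ℝ} (hW : Measurable W)
    (bW : ∀ j, BddMeas fun ω => W ω j) {θ : ℝ} (hs : 0 < Real.sin θ)
    (hc : 0 < Real.cos θ) (a : ℝ) :
    HasDerivAt (fun θ => ∫ ω, boxProd a θ 0 (W ω) ∂P)
      (Real.tan θ * ∫ ω, ∑ j, (boxProd a θ (Pi.single j 1 + Pi.single j 1) (W ω) -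
        W ω j * boxProd a θ (Pi.single j 1) (W ω)) ∂P) θ := by
  have hS : ∀ᶠ t in 𝓝 θ, Real.sin θ / 2 < Real.sin t ∧ 0 < Real.cos t :=
    (Real.continuous_sin.continuousAt.eventually_const_lt (by linarith)).and
      (Real.continuous_cos.continuousAt.eventually_const_lt hc)
  obtain ⟨S, hSθ, hS⟩ := eventually_iff_exists_mem.1 hS
  have hS0 : ∀ t ∈ S, 0 < Real.sin t := fun t ht => by linarith [(hS t ht).1]
  have hS1 : ∀ t ∈ S, 0 < Real.cos t := fun t ht => (hS t ht).2
  have hθS : θ ∈ S := mem_of_mem_nhds hSθ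
  have bU : ∀ t ∈ S, ∀ v : Fin m → ℕ, BddMeas fun ω => boxProd a t v (W ω) :=
    fun t ht v => (bddMeas_boxProd (hS0 t ht) (hS1 t ht).le v).comp hW
  have bF' : BddMeas fun ω => Real.tan θ *
      ∑ j, (boxProd a θ (Pi.single j 1 + Pi.single j 1) (W ω) -
        W ω j * boxProd a θ (Pi.single j 1) (W ω)) :=
    (BddMeas.const _).mul (BddMeas.sum _ fun j => (bU θ hθS _).sub ((bW j).mul (bU θ hθS _)))
  have bB : BddMeas fun ω => ∑ j : Fin m, (2048 / Real.sin θ + 32 * |W ω j|) :=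
    BddMeas.sum _ fun j => (BddMeas.const _).add ((BddMeas.const _).mul (bW j).abs)
  rw [← integral_const_mul]
  have hd : ∀ ω, ∀ t ∈ S, HasDerivAt (fun t => boxProd a t 0 (W ω)) (Real.tan t *
      ∑ j, (boxProd a t (Pi.single j 1 + Pi.single j 1) (W ω) -
        W ω j * boxProd a t (Pi.single j 1) (W ω))) t := fun ω t ht =>
    hasDerivAt_boxProd_angle (hS0 t ht).ne' (hS1 t ht).ne' _
  have hb : ∀ ω, ∀ t ∈ S, |Real.tan t *
      ∑ j, (boxProd a t (Pi.single j 1 + Pi.single j 1) (W ω) -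
        W ω j * boxProd a t (Pi.single j 1) (W ω))| ≤
      ∑ j : Fin m, (2048 / Real.sin θ + 32 * |W ω j|) := fun ω t ht =>
    abs_tan_mul_sum_boxProd_le hs (hS t ht).1 (hS t ht).2 _
  have hm0 : ∀ᶠ t in 𝓝 θ, AEStronglyMeasurable (fun ω => boxProd a t 0 (W ω)) P :=
    eventually_of_mem hSθ fun t ht => (bU t ht 0).1.aestronglyMeasurable
  have i0 := (bU θ hθS 0).integrable P
  have hm1 := bF'.1.aestronglyMeasurable (μ := P)
  have iB := bB.integrable P
  exact (hasDerivAt_integral_of_dominated_loc_of_deriv_le hSθ hm0 i0 hm1 (ae_of_all _ hb)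
    iB (ae_of_all _ hd)).2

/-- Comparison of the smoothed cube probability with the normal one. -/
theorem StdSum.abs_integral_boxProd_sub_le [IsProbabilityMeasure P] (h : StdSum P ξ β) (hβ0 : 0 < β) (hβ1 : β ≤ 1)
    (a : ℝ) :
    |(∫ ω, boxProd a (Real.arctan β) 0 (∑ k, ξ k ω) ∂P) - cubeProb m a| ≤
      17694720 * m ^ 4 * β * (1 + Real.log (1 / β)) := by
  set ε := Real.arctan β with hε
  have hε0 : 0 < ε := Real.arctan_pos.2 hβ0
  have hε1 : ε < Real.pi / 2 := Real.arctan_lt_pi_div_two β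
  have hsin : ∀ x ∈ Set.Icc ε (Real.pi / 2), 0 < Real.sin x := fun x hx =>
    Real.sin_pos_of_pos_of_lt_pi (hε0.trans_le hx.1) (by linarith [hx.2, Real.pi_pos])
  have hcos : ∀ x ∈ Set.Ico ε (Real.pi / 2), 0 < Real.cos x := fun x hx =>
    Real.cos_pos_of_mem_Ioo ⟨by linarith [hx.1, Real.pi_pos], hx.2⟩
  set F : ℝ → ℝ := fun θ => ∫ ω, boxProd a θ 0 (∑ k, ξ k ω) ∂P with hF
  set C : ℝ := 17694720 * m ^ 4 * β with hC
  have hC0 : 0 ≤ C := by positivity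
  have hcont : ContinuousOn F (Set.Icc ε (Real.pi / 2)) := by
    refine continuousOn_of_dominated (bound := fun _ => (1 : ℝ)) (fun x hx => ?_)
      (fun x hx => ae_of_all _ fun ω => abs_boxProd_zero_le _) (integrable_const _)
      (ae_of_all _ fun ω x hx => (continuousAt_boxProd_angle (hsin x hx).ne' _).continuousWithinAt)
    exact (Measurable.comp (Finset.measurable_prod _ fun l _ =>
      (measurable_boxDeriv a x _).comp (measurable_pi_apply l)) h.measurable_sum).aestronglyMeasurable
  have hder := image_norm_le_of_norm_deriv_right_le_deriv_boundary' (a := ε) (b := Real.pi / 2)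
    (f := fun x => F x - F ε)
    (f' := fun θ => Real.tan θ *
      ∫ ω, ∑ j, (boxProd a θ (Pi.single j 1 + Pi.single j 1) (∑ k, ξ k ω) -
        (∑ k, ξ k ω) j * boxProd a θ (Pi.single j 1) (∑ k, ξ k ω)) ∂P)
    (B := fun x => C * (Real.log (Real.sin x) - Real.log (Real.sin ε)))
    (B' := fun x => C * (Real.cos x / Real.sin x))
    (hcont.sub continuousOn_const)
    (fun x hx => ((hasDerivAt_integral_boxProd h.measurable_sum h.bddMeas_sum (hsin x ⟨hx.1, hx.2.le⟩)
      (hcos x hx) a).sub_const (F ε)).hasDerivWithinAt)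
    (by simp)
    (fun x hx => ((((Real.hasDerivAt_sin x).log (hsin x hx).ne').sub_const
      _).const_mul C).continuousAt.continuousWithinAt)
    (fun x hx => ((((Real.hasDerivAt_sin x).log (hsin x ⟨hx.1, hx.2.le⟩).ne').sub_const
      _).const_mul C).hasDerivWithinAt)
    (fun x hx => ?_) (Set.right_mem_Icc.2 hε1.le)
  · have hF1 : F (Real.pi / 2) = cubeProb m a := by
      simp [hF, boxProd, boxDeriv, cubeProb, normalDeriv]
    simp only [hF1, Real.sin_pi_div_two, Real.log_one, zero_sub, Real.norm_eq_abs] at hder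
    rw [abs_sub_comm]
    refine hder.trans (mul_le_mul_of_nonneg_left ?_ hC0)
    have hsq : √(1 + β ^ 2) ≤ 2 := by
      rw [Real.sqrt_le_left (by norm_num)]; nlinarith
    rw [hε, Real.sin_arctan, Real.log_div hβ0.ne' (by positivity), one_div, Real.log_inv]
    have : Real.log √(1 + β ^ 2) ≤ 1 := by
      refine (Real.log_le_sub_one_of_pos (by positivity)).trans (by linarith)
    linarith
  · have hs := hsin x ⟨hx.1, hx.2.le⟩
    have hc := hcos x hx
    have ht : 0 < Real.tan x := by rw [Real.tan_eq_sin_div_cos]; positivity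
    have hβt : β ≤ Real.tan x := by
      have h1 : Real.tan ε = β := Real.tan_arctan β
      rw [← h1]
      exact Real.strictMonoOn_tan.monotoneOn ⟨by linarith, hε1⟩
        ⟨by linarith [hx.1], hx.2⟩ hx.1
    rw [Real.norm_eq_abs, abs_mul, abs_of_pos ht]
    refine (mul_le_mul_of_nonneg_left (h.abs_integral_boxProd_deriv_le hs hc hβt a)
      ht.le).trans (le_of_eq ?_)
    rw [hC, Real.tan_eq_sin_div_cos]
    field_simp

/-- **Berry–Esseen bound for cubes**, with a logarithmic factor. -/
theorem StdSum.abs_prob_cube_sub_le [IsProbabilityMeasure P] (h : StdSum P ξ β) (hβ0 : 0 < β) (hβ1 : β ≤ 1)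
    {a : ℝ} (ha : 0 ≤ a) :
    |P.real {ω | ∀ j, |(∑ k, ξ k ω) j| ≤ a} - cubeProb m a| ≤
      20000000 * m ^ 4 * β * (1 + Real.log (1 / β)) := by
  set ε := Real.arctan β with hε
  have hs : 0 < Real.sin ε := by rw [hε, Real.sin_arctan]; positivity
  have hc : 0 < Real.cos ε := Real.cos_arctan_pos β
  have ht : Real.tan ε = β := Real.tan_arctan β
  set b := a * Real.cos ε with hb
  have hb0 : 0 ≤ b := by positivity
  have h1 := h.abs_integral_boxProd_sub_le hβ0 hβ1 b
  have hcε : 1 / Real.cos ε ≤ 1 + β := by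
    rw [hε, Real.cos_arctan, one_div_one_div, Real.sqrt_le_left (by linarith)]
    nlinarith
  have h2 := abs_cubeProb_sub_mul_le m ha hc (Real.cos_le_one _) hcε
  have hset : MeasurableSet {ω | ∀ j, |(∑ k, ξ k ω) j| ≤ a} := by
    have : {ω | ∀ j, |(∑ k, ξ k ω) j| ≤ a} = ⋂ j, {ω | |(∑ k, ξ k ω) j| ≤ a} := by
      ext; simp
    rw [this]
    exact MeasurableSet.iInter fun j => measurableSet_le
      ((continuous_abs.comp (continuous_apply j)).measurable.comp h.measurable_sum) measurable_const
  have h3 : |P.real {ω | ∀ j, |(∑ k, ξ k ω) j| ≤ a} -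
      ∫ ω, boxProd b ε 0 (∑ k, ξ k ω) ∂P| ≤ 240 * m * β := by
    have bP : BddMeas fun ω => boxProd b ε 0 (∑ k, ξ k ω) :=
      (bddMeas_boxProd hs hc.le 0).comp h.measurable_sum
    have bL : ∀ j : Fin m, BddMeas fun ω => layer b ε ((∑ k, ξ k ω) j) := fun j =>
      (bddMeas_layer b ε).comp ((measurable_pi_apply j).comp h.measurable_sum)
    have hI : Integrable ({ω | ∀ j, |(∑ k, ξ k ω) j| ≤ a}.indicator (1 : Ω → ℝ)) P :=
      (integrable_const (1 : ℝ)).indicator hset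
    rw [← integral_indicator_one hset, ← integral_sub hI (bP.integrable P)]
    refine abs_integral_le_integral_abs.trans ?_
    have : ∫ ω, |{ω | ∀ j, |(∑ k, ξ k ω) j| ≤ a}.indicator 1 ω - boxProd b ε 0 (∑ k, ξ k ω)| ∂P ≤
        ∫ ω, ∑ j, 8 * layer b ε ((∑ k, ξ k ω) j) ∂P := by
      refine integral_mono (hI.sub (bP.integrable P)).abs
        ((BddMeas.sum _ fun j => (BddMeas.const 8).mul (bL j)).integrable P) fun ω => ?_
      have e : {ω | ∀ j, |(∑ k, ξ k ω) j| ≤ a}.indicator (1 : Ω → ℝ) ω =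
          ∏ j, if |(∑ k, ξ k ω) j * Real.cos ε| ≤ b then (1 : ℝ) else 0 := by
        have hiff : ∀ j, |(∑ k, ξ k ω) j * Real.cos ε| ≤ b ↔ |(∑ k, ξ k ω) j| ≤ a := fun j => by
          rw [abs_mul, abs_of_pos hc, hb]
          exact mul_le_mul_iff_left₀ hc
        simp only [hiff, Set.indicator_apply, Set.mem_ofPred_eq, Pi.one_apply]
        rw [Finset.prod_ite_zero]
        simp
      simp only [e]
      rw [boxProd]
      refine (abs_prod_sub_prod_le _ (fun j => ?_) fun j => abs_boxDeriv_zero_le _ _ _).trans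
        (Finset.sum_le_sum fun j _ => abs_indicator_sub_boxDeriv_le hb0 hs _)
      split_ifs <;> simp
    refine this.trans ?_
    rw [integral_finsetSum _ fun j _ => ((BddMeas.const 8).mul (bL j)).integrable P]
    calc _ ≤ ∑ _j : Fin m, 8 * (30 * β) := Finset.sum_le_sum fun j _ => by
          rw [integral_const_mul]
          refine mul_le_mul_of_nonneg_left ?_ (by norm_num)
          have := h.integral_layer_le hs hc ht.ge b j
          rwa [ht] at this
      _ = _ := by simp; ring
  have hm4 : (m : ℝ) ≤ m ^ 4 := by exact_mod_cast Nat.le_self_pow (by norm_num) m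
  have hlog : 0 ≤ Real.log (1 / β) := Real.log_nonneg (by rw [le_div_iff₀ hβ0]; linarith)
  have hfin : (m : ℝ) * β ≤ m ^ 4 * β * (1 + Real.log (1 / β)) := by
    have : (m : ℝ) * β ≤ m ^ 4 * β := mul_le_mul_of_nonneg_right hm4 hβ0.le
    nlinarith [mul_nonneg (by positivity : 0 ≤ (m : ℝ) ^ 4 * β) hlog]
  rw [abs_le] at *
  constructor <;> nlinarith [h1.1, h1.2, h2.1, h2.2, h3.1, h3.2]

end BerryEsseen

/-! ### Inverse square roots of symmetric matrices -/

section Matrices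

variable {m : ℕ} {A B M : Matrix (Fin m) (Fin m) ℝ} {c : ℝ}

theorem exists_eigenvector {x : ℝ} (hx : x ∈ spectrum ℝ M) : ∃ v ≠ 0, M *ᵥ v = x • v := by
  have h : ¬ IsUnit (algebraMap ℝ (Matrix (Fin m) (Fin m) ℝ) x - M) := hx
  rw [Matrix.isUnit_iff_isUnit_det, isUnit_iff_ne_zero, not_not] at h
  obtain ⟨v, hv, e⟩ := Matrix.exists_mulVec_eq_zero_iff.2 h
  refine ⟨v, hv, ?_⟩
  rw [Matrix.sub_mulVec, sub_eq_zero, Algebra.algebraMap_eq_smul_one, Matrix.smul_mulVec,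
    Matrix.one_mulVec] at e
  exact e.symm

theorem dotProduct_self_pos {v : Fin m → ℝ} (hv : v ≠ 0) : 0 < v ⬝ᵥ v := by
  have := Matrix.dotProduct_star_self_pos_iff.2 hv
  simpa using this

theorem spectrum_subset_Ici (h : ∀ v, c * (v ⬝ᵥ v) ≤ v ⬝ᵥ M *ᵥ v) :
    spectrum ℝ M ⊆ Set.Ici c := by
  intro x hx
  obtain ⟨v, hv, e⟩ := exists_eigenvector hx
  have := h v
  rw [e, dotProduct_smul, smul_eq_mul] at this
  exact le_of_mul_le_mul_right this (dotProduct_self_pos hv)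

theorem mul_dotProduct_le (hM : M.IsHermitian) (h : spectrum ℝ M ⊆ Set.Ici c) (v : Fin m → ℝ) :
    c * (v ⬝ᵥ v) ≤ v ⬝ᵥ M *ᵥ v := by
  have hM' : (M - algebraMap ℝ _ c).IsHermitian := by
    refine hM.sub ?_
    rw [Algebra.algebraMap_eq_smul_one]
    simp [Matrix.IsHermitian]
  have hps : (M - algebraMap ℝ _ c).PosSemidef := by
    rw [Matrix.posSemidef_iff_isHermitian_and_spectrum_nonneg]
    refine ⟨hM', fun x hx => ?_⟩
    obtain ⟨w, hw, e⟩ := exists_eigenvector hx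
    have hx' : x + c ∈ spectrum ℝ M := by
      rw [spectrum.mem_iff, Matrix.isUnit_iff_isUnit_det, isUnit_iff_ne_zero, not_not,
        ← Matrix.exists_mulVec_eq_zero_iff]
      refine ⟨w, hw, ?_⟩
      rw [Matrix.sub_mulVec, Algebra.algebraMap_eq_smul_one, Matrix.smul_mulVec,
        Matrix.one_mulVec] at e
      rw [Matrix.sub_mulVec, Algebra.algebraMap_eq_smul_one, Matrix.smul_mulVec,
        Matrix.one_mulVec, add_smul, ← e]
      simp
    have : c ≤ x + c := h hx'
    simpa using this
  have := hps.dotProduct_mulVec_nonneg v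
  rw [Matrix.sub_mulVec, Algebra.algebraMap_eq_smul_one, Matrix.smul_mulVec, Matrix.one_mulVec,
    dotProduct_sub, dotProduct_smul, smul_eq_mul] at this
  simpa using this

theorem isHermitian_cfc (f : ℝ → ℝ) (M : Matrix (Fin m) (Fin m) ℝ) : (cfc f M).IsHermitian :=
  cfc_predicate f M

theorem continuousOn_spectrum (f : ℝ → ℝ) (M : Matrix (Fin m) (Fin m) ℝ) :
    ContinuousOn f (spectrum ℝ M) :=
  (Matrix.finite_real_spectrum (A := M)).continuousOn f

theorem abs_apply_le_of_spectrum (hM : M.IsHermitian) (hc : 0 ≤ c)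
    (h : ∀ x ∈ spectrum ℝ M, |x| ≤ c) (i j : Fin m) : |M i j| ≤ c := by
  have hMs : IsSelfAdjoint M := hM
  have e : cfc (fun t : ℝ => -t ^ 2) M = -(M * M) := by
    rw [cfc_neg, cfc_pow_id (R := ℝ) M 2, sq]
  have hs : spectrum ℝ (-(M * M)) ⊆ Set.Ici (-c ^ 2) := by
    rw [← e, cfc_map_spectrum (R := ℝ) (fun t : ℝ => -t ^ 2) M]
    rintro _ ⟨x, hx, rfl⟩
    have := pow_le_pow_left₀ (abs_nonneg _) (h x hx) 2
    rw [sq_abs] at this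
    simpa using this
  have hh : (-(M * M)).IsHermitian := by rw [← e]; exact isHermitian_cfc _ _
  have h1 := mul_dotProduct_le hh hs (Pi.single i 1)
  have h2 : ∑ k, M i k ^ 2 ≤ c ^ 2 := by
    have e2 : (M * M) i i = ∑ k, M i k ^ 2 := by
      rw [Matrix.mul_apply]
      refine Finset.sum_congr rfl fun k _ => ?_
      rw [sq]
      congr 1
      simpa using (hM.apply k i).symm
    simp only [single_dotProduct, Matrix.mulVec_single,
      Pi.single_eq_same, mul_one, one_mul] at h1
    simp at h1
    rw [e2] at h1
    exact h1
  have h3 : M i j ^ 2 ≤ c ^ 2 :=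
    (Finset.single_le_sum (f := fun k => M i k ^ 2) (fun k _ => sq_nonneg _)
      (Finset.mem_univ j)).trans h2
  exact abs_le_of_sq_le_sq h3 hc

theorem abs_dotProduct_mulVec_le (h : ∀ i j, |M i j| ≤ c) (v : Fin m → ℝ) :
    |v ⬝ᵥ M *ᵥ v| ≤ m * c * (v ⬝ᵥ v) := by
  rcases Nat.eq_zero_or_pos m with rfl | hm
  · simp
  have hc : 0 ≤ c := (abs_nonneg _).trans (h ⟨0, hm⟩ ⟨0, hm⟩)
  have e : v ⬝ᵥ M *ᵥ v = ∑ i, ∑ j, v i * (M i j * v j) := by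
    simp [dotProduct, Matrix.mulVec, Finset.mul_sum]
  rw [e]
  have h1 : |∑ i, ∑ j, v i * (M i j * v j)| ≤ ∑ i, ∑ j, c * (|v i| * |v j|) := by
    refine (Finset.abs_sum_le_sum_abs _ _).trans (Finset.sum_le_sum fun i _ => ?_)
    refine (Finset.abs_sum_le_sum_abs _ _).trans (Finset.sum_le_sum fun j _ => ?_)
    rw [abs_mul, abs_mul]
    nlinarith [mul_le_mul_of_nonneg_right (h i j)
      (mul_nonneg (abs_nonneg (v i)) (abs_nonneg (v j)))]
  have h2 : ∑ i, ∑ j, c * (|v i| * |v j|) = c * (∑ i, |v i|) ^ 2 := by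
    rw [sq, Finset.sum_mul_sum, Finset.mul_sum]
    simp only [Finset.mul_sum]
  have h3 : (∑ l, |v l|) ^ 2 ≤ m * (v ⬝ᵥ v) := by
    have := sq_sum_le_card_mul_sum_sq (s := Finset.univ) (f := fun l => |v l|)
    simpa [dotProduct, sq] using this
  calc _ ≤ _ := h1
    _ = _ := h2
    _ ≤ c * (m * (v ⬝ᵥ v)) := mul_le_mul_of_nonneg_left h3 hc
    _ = _ := by ring

theorem isHermitian_invSqrt (A : Matrix (Fin m) (Fin m) ℝ) : (invSqrt A).IsHermitian :=
  isHermitian_cfc _ _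

theorem invSqrt_mul_sqrt (hA : A.IsHermitian) (hc : 0 < c) (h : spectrum ℝ A ⊆ Set.Ici c) :
    invSqrt A * cfc Real.sqrt A = 1 := by
  have hAs : IsSelfAdjoint A := hA
  rw [invSqrt, ← cfc_mul _ _ A (continuousOn_spectrum _ _) (continuousOn_spectrum _ _)]
  rw [cfc_congr (g := fun _ => (1 : ℝ)), cfc_const_one ℝ A]
  intro x hx
  have hx : c ≤ x := h hx
  exact inv_mul_cancel₀ (Real.sqrt_pos.2 (hc.trans_le hx)).ne'

theorem sqrt_mul_sqrt (hA : A.IsHermitian) (hc : 0 ≤ c) (h : spectrum ℝ A ⊆ Set.Ici c) :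
    cfc Real.sqrt A * cfc Real.sqrt A = A := by
  have hAs : IsSelfAdjoint A := hA
  rw [← cfc_mul _ _ A (continuousOn_spectrum _ _) (continuousOn_spectrum _ _)]
  rw [cfc_congr (g := fun x => x), cfc_id' ℝ A]
  intro x hx
  have hx : c ≤ x := h hx
  exact Real.mul_self_sqrt (hc.trans hx)

theorem sqrt_mul_invSqrt (hA : A.IsHermitian) (hc : 0 < c) (h : spectrum ℝ A ⊆ Set.Ici c) :
    cfc Real.sqrt A * invSqrt A = 1 :=
  mul_eq_one_comm.1 (invSqrt_mul_sqrt hA hc h)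

theorem invSqrt_mul_mul_invSqrt (hA : A.IsHermitian) (hc : 0 < c)
    (h : spectrum ℝ A ⊆ Set.Ici c) : invSqrt A * A * invSqrt A = 1 := by
  nth_rewrite 2 [← sqrt_mul_sqrt hA hc.le h]
  rw [← mul_assoc, invSqrt_mul_sqrt hA hc h, one_mul, sqrt_mul_invSqrt hA hc h]

theorem abs_invSqrt_apply_le (hA : A.IsHermitian) (hc : 0 < c) (h : spectrum ℝ A ⊆ Set.Ici c)
    (i j : Fin m) : |invSqrt A i j| ≤ (√c)⁻¹ := by
  have hAs : IsSelfAdjoint A := hA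
  refine abs_apply_le_of_spectrum (isHermitian_invSqrt A) (by positivity) ?_ i j
  rw [invSqrt, cfc_map_spectrum (R := ℝ) _ A hAs (continuousOn_spectrum _ _)]
  rintro _ ⟨x, hx, rfl⟩
  have hx : c ≤ x := h hx
  rw [abs_of_nonneg (by positivity)]
  exact inv_anti₀ (Real.sqrt_pos.2 hc) (Real.sqrt_le_sqrt hx)

theorem spectrum_sqrt_subset (hA : A.IsHermitian) (h : spectrum ℝ A ⊆ Set.Ici c) :
    spectrum ℝ (cfc Real.sqrt A) ⊆ Set.Ici √c := by
  have hAs : IsSelfAdjoint A := hA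
  rw [cfc_map_spectrum (R := ℝ) _ A hAs (continuousOn_spectrum _ _)]
  rintro _ ⟨x, hx, rfl⟩
  exact Real.sqrt_le_sqrt (h hx)

/-- The square root is Lipschitz away from singular matrices. -/
theorem abs_sqrt_sub_sqrt_apply_le (hA : A.IsHermitian) (hB : B.IsHermitian) (hc : 0 < c)
    (hsA : spectrum ℝ A ⊆ Set.Ici c) (hsB : spectrum ℝ B ⊆ Set.Ici 0) {ε : ℝ}
    (hAB : ∀ i j, |A i j - B i j| ≤ ε) (i j : Fin m) :
    |(cfc Real.sqrt A - cfc Real.sqrt B) i j| ≤ m * ε / √c := by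
  have hε : 0 ≤ ε := (abs_nonneg _).trans (hAB i j)
  have hc' : 0 < √c := Real.sqrt_pos.2 hc
  refine abs_apply_le_of_spectrum ((isHermitian_cfc _ _).sub (isHermitian_cfc _ _))
    (by positivity) (fun x hx => ?_) i j
  obtain ⟨v, hv, e⟩ := exists_eigenvector hx
  set S := cfc Real.sqrt A
  set T := cfc Real.sqrt B
  have h1 := mul_dotProduct_le (isHermitian_cfc _ _) (spectrum_sqrt_subset hA hsA) v
  have h2 := mul_dotProduct_le (isHermitian_cfc _ _) (spectrum_sqrt_subset hB hsB) v
  rw [Real.sqrt_zero, zero_mul] at h2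
  have hT : Tᵀ = T := by simpa using (isHermitian_cfc Real.sqrt B).eq
  have hS : Sᵀ = S := by simpa using (isHermitian_cfc Real.sqrt A).eq
  have h3 : v ⬝ᵥ (A - B) *ᵥ v = x * (v ⬝ᵥ S *ᵥ v + v ⬝ᵥ T *ᵥ v) := by
    have eAB : A - B = S * (S - T) + (S - T) * T := by
      rw [mul_sub, sub_mul, sqrt_mul_sqrt hA hc.le hsA, sqrt_mul_sqrt hB le_rfl hsB]
      abel
    have e' : v ᵥ* (S - T) = x • v := by
      rw [← Matrix.mulVec_transpose, Matrix.transpose_sub, hS, hT, e]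
    rw [eAB, Matrix.add_mulVec, dotProduct_add, ← Matrix.mulVec_mulVec, e, Matrix.mulVec_smul,
      dotProduct_smul, ← Matrix.mulVec_mulVec, Matrix.dotProduct_mulVec v (S - T), e',
      smul_dotProduct, smul_eq_mul, smul_eq_mul, mul_add]
  have h4 := abs_dotProduct_mulVec_le (M := A - B) (c := ε) (fun i j => hAB i j) v
  have hvv := dotProduct_self_pos hv
  rw [h3, abs_mul, abs_of_nonneg (a := v ⬝ᵥ S *ᵥ v + v ⬝ᵥ T *ᵥ v)
    (by nlinarith [mul_pos hc' hvv])] at h4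
  rw [le_div_iff₀ hc']
  have h5 : |x| * (√c * (v ⬝ᵥ v)) ≤ m * ε * (v ⬝ᵥ v) :=
    (mul_le_mul_of_nonneg_left (by linarith) (abs_nonneg x)).trans h4
  refine le_of_mul_le_mul_right ?_ hvv
  linarith

theorem spectrum_subset_of_close (hA : A.IsHermitian) (hsA : spectrum ℝ A ⊆ Set.Ici c) {ε : ℝ}
    (hAB : ∀ i j, |A i j - B i j| ≤ ε) : spectrum ℝ B ⊆ Set.Ici (c - m * ε) := by
  refine spectrum_subset_Ici fun v => ?_
  have h1 := mul_dotProduct_le hA hsA v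
  have h2 := (abs_le.1 (abs_dotProduct_mulVec_le (M := A - B) (c := ε) (fun i j => hAB i j) v)).2
  rw [Matrix.sub_mulVec, dotProduct_sub] at h2
  linarith

/-- Perturbation of the inverse square root. -/
theorem abs_invSqrt_mulVec_sub_le (hA : A.IsHermitian) (hB : B.IsHermitian) (hc : 0 < c)
    (hsA : spectrum ℝ A ⊆ Set.Ici c) {ε : ℝ} (hε : m * ε ≤ c / 2)
    (hAB : ∀ i j, |A i j - B i j| ≤ ε) {V : Fin m → ℝ} {K : ℝ}
    (hK : ∀ l, |(invSqrt A *ᵥ V) l| ≤ K) (j : Fin m) :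
    |(invSqrt B *ᵥ V) j - (invSqrt A *ᵥ V) j| ≤ 2 * m ^ 3 / c * ε * K := by
  have hsB : spectrum ℝ B ⊆ Set.Ici (c / 2) :=
    (spectrum_subset_of_close hA hsA hAB).trans (Set.Ici_subset_Ici.2 (by linarith))
  have hε0 : 0 ≤ ε := (abs_nonneg _).trans (hAB j j)
  set W := invSqrt A *ᵥ V with hW
  set D := cfc Real.sqrt A - cfc Real.sqrt B with hD
  have hV : V = cfc Real.sqrt A *ᵥ W := by
    rw [hW, Matrix.mulVec_mulVec, sqrt_mul_invSqrt hA hc hsA, Matrix.one_mulVec]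
  have e : invSqrt B *ᵥ V - W = (invSqrt B * D) *ᵥ W := by
    have : W = (invSqrt B * cfc Real.sqrt B) *ᵥ W := by
      rw [invSqrt_mul_sqrt hB (half_pos hc) hsB, Matrix.one_mulVec]
    nth_rewrite 1 [this]
    rw [hV, Matrix.mulVec_mulVec, ← Matrix.sub_mulVec, ← mul_sub]
  have e2 := congrFun e j
  rw [Pi.sub_apply] at e2
  rw [e2]
  have hR := abs_invSqrt_apply_le hB (half_pos hc) hsB
  have hDb := abs_sqrt_sub_sqrt_apply_le hA hB hc hsA
    (hsB.trans (Set.Ici_subset_Ici.2 (half_pos hc).le)) hAB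
  have hK0 : 0 ≤ K := (abs_nonneg _).trans (hK j)
  have hprod : ∀ l, |(invSqrt B * D) j l| ≤ m * ((√(c / 2))⁻¹ * (m * ε / √c)) := by
    intro l
    rw [Matrix.mul_apply]
    refine (Finset.abs_sum_le_sum_abs _ _).trans ?_
    calc _ ≤ ∑ _k : Fin m, (√(c / 2))⁻¹ * (m * ε / √c) := Finset.sum_le_sum fun k _ => by
          rw [abs_mul]
          exact mul_le_mul (hR j k) (hDb k l) (abs_nonneg _) (by positivity)
      _ = _ := by simp
  have hsq : (√(c / 2))⁻¹ / √c ≤ 2 / c := by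
    have h1 : √c / 2 ≤ √(c / 2) := by
      refine Real.le_sqrt_of_sq_le ?_
      rw [div_pow, Real.sq_sqrt hc.le]
      linarith
    have hc' : 0 < √c := Real.sqrt_pos.2 hc
    calc (√(c / 2))⁻¹ / √c ≤ (√c / 2)⁻¹ / √c := by gcongr
      _ = 2 / (√c * √c) := by field_simp
      _ = 2 / c := by rw [Real.mul_self_sqrt hc.le]
  simp only [Matrix.mulVec, dotProduct]
  refine (Finset.abs_sum_le_sum_abs _ _).trans ?_
  calc _ ≤ ∑ _l : Fin m, m * ((√(c / 2))⁻¹ * (m * ε / √c)) * K := Finset.sum_le_sum fun l _ => by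
        rw [abs_mul]
        exact mul_le_mul (hprod l) (hK l) (abs_nonneg _) (by positivity)
    _ = m ^ 3 * ε * K * ((√(c / 2))⁻¹ / √c) := by simp; ring
    _ ≤ m ^ 3 * ε * K * (2 / c) := mul_le_mul_of_nonneg_left hsq (by positivity)
    _ = _ := by ring

end Matrices

/-! ### Measurability of the inverse square root -/

theorem exists_polynomial_tendsto_inv_sqrt :
    ∃ p : ℕ → Polynomial ℝ, ∀ t : ℝ, Tendsto (fun n => (p n).eval t) atTop (𝓝 (√t)⁻¹) := by
  set f : ℕ → ℝ → ℝ := fun n t => √t / (max t 0 + 1 / ((n : ℝ) + 1)) with hf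
  have hpos : ∀ (n : ℕ) (t : ℝ), 0 < max t 0 + 1 / ((n : ℝ) + 1) := fun n t =>
    add_pos_of_nonneg_of_pos (le_max_right _ _) (by positivity)
  have hc : ∀ n, Continuous (f n) := fun n =>
    Real.continuous_sqrt.div (by fun_prop) fun t => (hpos n t).ne'
  choose p hp using fun n : ℕ => exists_polynomial_near_of_continuousOn (-(n : ℝ)) n (f n)
    (hc n).continuousOn (1 / ((n : ℝ) + 1)) (by positivity)
  refine ⟨p, fun t => ?_⟩
  have h0 : Tendsto (fun n : ℕ => 1 / ((n : ℝ) + 1)) atTop (𝓝 0) :=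
    tendsto_one_div_add_atTop_nhds_zero_nat
  have h1 : Tendsto (fun n => f n t) atTop (𝓝 (√t)⁻¹) := by
    rcases le_or_gt t 0 with ht | ht
    · simp [hf, Real.sqrt_eq_zero_of_nonpos ht]
    · have : Tendsto (fun n => f n t) atTop (𝓝 (√t / (max t 0 + 0))) :=
        tendsto_const_nhds.div (tendsto_const_nhds.add h0) (by simp [max_eq_left ht.le, ht.ne'])
      rwa [max_eq_left ht.le, add_zero, Real.sqrt_div_self', one_div] at this
  have h2 : Tendsto (fun n => (p n).eval t - f n t) atTop (𝓝 0) := by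
    refine squeeze_zero_norm' ?_ h0
    obtain ⟨N, hN⟩ := exists_nat_ge |t|
    filter_upwards [eventually_ge_atTop N] with n hn
    refine (hp n t ?_).le
    have : |t| ≤ n := hN.trans (by exact_mod_cast hn)
    exact abs_le.1 this
  simpa using h2.add h1

theorem tendsto_cfc_apply {m : ℕ} {A : Matrix (Fin m) (Fin m) ℝ} (hA : A.IsHermitian)
    {p : ℕ → ℝ → ℝ} {f : ℝ → ℝ} (h : ∀ t, Tendsto (fun n => p n t) atTop (𝓝 (f t)))
    (i j : Fin m) : Tendsto (fun n => cfc (p n) A i j) atTop (𝓝 (cfc f A i j)) := by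
  have e : ∀ g : ℝ → ℝ, cfc g A i j = ∑ k, (hA.eigenvectorUnitary : Matrix (Fin m) (Fin m) ℝ) i k *
      g (hA.eigenvalues k) * star (hA.eigenvectorUnitary : Matrix (Fin m) (Fin m) ℝ) k j := by
    intro g
    rw [hA.cfc_eq g, Matrix.IsHermitian.cfc, Unitary.conjStarAlgAut_apply, Matrix.mul_apply]
    refine Finset.sum_congr rfl fun k _ => ?_
    rw [Matrix.mul_diagonal]
    rfl
  simp only [e]
  exact tendsto_finsetSum _ fun k _ => ((h _).const_mul _).mul_const _

theorem measurable_invSqrt_apply {Ω : Type*} [MeasurableSpace Ω] {m : ℕ}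
    {M : Ω → Matrix (Fin m) (Fin m) ℝ} (hM : ∀ i j, Measurable fun ω => M ω i j)
    (hh : ∀ ω, (M ω).IsHermitian) (i j : Fin m) : Measurable fun ω => invSqrt (M ω) i j := by
  obtain ⟨p, hp⟩ := exists_polynomial_tendsto_inv_sqrt
  refine measurable_of_tendsto_metrizable (f := fun n ω => cfc (p n).eval (M ω) i j) (fun n => ?_)
    (tendsto_pi_nhds.2 fun ω => tendsto_cfc_apply (hh ω) hp i j)
  have e : ∀ ω, cfc (p n).eval (M ω) = Polynomial.aeval (M ω) (p n) := fun ω =>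
    cfc_polynomial (R := ℝ) (p n) (M ω) (hh ω)
  simp only [e]
  have hc : Continuous fun x : Fin m → Fin m → ℝ =>
      (Polynomial.aeval (Matrix.of x : Matrix (Fin m) (Fin m) ℝ) (p n)) i j := by
    have h1 : Continuous fun A : Matrix (Fin m) (Fin m) ℝ => Polynomial.aeval A (p n) :=
      (p n).continuous_aeval
    exact (continuous_apply j).comp ((continuous_apply i).comp (h1.comp continuous_id))
  exact hc.measurable.comp (measurable_pi_lambda _ fun i => measurable_pi_lambda _ fun j => hM i j)

/-! ### Deviations of sample means and sample covariances -/

section Sample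

variable {Ω E : Type*} [MeasurableSpace Ω] [MeasurableSpace E] {P : Measure Ω}
  {μ : Measure E} {a : ℕ} {X : Fin a → Ω → E}

theorem integral_comp_of_map {i : Fin a} (hX : Measurable (X i)) (hlaw : P.map (X i) = μ)
    {φ : E → ℝ} (hφ : Measurable φ) : ∫ ω, φ (X i ω) ∂P = ∫ x, φ x ∂μ := by
  rw [← hlaw, integral_map hX.aemeasurable hφ.aestronglyMeasurable]

theorem prob_mean_ge_le_exp [IsProbabilityMeasure P] (hX : ∀ i, Measurable (X i)) (hind : iIndepFun X P)
    (hlaw : ∀ i, P.map (X i) = μ) {φ : E → ℝ} (hφ : Measurable φ) {M : ℝ} (hM : 0 < M)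
    (hb : ∀ x, |φ x| ≤ M) (h0 : ∫ x, φ x ∂μ = 0) {I : Finset (Fin a)} (hI : 0 < I.card)
    {t : ℝ} (ht : 0 ≤ t) :
    P.real {ω | t ≤ |(I.card : ℝ)⁻¹ * ∑ i ∈ I, φ (X i ω)|} ≤
      2 * Real.exp (-(I.card * t ^ 2 / (2 * M ^ 2))) := by
  have hI' : (0 : ℝ) < I.card := by exact_mod_cast hI
  have key : ∀ ψ : E → ℝ, Measurable ψ → (∀ x, |ψ x| ≤ M) → ∫ x, ψ x ∂μ = 0 →
      P.real {ω | I.card * t ≤ ∑ i ∈ I, ψ (X i ω)} ≤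
        Real.exp (-(I.card * t ^ 2 / (2 * M ^ 2))) := by
    intro ψ hψ hψb hψ0
    have h := HasSubgaussianMGF.measure_sum_ge_le_of_iIndepFun
      (X := fun i ω => ψ (X i ω)) (hind.comp (fun _ => ψ) fun _ => hψ) (s := I)
      (c := fun _ => (‖M - -M‖₊ / 2) ^ 2) (fun i _ =>
        hasSubgaussianMGF_of_mem_Icc_of_integral_eq_zero (hψ.comp (hX i)).aemeasurable
          (ae_of_all _ fun ω => abs_le.1 (hψb _))
          (by rw [← hψ0]; exact integral_comp_of_map (hX i) (hlaw i) hψ))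
      (mul_nonneg hI'.le ht)
    refine h.trans_eq ?_
    congr 1
    have e : ((∑ _i ∈ I, (‖M - -M‖₊ / 2) ^ 2 : NNReal) : ℝ) = I.card * M ^ 2 := by
      push_cast
      rw [Finset.sum_const, nsmul_eq_mul, Real.norm_of_nonneg (by linarith)]
      ring
    rw [e]
    field_simp
  have h1 := key φ hφ hb h0
  have h2 := key (fun x => -φ x) hφ.neg (fun x => by rw [abs_neg]; exact hb x)
    (by rw [integral_neg, h0, neg_zero])
  have hsub : {ω | t ≤ |(I.card : ℝ)⁻¹ * ∑ i ∈ I, φ (X i ω)|} ⊆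
      {ω | I.card * t ≤ ∑ i ∈ I, φ (X i ω)} ∪ {ω | I.card * t ≤ ∑ i ∈ I, -φ (X i ω)} := by
    intro ω hω
    have hω : t ≤ |(I.card : ℝ)⁻¹ * ∑ i ∈ I, φ (X i ω)| := hω
    rw [abs_mul, abs_of_pos (inv_pos.2 hI'), inv_mul_eq_div, le_div_iff₀ hI', mul_comm] at hω
    rcases le_abs.1 hω with h | h
    · exact Or.inl h
    · refine Or.inr ?_
      rw [← Finset.sum_neg_distrib] at h
      exact h
  refine (measureReal_mono hsub).trans ((measureReal_union_le _ _).trans ?_)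
  linarith

theorem prob_mean_ge_le_div [IsProbabilityMeasure P] (hX : ∀ i, Measurable (X i)) (hind : iIndepFun X P)
    (hlaw : ∀ i, P.map (X i) = μ) {φ : E → ℝ} (hφ : BddMeas φ) {v : ℝ}
    (hv : ∫ x, φ x ^ 2 ∂μ ≤ v) (h0 : ∫ x, φ x ∂μ = 0) {I : Finset (Fin a)} (hI : 0 < I.card)
    {t : ℝ} (ht : 0 < t) :
    P.real {ω | t ≤ |(I.card : ℝ)⁻¹ * ∑ i ∈ I, φ (X i ω)|} ≤ v / (I.card * t ^ 2) := by
  have hI' : (0 : ℝ) < I.card := by exact_mod_cast hI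
  have hb : ∀ i, BddMeas fun ω => φ (X i ω) := fun i => hφ.comp (hX i)
  have hm0 : ∀ i, ∫ ω, φ (X i ω) ∂P = 0 := fun i => by
    rw [integral_comp_of_map (hX i) (hlaw i) hφ.1, h0]
  have hvar := IndepFun.variance_sum (μ := P) (s := I) (X := fun i ω => φ (X i ω))
    (fun i _ => (hb i).memLp P 2)
    (fun i _ j _ hij => (hind.indepFun hij).comp hφ.1 hφ.1)
  have hv' : variance (∑ i ∈ I, fun ω => φ (X i ω)) P ≤ I.card * v := by
    rw [hvar]
    calc _ ≤ ∑ _i ∈ I, v := Finset.sum_le_sum fun i _ => by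
          rw [variance_of_integral_eq_zero (hb i).1.aemeasurable (hm0 i),
            integral_comp_of_map (φ := fun x => φ x ^ 2) (hX i) (hlaw i) (hφ.pow 2).1]
          exact hv
      _ = _ := by simp
  have hS : BddMeas (∑ i ∈ I, fun ω => φ (X i ω)) := by
    have := BddMeas.sum I hb
    rwa [← Finset.sum_fn] at this
  have hmean : P[∑ i ∈ I, fun ω => φ (X i ω)] = 0 := by
    simp only [Finset.sum_apply]
    rw [integral_finsetSum _ fun i _ => (hb i).integrable P]
    simp [hm0]
  have hch := meas_ge_le_variance_div_sq (hS.memLp P 2) (mul_pos hI' ht)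
  have hset : {ω | t ≤ |(I.card : ℝ)⁻¹ * ∑ i ∈ I, φ (X i ω)|} ⊆
      {ω | I.card * t ≤ |(∑ i ∈ I, fun ω => φ (X i ω)) ω -
        P[∑ i ∈ I, fun ω => φ (X i ω)]|} := by
    intro ω hω
    have hω : t ≤ |(I.card : ℝ)⁻¹ * ∑ i ∈ I, φ (X i ω)| := hω
    rw [abs_mul, abs_of_pos (inv_pos.2 hI'), inv_mul_eq_div, le_div_iff₀ hI', mul_comm] at hω
    rw [Set.mem_ofPred_eq, hmean, sub_zero, Finset.sum_apply]
    exact hω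
  refine (measureReal_mono hset).trans ?_
  have hnn : 0 ≤ variance (∑ i ∈ I, fun ω => φ (X i ω)) P / (I.card * t) ^ 2 :=
    div_nonneg (variance_nonneg _ _) (sq_nonneg _)
  refine (ENNReal.toReal_le_of_le_ofReal hnn hch).trans ?_
  rw [div_le_div_iff₀ (by positivity) (by positivity)]
  nlinarith [mul_le_mul_of_nonneg_right hv' (by positivity : 0 ≤ (I.card : ℝ) * t ^ 2)]

end Sample

theorem empCov_eq {E : Type*} {a : ℕ} {I : Finset (Fin a)} (hI : 0 < I.card) (x : Fin a → E) (g h : E → ℝ)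
    (u v : ℝ) :
    empCov I x g h = (I.card : ℝ)⁻¹ * ∑ i ∈ I, (g (x i) - u) * (h (x i) - v) -
      ((I.card : ℝ)⁻¹ * ∑ i ∈ I, (g (x i) - u)) * ((I.card : ℝ)⁻¹ * ∑ i ∈ I, (h (x i) - v)) := by
  have hI' : (I.card : ℝ) ≠ 0 := by exact_mod_cast hI.ne'
  have e : ∀ A B : ℝ, ∑ i ∈ I, (g (x i) - A) * (h (x i) - B) =
      ∑ i ∈ I, g (x i) * h (x i) - B * ∑ i ∈ I, g (x i) - A * ∑ i ∈ I, h (x i) +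
        I.card * (A * B) := by
    intro A B
    rw [Finset.mul_sum, Finset.mul_sum, ← nsmul_eq_mul, ← Finset.sum_const,
      ← Finset.sum_sub_distrib, ← Finset.sum_sub_distrib, ← Finset.sum_add_distrib]
    exact Finset.sum_congr rfl fun i _ => by ring
  have e2 : ∀ (f : E → ℝ) (A : ℝ), ∑ i ∈ I, (f (x i) - A) = ∑ i ∈ I, f (x i) - I.card * A := by
    intro f A
    rw [Finset.sum_sub_distrib]
    simp
  rw [empCov, e, e, e2, e2]
  field_simp
  ring


/-- The covariance matrix of `g₁, …, g_m` under `μ`. -/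
noncomputable def popCov {E : Type*} [MeasurableSpace E] {m : ℕ} (μ : Measure E)
    (g : Fin m → E → ℝ) : Matrix (Fin m) (Fin m) ℝ :=
  Matrix.of fun j l => cov[g j, g l; μ]

theorem abs_empCov_sub_le {E : Type*} {m : ℕ} {g : Fin m → E → ℝ} {a : ℕ} {I : Finset (Fin a)} (hI : 0 < I.card) (x : Fin a → E)
    (u : Fin m → ℝ) {C r : ℝ} (hr : 0 ≤ r) (j l : Fin m)
    (h1 : |(I.card : ℝ)⁻¹ * ∑ i ∈ I, ((g j (x i) - u j) * (g l (x i) - u l) - C)| ≤ r / 2)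
    (h2 : ∀ j, |(I.card : ℝ)⁻¹ * ∑ i ∈ I, (g j (x i) - u j)| ≤ √(r / 2)) :
    |empCov I x (g j) (g l) - C| ≤ r := by
  have hI' : (I.card : ℝ) ≠ 0 := by exact_mod_cast hI.ne'
  rw [empCov_eq hI x (g j) (g l) (u j) (u l)]
  have e : (I.card : ℝ)⁻¹ * ∑ i ∈ I, ((g j (x i) - u j) * (g l (x i) - u l) - C) =
      (I.card : ℝ)⁻¹ * ∑ i ∈ I, (g j (x i) - u j) * (g l (x i) - u l) - C := by
    rw [Finset.sum_sub_distrib, mul_sub]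
    simp [hI']
  rw [e] at h1
  have h3 := mul_le_mul (h2 j) (h2 l) (abs_nonneg _) (Real.sqrt_nonneg _)
  rw [← abs_mul, Real.mul_self_sqrt (by linarith)] at h3
  rw [abs_le] at h1 h3 ⊢
  constructor <;> linarith [h1.1, h1.2, h3.1, h3.2]

section Deviation

variable {Ω E : Type*} [MeasurableSpace Ω] [MeasurableSpace E] {P : Measure Ω}
  {μ : Measure E} {m : ℕ} {g : Fin m → E → ℝ}

theorem isHermitian_popCov (μ : Measure E) (g : Fin m → E → ℝ) : (popCov μ g).IsHermitian := by
  ext j l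
  simp only [popCov, Matrix.conjTranspose_apply, Matrix.of_apply, star_trivial]
  exact covariance_comm _ _

theorem popCov_apply (μ : Measure E) (g : Fin m → E → ℝ) (j l : Fin m) :
    popCov μ g j l = ∫ x, (g j x - ∫ y, g j y ∂μ) * (g l x - ∫ y, g l y ∂μ) ∂μ := rfl

theorem prob_empCov_dev_le [IsProbabilityMeasure P] {a : ℕ} {X : Fin a → Ω → E}
    {I : Finset (Fin a)} (hI : 0 < I.card) {r q : ℝ} (hr : 0 ≤ r)
    (h1 : ∀ j l, P.real {ω | r / 2 ≤ |(I.card : ℝ)⁻¹ * ∑ i ∈ I,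
      ((g j (X i ω) - ∫ y, g j y ∂μ) * (g l (X i ω) - ∫ y, g l y ∂μ) - popCov μ g j l)|} ≤ q)
    (h2 : ∀ j, P.real {ω | √(r / 2) ≤ |(I.card : ℝ)⁻¹ * ∑ i ∈ I,
      (g j (X i ω) - ∫ y, g j y ∂μ)|} ≤ q) :
    P.real {ω | ∃ j l, r < |empCov I (fun i => X i ω) (g j) (g l) - popCov μ g j l|} ≤
      (m ^ 2 + m) * q := by
  have hsub : {ω | ∃ j l, r < |empCov I (fun i => X i ω) (g j) (g l) - popCov μ g j l|} ⊆
      (⋃ p : Fin m × Fin m, {ω | r / 2 ≤ |(I.card : ℝ)⁻¹ * ∑ i ∈ I,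
        ((g p.1 (X i ω) - ∫ y, g p.1 y ∂μ) * (g p.2 (X i ω) - ∫ y, g p.2 y ∂μ) -
          popCov μ g p.1 p.2)|}) ∪
      ⋃ j, {ω | √(r / 2) ≤ |(I.card : ℝ)⁻¹ * ∑ i ∈ I, (g j (X i ω) - ∫ y, g j y ∂μ)|} := by
    rintro ω ⟨j, l, h⟩
    by_contra hn
    rw [Set.mem_union, not_or, Set.mem_iUnion, Set.mem_iUnion, not_exists, not_exists] at hn
    refine absurd (abs_empCov_sub_le (g := g) hI (fun i => X i ω) (fun j => ∫ y, g j y ∂μ) hr j l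
      (not_le.1 (hn.1 (j, l))).le fun j => (not_le.1 (hn.2 j)).le) (not_le.2 h)
  refine (measureReal_mono hsub).trans ((measureReal_union_le _ _).trans ?_)
  have e1 := (measureReal_iUnion_fintype_le (μ := P) fun p : Fin m × Fin m =>
    {ω | r / 2 ≤ |(I.card : ℝ)⁻¹ * ∑ i ∈ I,
        ((g p.1 (X i ω) - ∫ y, g p.1 y ∂μ) * (g p.2 (X i ω) - ∫ y, g p.2 y ∂μ) -
          popCov μ g p.1 p.2)|}).trans (Finset.sum_le_sum fun p _ => h1 p.1 p.2)
  have e2 := (measureReal_iUnion_fintype_le (μ := P) fun j : Fin m =>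
    {ω | √(r / 2) ≤ |(I.card : ℝ)⁻¹ * ∑ i ∈ I, (g j (X i ω) - ∫ y, g j y ∂μ)|}).trans
    (Finset.sum_le_sum fun j _ => h2 j)
  refine (add_le_add e1 e2).trans (le_of_eq ?_)
  simp
  ring

theorem bddMeas_centred {f : E → ℝ} (hf : BddMeas f) : BddMeas fun x => f x - ∫ y, f y ∂μ :=
  hf.sub (BddMeas.const _)

variable [IsProbabilityMeasure P] [IsProbabilityMeasure μ]

theorem abs_sub_integral_le {f : E → ℝ} {b : ℝ} (hb : ∀ x, |f x| ≤ b) (x : E) :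
    |f x - ∫ y, f y ∂μ| ≤ 2 * b := by
  have h : |∫ y, f y ∂μ| ≤ b := by
    have := norm_integral_le_of_norm_le_const (μ := μ) (f := f) (C := b) (ae_of_all _ hb)
    simpa using this
  exact (abs_sub _ _).trans (by linarith [hb x])

theorem integral_centred {f : E → ℝ} (hf : BddMeas f) : ∫ x, (f x - ∫ y, f y ∂μ) ∂μ = 0 := by
  rw [integral_sub (hf.integrable μ) (integrable_const _)]
  simp

variable {a : ℕ} {X : Fin a → Ω → E}

theorem integral_popCov_centred (hg : ∀ j, BddMeas (g j)) (j l : Fin m) :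
    ∫ x, ((g j x - ∫ y, g j y ∂μ) * (g l x - ∫ y, g l y ∂μ) - popCov μ g j l) ∂μ = 0 := by
  rw [integral_sub (((bddMeas_centred (hg j)).mul (bddMeas_centred (hg l))).integrable μ)
    (integrable_const _), ← popCov_apply]
  simp

/-- Deviation of the sample covariance, with Gaussian tails. -/
theorem prob_empCov_dev_le_exp (hX : ∀ i, Measurable (X i)) (hind : iIndepFun X P)
    (hlaw : ∀ i, P.map (X i) = μ) (hg : ∀ j, Measurable (g j)) {b : ℝ} (hb0 : 0 < b)
    (hb : ∀ j x, |g j x| ≤ b) {I : Finset (Fin a)} (hI : 0 < I.card) {r q : ℝ} (hr : 0 ≤ r)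
    (hq1 : 2 * Real.exp (-(I.card * r ^ 2 / (512 * b ^ 4))) ≤ q)
    (hq2 : 2 * Real.exp (-(I.card * r / (16 * b ^ 2))) ≤ q) :
    P.real {ω | ∃ j l, r < |empCov I (fun i => X i ω) (g j) (g l) - popCov μ g j l|} ≤
      (m ^ 2 + m) * q := by
  have hgb : ∀ j, BddMeas (g j) := fun j => ⟨hg j, b, hb j⟩
  have hcb : ∀ j l x, |(g j x - ∫ y, g j y ∂μ) * (g l x - ∫ y, g l y ∂μ)| ≤ 4 * b ^ 2 := by
    intro j l x
    rw [abs_mul]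
    calc _ ≤ (2 * b) * (2 * b) := mul_le_mul (abs_sub_integral_le (hb j) x)
          (abs_sub_integral_le (hb l) x) (abs_nonneg _) (by positivity)
      _ = _ := by ring
  refine prob_empCov_dev_le hI hr (fun j l => ?_) fun j => ?_
  · have hC : |popCov μ g j l| ≤ 4 * b ^ 2 := by
      rw [popCov_apply]
      have := norm_integral_le_of_norm_le_const (μ := μ) (C := 4 * b ^ 2)
        (f := fun x => (g j x - ∫ y, g j y ∂μ) * (g l x - ∫ y, g l y ∂μ))
        (ae_of_all _ (hcb j l))
      simpa using this
    have := prob_mean_ge_le_exp hX hind hlaw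
      (φ := fun x => (g j x - ∫ y, g j y ∂μ) * (g l x - ∫ y, g l y ∂μ) - popCov μ g j l)
      (((bddMeas_centred (hgb j)).mul (bddMeas_centred (hgb l))).sub (BddMeas.const _)).1
      (M := 8 * b ^ 2) (by positivity)
      (fun x => (abs_sub _ _).trans (by linarith [hcb j l x]))
      (integral_popCov_centred hgb j l) hI (t := r / 2) (by positivity)
    refine this.trans (le_trans (le_of_eq ?_) hq1)
    congr 3
    field_simp
    ring
  · have := prob_mean_ge_le_exp hX hind hlaw (φ := fun x => g j x - ∫ y, g j y ∂μ)
      (bddMeas_centred (hgb j)).1 (M := 2 * b) (by positivity)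
      (abs_sub_integral_le (hb j)) (integral_centred (hgb j)) hI (t := √(r / 2)) (by positivity)
    refine this.trans (le_trans (le_of_eq ?_) hq2)
    rw [Real.sq_sqrt (by positivity)]
    congr 3
    field_simp
    ring

/-- Deviation of the sample covariance, with polynomial tails. -/
theorem prob_empCov_dev_le_div (hX : ∀ i, Measurable (X i)) (hind : iIndepFun X P)
    (hlaw : ∀ i, P.map (X i) = μ) (hg : ∀ j, Measurable (g j)) {b : ℝ}
    (hb : ∀ j x, |g j x| ≤ b) {I : Finset (Fin a)} (hI : 0 < I.card) {r q v : ℝ} (hr : 0 < r)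
    (hv : ∀ j, popCov μ g j j ≤ v)
    (hq1 : 16 * b ^ 2 * v / (I.card * r ^ 2) ≤ q) (hq2 : 2 * v / (I.card * r) ≤ q) :
    P.real {ω | ∃ j l, r < |empCov I (fun i => X i ω) (g j) (g l) - popCov μ g j l|} ≤
      (m ^ 2 + m) * q := by
  have hI' : (0 : ℝ) < I.card := by exact_mod_cast hI
  have hgb : ∀ j, BddMeas (g j) := fun j => ⟨hg j, b, hb j⟩
  have hc := fun j => bddMeas_centred (μ := μ) (hgb j)
  have hsq : ∀ j, ∫ x, (g j x - ∫ y, g j y ∂μ) ^ 2 ∂μ ≤ v := fun j => by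
    have := hv j
    rw [popCov_apply] at this
    simpa only [sq] using this
  refine prob_empCov_dev_le hI hr.le (fun j l => ?_) fun j => ?_
  · have hbd := ((hc j).mul (hc l)).sub (BddMeas.const (popCov μ g j l))
    have hi : Integrable (fun x => ((g j x - ∫ y, g j y ∂μ) * (g l x - ∫ y, g l y ∂μ)) ^ 2) μ :=
      (((hc j).mul (hc l)).pow 2).integrable μ
    have hvar : ∫ x, ((g j x - ∫ y, g j y ∂μ) * (g l x - ∫ y, g l y ∂μ) -
        popCov μ g j l) ^ 2 ∂μ ≤ 4 * b ^ 2 * v := by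
      have e : ∀ x, ((g j x - ∫ y, g j y ∂μ) * (g l x - ∫ y, g l y ∂μ) - popCov μ g j l) ^ 2 =
          ((g j x - ∫ y, g j y ∂μ) * (g l x - ∫ y, g l y ∂μ)) ^ 2 -
          2 * popCov μ g j l * ((g j x - ∫ y, g j y ∂μ) * (g l x - ∫ y, g l y ∂μ) -
            popCov μ g j l) - popCov μ g j l ^ 2 := fun x => by ring
      simp only [e]
      rw [integral_sub (((((hc j).mul (hc l)).pow 2).sub
        ((BddMeas.const (2 * popCov μ g j l)).mul hbd)).integrable μ)
        (integrable_const _), integral_sub hi ((hbd.integrable μ).const_mul _),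
        integral_const_mul, integral_popCov_centred hgb]
      have h1 : ∫ x, ((g j x - ∫ y, g j y ∂μ) * (g l x - ∫ y, g l y ∂μ)) ^ 2 ∂μ ≤
          ∫ x, 4 * b ^ 2 * (g l x - ∫ y, g l y ∂μ) ^ 2 ∂μ := by
        refine integral_mono hi ((((hc l).pow 2).integrable μ).const_mul _) fun x => ?_
        simp only
        rw [mul_pow]
        refine mul_le_mul_of_nonneg_right ?_ (sq_nonneg _)
        have := pow_le_pow_left₀ (abs_nonneg _) (abs_sub_integral_le (μ := μ) (hb j) x) 2
        rw [sq_abs] at this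
        linarith
      rw [integral_const_mul] at h1
      have h2 := mul_le_mul_of_nonneg_left (hsq l) (by positivity : 0 ≤ 4 * b ^ 2)
      simp only [integral_const, probReal_univ, one_smul, mul_zero, sub_zero]
      nlinarith [sq_nonneg (popCov μ g j l)]
    have := prob_mean_ge_le_div hX hind hlaw hbd hvar (integral_popCov_centred hgb j l) hI
      (t := r / 2) (by positivity)
    refine this.trans (le_trans (le_of_eq ?_) hq1)
    field_simp
    ring
  · have := prob_mean_ge_le_div hX hind hlaw (hc j) (hsq j) (integral_centred (hgb j)) hI
      (t := √(r / 2)) (by positivity)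
    refine this.trans (le_trans (le_of_eq ?_) hq2)
    rw [Real.sq_sqrt (by positivity)]
    field_simp

end Deviation

/-! ### Standardised sums -/

section Standardise

variable {Ω E : Type*} [MeasurableSpace Ω] [MeasurableSpace E] {P : Measure Ω}
  [IsProbabilityMeasure P] {μ : Measure E} [IsProbabilityMeasure μ] {m : ℕ} {g : Fin m → E → ℝ}
  {ι : Type*} [Fintype ι] {Z : ι → Ω → E}

theorem stdSum_of_iid (hZ : ∀ i, Measurable (Z i)) (hind : iIndepFun Z P)
    (hlaw : ∀ i, P.map (Z i) = μ) (hg : ∀ j, Measurable (g j)) {b : ℝ}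
    (hb : ∀ j x, |g j x| ≤ b) {c : ℝ} (hc : 0 < c) (hs : spectrum ℝ (popCov μ g) ⊆ Set.Ici c)
    {w : ι → ℝ} (hw : ∑ i, w i ^ 2 = 1) {w₀ : ℝ} (hw₀ : ∀ i, |w i| ≤ w₀) :
    StdSum P (fun i ω => invSqrt (popCov μ g) *ᵥ
      fun l => w i * (g l (Z i ω) - ∫ y, g l y ∂μ)) (m * ((√c)⁻¹ * (w₀ * (2 * b)))) := by
  set C := popCov μ g with hC
  set R := invSqrt C with hR
  have hH : C.IsHermitian := isHermitian_popCov μ g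
  have hgb : ∀ j, BddMeas (g j) := fun j => ⟨hg j, b, hb j⟩
  have hcb := fun j => bddMeas_centred (μ := μ) (hgb j)
  have hcZ : ∀ i j, BddMeas fun ω => g j (Z i ω) - ∫ y, g j y ∂μ := fun i j =>
    (hcb j).comp (hZ i)
  have hvec : ∀ i, Measurable fun x : E => R *ᵥ fun l => w i * (g l x - ∫ y, g l y ∂μ) := by
    intro i
    refine measurable_pi_lambda _ fun j => ?_
    simp only [Matrix.mulVec, dotProduct]
    exact Finset.measurable_sum _ fun l _ => ((hcb l).1.const_mul _).const_mul _
  have int0 : ∀ i j, ∫ ω, (g j (Z i ω) - ∫ y, g j y ∂μ) ∂P = 0 := fun i j => by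
    have h1 := integral_map (μ := P) (hZ i).aemeasurable
      (f := fun x => g j x - ∫ y, g j y ∂μ) (hcb j).1.aestronglyMeasurable
    rw [← h1, hlaw i]
    exact integral_centred (hgb j)
  have int2 : ∀ i j l, ∫ ω, (g j (Z i ω) - ∫ y, g j y ∂μ) * (g l (Z i ω) - ∫ y, g l y ∂μ) ∂P =
      C j l := fun i j l => by
    have h1 := integral_map (μ := P) (hZ i).aemeasurable
      (f := fun x => (g j x - ∫ y, g j y ∂μ) * (g l x - ∫ y, g l y ∂μ))
      ((hcb j).mul (hcb l)).1.aestronglyMeasurable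
    rw [← h1, hlaw i, hC, popCov_apply]
  refine ⟨fun i => (hvec i).comp (hZ i), hind.comp _ hvec, fun i ω j => ?_, fun i j => ?_,
    fun j l => ?_⟩
  · simp only [Matrix.mulVec, dotProduct]
    refine (Finset.abs_sum_le_sum_abs _ _).trans ?_
    calc _ ≤ ∑ _l : Fin m, (√c)⁻¹ * (w₀ * (2 * b)) := Finset.sum_le_sum fun l _ => by
          rw [abs_mul, abs_mul]
          have h1 := abs_invSqrt_apply_le hH hc hs j l
          have h2 := abs_sub_integral_le (μ := μ) (hb l) (Z i ω)
          have h3 := hw₀ i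
          have h4 : 0 ≤ w₀ := (abs_nonneg _).trans h3
          have h5 : 0 ≤ 2 * b := (abs_nonneg _).trans h2
          gcongr
      _ = _ := by simp
  · simp only [Matrix.mulVec, dotProduct]
    rw [integral_finsetSum _ fun l _ =>
      (((hcZ i l).integrable P).const_mul _).const_mul _]
    refine Finset.sum_eq_zero fun l _ => ?_
    rw [integral_const_mul, integral_const_mul, int0]
    simp
  · have e : ∀ i, ∫ ω, (R *ᵥ fun l => w i * (g l (Z i ω) - ∫ y, g l y ∂μ)) j *
        (R *ᵥ fun l => w i * (g l (Z i ω) - ∫ y, g l y ∂μ)) l ∂P =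
        w i ^ 2 * (R * C * R) j l := by
      intro i
      have e1 : ∀ ω, (R *ᵥ fun l => w i * (g l (Z i ω) - ∫ y, g l y ∂μ)) j *
          (R *ᵥ fun l => w i * (g l (Z i ω) - ∫ y, g l y ∂μ)) l =
          ∑ k', ∑ k, w i ^ 2 * R j k * R l k' *
            ((g k (Z i ω) - ∫ y, g k y ∂μ) * (g k' (Z i ω) - ∫ y, g k' y ∂μ)) := by
        intro ω
        simp only [Matrix.mulVec, dotProduct]
        rw [Finset.sum_mul_sum, Finset.sum_comm]
        exact Finset.sum_congr rfl fun k' _ => Finset.sum_congr rfl fun k _ => by ring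
      simp only [e1]
      rw [integral_finsetSum _ fun k' _ => integrable_finsetSum _ fun k _ =>
        ((((hcZ i k).mul (hcZ i k')).integrable P).const_mul _)]
      rw [Matrix.mul_apply, Finset.mul_sum]
      refine Finset.sum_congr rfl fun k' _ => ?_
      rw [integral_finsetSum _ fun k _ =>
        ((((hcZ i k).mul (hcZ i k')).integrable P).const_mul _), Matrix.mul_apply,
        Finset.sum_mul, Finset.mul_sum]
      refine Finset.sum_congr rfl fun k _ => ?_
      rw [integral_const_mul, int2]
      have hRs : R l k' = R k' l := by simpa using (isHermitian_invSqrt C).apply k' l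
      rw [hRs]
      ring
    simp only [e]
    rw [← Finset.sum_mul, hw, one_mul, invSqrt_mul_mul_invSqrt hH hc hs, Matrix.one_apply]

end Standardise

/-! ### Comparison of distribution functions -/

theorem abs_prob_le_sub_le {Ω : Type*} [MeasurableSpace Ω] {P : Measure Ω}
    [IsProbabilityMeasure P] {T W : Ω → ℝ} (hW : Measurable W) {H : ℝ → ℝ} {δ L κ M q : ℝ}
    (hδ : ∀ a, |P.real {ω | W ω ≤ a} - H a| ≤ δ) (hL : ∀ a b, |H a - H b| ≤ L * |a - b|)
    (hκ : 0 ≤ κ) (hM : 0 ≤ M) {bad : Set Ω} (hq : P.real bad ≤ q)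
    (h : ∀ ω, ω ∉ bad → |T ω - W ω| ≤ κ * W ω) (t : ℝ) :
    |P.real {ω | T ω ≤ t} - H t| ≤ 2 * δ + L * (κ * M) + (1 - H M) + q := by
  have hκM : 0 ≤ κ * M := mul_nonneg hκ hM
  have htail : P.real {ω | W ω ≤ M}ᶜ ≤ 1 - H M + δ := by
    rw [probReal_compl_eq_one_sub (measurableSet_le hW measurable_const)]
    linarith [(abs_le.1 (hδ M)).1]
  have hgood : ∀ ω, ω ∉ bad → W ω ≤ M → |T ω - W ω| ≤ κ * M := fun ω h1 h2 =>
    (h ω h1).trans (mul_le_mul_of_nonneg_left h2 hκ)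
  have up : {ω | T ω ≤ t} ⊆ {ω | W ω ≤ t + κ * M} ∪ {ω | W ω ≤ M}ᶜ ∪ bad := by
    intro ω hω
    by_cases h1 : ω ∈ bad
    · exact Or.inr h1
    by_cases h2 : W ω ≤ M
    · refine Or.inl (Or.inl ?_)
      have h3 := (abs_le.1 (hgood ω h1 h2)).1
      have h4 : T ω ≤ t := hω
      exact (by linarith : W ω ≤ t + κ * M)
    · exact Or.inl (Or.inr h2)
  have lo : {ω | W ω ≤ t - κ * M} ⊆ {ω | T ω ≤ t} ∪ {ω | W ω ≤ M}ᶜ ∪ bad := by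
    intro ω hω
    by_cases h1 : ω ∈ bad
    · exact Or.inr h1
    by_cases h2 : W ω ≤ M
    · refine Or.inl (Or.inl ?_)
      have h3 := (abs_le.1 (hgood ω h1 h2)).2
      have h4 : W ω ≤ t - κ * M := hω
      exact (by linarith : T ω ≤ t)
    · exact Or.inl (Or.inr h2)
  have u1 := (measureReal_mono up (μ := P)).trans ((measureReal_union_le _ _).trans
    (add_le_add_left (measureReal_union_le _ _) _))
  have l1 := (measureReal_mono lo (μ := P)).trans ((measureReal_union_le _ _).trans
    (add_le_add_left (measureReal_union_le _ _) _))
  have a1 := hδ (t + κ * M)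
  have a2 := hδ (t - κ * M)
  have b1 := hL (t + κ * M) t
  have b2 := hL (t - κ * M) t
  rw [show t + κ * M - t = κ * M by ring, abs_of_nonneg hκM] at b1
  rw [show t - κ * M - t = -(κ * M) by ring, abs_neg, abs_of_nonneg hκM] at b2
  rw [abs_le] at a1 a2 b1 b2 ⊢
  constructor <;> linarith [a1.1, a1.2, a2.1, a2.2, b1.1, b1.2, b2.1, b2.2]


/-! ### The statistic for fixed fitting data -/

namespace Experiment

variable {m : ℕ} (e : Experiment m)

/-- Pairs of samples. -/
abbrev Sample : Type :=
  (Fin e.nx → EuclideanSpace ℝ (Fin e.d)) × (Fin e.ny → EuclideanSpace ℝ (Fin e.d))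

/-- The realised samples. -/
def sample (ω : e.Ω) : e.Sample := (fun i => e.X i ω, fun i => e.Y i ω)

/-- The sample covariance matrix evaluated with the functions obtained from the fitting data `F`
on the test part of a sample. -/
noncomputable def sigmaHatAt (F : FitData e.nx e.ny e.d) (q : e.Sample) :
    Matrix (Fin m) (Fin m) ℝ :=
  Matrix.of fun j l =>
    e.nyTest F.1 / (e.nxTest F.1 + e.nyTest F.1) * empCov (testSet F.1.1) q.1 (e.g F j) (e.g F l) +
    e.nxTest F.1 / (e.nxTest F.1 + e.nyTest F.1) * empCov (testSet F.1.2) q.2 (e.g F j) (e.g F l)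

/-- The test statistic as a function of the fitting data and of the sample. -/
noncomputable def statAt (F : FitData e.nx e.ny e.d) (q : e.Sample) : ℝ :=
  ⨆ j : Fin m, e.scale F.1 * |(invSqrt (e.sigmaHatAt F q) *ᵥ e.S F q) j|

theorem measurable_sample : Measurable e.sample :=
  (measurable_pi_lambda _ e.measurable_X).prodMk (measurable_pi_lambda _ e.measurable_Y)

theorem measurable_g_uncurry (j : Fin m) :
    Measurable fun p : FitData e.nx e.ny e.d × EuclideanSpace ℝ (Fin e.d) => e.g p.1 j p.2 := by
  have h : Measurable fun p : FitData e.nx e.ny e.d × EuclideanSpace ℝ (Fin e.d) =>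
      proj (e.U j p.1) p.2 := by
    refine measurable_pi_lambda _ fun l => ?_
    simp only [proj, Matrix.mulVec, dotProduct, Matrix.transpose_apply]
    refine Finset.measurable_sum _ fun i _ => ((e.measurable_U j i l).comp measurable_fst).mul ?_
    exact (EuclideanSpace.proj (𝕜 := ℝ) i).continuous.measurable.comp measurable_snd
  exact (e.measurable_f j).comp (measurable_fst.prodMk h)

theorem measurable_g (F : FitData e.nx e.ny e.d) (j : Fin m) : Measurable (e.g F j) :=
  (e.measurable_g_uncurry j).comp (measurable_const.prodMk measurable_id)

theorem isHermitian_sigmaHatAt (F : FitData e.nx e.ny e.d) (q : e.Sample) :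
    (e.sigmaHatAt F q).IsHermitian := by
  have h : ∀ {a : ℕ} (I : Finset (Fin a)) (x : Fin a → EuclideanSpace ℝ (Fin e.d))
      (f g : EuclideanSpace ℝ (Fin e.d) → ℝ), empCov I x f g = empCov I x g f := by
    intro a I x f g
    simp only [empCov, mul_comm]
  ext j l
  simp only [sigmaHatAt, Matrix.conjTranspose_apply, Matrix.of_apply, star_trivial]
  rw [h _ _ (e.g F l), h _ _ (e.g F l)]

theorem measurable_meanDiff_apply {Ω' : Type*} [MeasurableSpace Ω'] {s : Split e.nx e.ny}
    {x : Ω' → Fin e.nx → EuclideanSpace ℝ (Fin e.d)} {y : Ω' → Fin e.ny → EuclideanSpace ℝ (Fin e.d)}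
    (hx : Measurable x) (hy : Measurable y) {f : Ω' → EuclideanSpace ℝ (Fin e.d) → ℝ}
    (hf : Measurable (Function.uncurry f)) :
    Measurable fun ω => meanDiff (testSet s.1) (testSet s.2) (x ω) (y ω) (f ω) := by
  have hX : ∀ i, Measurable fun ω => f ω (x ω i) := fun i =>
    hf.comp (measurable_id.prodMk ((measurable_pi_apply i).comp hx))
  have hY : ∀ i, Measurable fun ω => f ω (y ω i) := fun i =>
    hf.comp (measurable_id.prodMk ((measurable_pi_apply i).comp hy))
  exact ((Finset.measurable_sum _ fun i _ => hX i).const_mul _).sub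
    ((Finset.measurable_sum _ fun i _ => hY i).const_mul _)

theorem measurable_empCov_apply {Ω' E : Type*} [MeasurableSpace Ω'] [MeasurableSpace E] {a : ℕ}
    (I : Finset (Fin a)) {x : Ω' → Fin a → E} (hx : Measurable x) {f g : Ω' → E → ℝ}
    (hf : Measurable (Function.uncurry f)) (hg : Measurable (Function.uncurry g)) :
    Measurable fun ω => empCov I (x ω) (f ω) (g ω) := by
  have h1 : ∀ i, Measurable fun ω => f ω (x ω i) := fun i =>
    hf.comp (measurable_id.prodMk ((measurable_pi_apply i).comp hx))
  have h2 : ∀ i, Measurable fun ω => g ω (x ω i) := fun i =>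
    hg.comp (measurable_id.prodMk ((measurable_pi_apply i).comp hx))
  exact (Finset.measurable_sum _ fun i _ =>
    ((h1 i).sub ((Finset.measurable_sum _ fun i _ => h1 i).const_mul _)).mul
      ((h2 i).sub ((Finset.measurable_sum _ fun i _ => h2 i).const_mul _))).const_mul _

theorem measurable_iSup_invSqrt_mulVec {Ω' : Type*} [MeasurableSpace Ω']
    {A : Ω' → Matrix (Fin m) (Fin m) ℝ} {v : Ω' → Fin m → ℝ} (hA : ∀ i j, Measurable fun ω => A ω i j)
    (hH : ∀ ω, (A ω).IsHermitian) (hv : ∀ i, Measurable fun ω => v ω i) (c : ℝ) :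
    Measurable fun ω => ⨆ j, c * |(invSqrt (A ω) *ᵥ v ω) j| := by
  refine Measurable.iSup fun j => ?_
  have h0 : Measurable fun ω => (invSqrt (A ω) *ᵥ v ω) j := by
    simp only [Matrix.mulVec, dotProduct]
    exact Finset.measurable_sum _ fun l _ => (measurable_invSqrt_apply hA hH j l).mul (hv l)
  exact (continuous_abs.measurable.comp h0).const_mul c

theorem measurable_statAt_of_split (s : Split e.nx e.ny) :
    Measurable fun p : e.Sample × e.Sample => e.statAt (s, p.1) p.2 := by
  have hg : ∀ j, Measurable (Function.uncurry
      fun (p : e.Sample × e.Sample) (z : EuclideanSpace ℝ (Fin e.d)) => e.g (s, p.1) j z) := fun j =>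
    (e.measurable_g_uncurry j).comp
      ((measurable_const.prodMk (measurable_fst.comp measurable_fst)).prodMk measurable_snd)
  have hx : Measurable fun p : e.Sample × e.Sample => p.2.1 := measurable_fst.comp measurable_snd
  have hy : Measurable fun p : e.Sample × e.Sample => p.2.2 := measurable_snd.comp measurable_snd
  refine measurable_iSup_invSqrt_mulVec (A := fun p : e.Sample × e.Sample =>
    e.sigmaHatAt (s, p.1) p.2) (v := fun p => e.S (s, p.1) p.2) (fun i k => ?_)
    (fun p => e.isHermitian_sigmaHatAt _ _)
    (fun l => e.measurable_meanDiff_apply (s := s) hx hy (hg l)) (e.scale s)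
  simp only [sigmaHatAt, Matrix.of_apply]
  exact ((measurable_empCov_apply (testSet s.1) hx (hg i) (hg k)).const_mul _).fun_add
    ((measurable_empCov_apply (testSet s.2) hy (hg i) (hg k)).const_mul _)

theorem measurable_statAt_swap : Measurable fun p : (e.Sample × e.Sample) × Split e.nx e.ny =>
    e.statAt (p.2, p.1.1) p.1.2 := by
  refine measurable_from_prod_countable_left fun s => ?_
  have h := e.measurable_statAt_of_split s
  exact h

/-- The statistic is jointly measurable in the fitting data and the sample. -/
theorem measurable_statAt :
    Measurable fun p : FitData e.nx e.ny e.d × e.Sample => e.statAt p.1 p.2 := by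
  have h3 : Measurable fun p : FitData e.nx e.ny e.d × e.Sample => ((p.1.2, p.2), p.1.1) :=
    ((measurable_snd.comp measurable_fst).prodMk measurable_snd).prodMk
      (measurable_fst.comp measurable_fst)
  have h := e.measurable_statAt_swap.comp h3
  exact h

/-! #### Weights -/

/-- The weight of each observation in the standardised mean difference. -/
noncomputable def weight (s : Split e.nx e.ny) : Fin e.nx ⊕ Fin e.ny → ℝ :=
  Sum.elim (fun i => if i ∈ testSet s.1 then e.scale s * (e.nxTest s)⁻¹ else 0)
    (fun i => if i ∈ testSet s.2 then -(e.scale s * (e.nyTest s)⁻¹) else 0)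

theorem scale_mul_S (F : FitData e.nx e.ny e.d) (q : e.Sample) (j : Fin m) :
    e.scale F.1 * e.S F q j = ∑ i, e.weight F.1 i * e.g F j (Sum.elim q.1 q.2 i) := by
  simp only [S, meanDiff, weight, Fintype.sum_sum_type, Sum.elim_inl, Sum.elim_inr, ite_mul,
    zero_mul, Finset.sum_ite_mem, Finset.univ_inter, nxTest, nyTest, Finset.mul_sum, mul_sub]
  rw [← sub_neg_eq_add, ← Finset.sum_neg_distrib]
  congr 1
  · exact Finset.sum_congr rfl fun i _ => by ring
  · exact Finset.sum_congr rfl fun i _ => by ring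

section Weights

variable {e} {s : Split e.nx e.ny}

theorem sum_weight (hx : 0 < e.nxTest s) (hy : 0 < e.nyTest s) : ∑ i, e.weight s i = 0 := by
  simp only [weight, Fintype.sum_sum_type, Sum.elim_inl, Sum.elim_inr, Finset.sum_ite_mem,
    Finset.univ_inter, Finset.sum_const, nsmul_eq_mul]
  have h1 : ((testSet s.1).card : ℝ) = e.nxTest s := rfl
  have h2 : ((testSet s.2).card : ℝ) = e.nyTest s := rfl
  rw [h1, h2]
  field_simp
  ring

theorem scale_sq (s : Split e.nx e.ny) :
    e.scale s ^ 2 = e.nxTest s * e.nyTest s / (e.nxTest s + e.nyTest s) := by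
  have h1 : 0 ≤ e.nxTest s := Nat.cast_nonneg _
  have h2 : 0 ≤ e.nyTest s := Nat.cast_nonneg _
  rw [scale, Real.sq_sqrt (by positivity)]

theorem sum_weight_sq (hx : 0 < e.nxTest s) (hy : 0 < e.nyTest s) :
    ∑ i, e.weight s i ^ 2 = 1 := by
  simp only [weight, Fintype.sum_sum_type, Sum.elim_inl, Sum.elim_inr, ite_pow, neg_sq, mul_pow,
    scale_sq, ne_eq, OfNat.ofNat_ne_zero, not_false_eq_true, zero_pow, Finset.sum_ite_mem,
    Finset.univ_inter, Finset.sum_const, nsmul_eq_mul]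
  have h1 : ((testSet s.1).card : ℝ) = e.nxTest s := rfl
  have h2 : ((testSet s.2).card : ℝ) = e.nyTest s := rfl
  rw [h1, h2]
  field_simp
  ring

theorem abs_weight_le {k : ℝ} (hk : 0 < k) (hx : k ≤ e.nxTest s) (hy : k ≤ e.nyTest s)
    (i : Fin e.nx ⊕ Fin e.ny) : |e.weight s i| ≤ (√k)⁻¹ := by
  have hx0 : 0 < e.nxTest s := hk.trans_le hx
  have hy0 : 0 < e.nyTest s := hk.trans_le hy
  have hk2 : ((√k)⁻¹) ^ 2 = k⁻¹ := by rw [inv_pow, Real.sq_sqrt hk.le]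
  refine abs_le_of_sq_le_sq ?_ (by positivity)
  rw [hk2]
  rcases i with i | i
  · simp only [weight, Sum.elim_inl]
    split_ifs
    · rw [mul_pow, scale_sq]
      calc _ = e.nyTest s / (e.nxTest s + e.nyTest s) * (e.nxTest s)⁻¹ := by field_simp
        _ ≤ 1 * k⁻¹ := by
          gcongr
          rw [div_le_one (by positivity)]
          linarith
        _ = _ := one_mul _
    · simp [hk.le]
  · simp only [weight, Sum.elim_inr]
    split_ifs
    · rw [neg_sq, mul_pow, scale_sq]
      calc _ = e.nxTest s / (e.nxTest s + e.nyTest s) * (e.nyTest s)⁻¹ := by field_simp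
        _ ≤ 1 * k⁻¹ := by
          gcongr
          rw [div_le_one (by positivity)]
          linarith
        _ = _ := one_mul _
    · simp [hk.le]

end Weights

/-! #### Laws -/

theorem measurable_elim (i : Fin e.nx ⊕ Fin e.ny) : Measurable (Sum.elim e.X e.Y i) := by
  rcases i with i | i
  · exact e.measurable_X i
  · exact e.measurable_Y i

theorem law_sample : e.P.map e.sample =
    (Measure.pi fun _ : Fin e.nx => e.μ).prod (Measure.pi fun _ : Fin e.ny => e.ν) := by
  have h := (iIndepFun_iff_map_fun_eq_pi_map fun i => (e.measurable_elim i).aemeasurable).1 e.indep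
  have h2 := (measurePreserving_sumPiEquivProdPi
    (X := fun _ : Fin e.nx ⊕ Fin e.ny => EuclideanSpace ℝ (Fin e.d))
    (fun i => e.P.map (Sum.elim e.X e.Y i))).map_eq
  rw [← h, Measure.map_map (MeasurableEquiv.measurable _)
    (measurable_pi_lambda _ fun i => e.measurable_elim i)] at h2
  have e1 : ∀ i, e.P.map (Sum.elim e.X e.Y (Sum.inl i)) = e.μ := e.law_X
  have e2 : ∀ i, e.P.map (Sum.elim e.X e.Y (Sum.inr i)) = e.ν := e.law_Y
  simp only [e1, e2] at h2
  rw [← h2]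
  rfl

variable {e}

theorem law_elim (hμν : e.μ = e.ν) (i : Fin e.nx ⊕ Fin e.ny) :
    e.P.map (Sum.elim e.X e.Y i) = e.μ := by
  rcases i with i | i
  · exact e.law_X i
  · rw [hμν]; exact e.law_Y i

theorem sigma_eq_popCov (hμν : e.μ = e.ν) {F : FitData e.nx e.ny e.d}
    (hx : 0 < e.nxTest F.1) (hy : 0 < e.nyTest F.1) {b : ℝ} (hb : ∀ j x, |e.g F j x| ≤ b) :
    e.Sigma F = popCov e.μ (e.g F) := by
  have hg : ∀ j, BddMeas (e.g F j) := fun j => ⟨e.measurable_g F j, b, hb j⟩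
  have hgZ : ∀ i j, BddMeas fun ω => e.weight F.1 i * e.g F j (Sum.elim e.X e.Y i ω) := fun i j =>
    (BddMeas.const _).mul ((hg j).comp (e.measurable_elim i))
  have hS : ∀ j, Measurable fun q : e.Sample => e.scale F.1 * e.S F q j := fun j => by
    refine Measurable.const_mul ?_ _
    exact e.measurable_meanDiff_apply (s := F.1) measurable_fst measurable_snd
      ((e.measurable_g F j).comp measurable_snd)
  ext j l
  simp only [Sigma, Matrix.of_apply, popCov]
  rw [← e.law_sample]
  have hcov : cov[fun q => e.scale F.1 * e.S F q j, fun q => e.scale F.1 * e.S F q l;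
      e.P.map e.sample] = cov[fun ω => e.scale F.1 * e.S F (e.sample ω) j,
        fun ω => e.scale F.1 * e.S F (e.sample ω) l; e.P] := by
    exact covariance_map (hS j).aestronglyMeasurable (hS l).aestronglyMeasurable
      e.measurable_sample.aemeasurable
  rw [hcov]
  have hsum : ∀ j, (fun ω => e.scale F.1 * e.S F (e.sample ω) j) =
      fun ω => ∑ i, e.weight F.1 i * e.g F j (Sum.elim e.X e.Y i ω) := fun j => by
    ext ω
    rw [scale_mul_S]
    refine Finset.sum_congr rfl fun i _ => ?_
    rcases i with i | i <;> rfl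
  rw [hsum, hsum, covariance_fun_sum_fun_sum (fun i => (hgZ i j).memLp _ 2)
    (fun i => (hgZ i l).memLp _ 2)]
  have hdiag : ∀ i, ∑ i', cov[fun ω => e.weight F.1 i * e.g F j (Sum.elim e.X e.Y i ω),
      fun ω => e.weight F.1 i' * e.g F l (Sum.elim e.X e.Y i' ω); e.P] =
      e.weight F.1 i ^ 2 * cov[e.g F j, e.g F l; e.μ] := by
    intro i
    rw [Finset.sum_eq_single i]
    · rw [covariance_const_mul_left, covariance_const_mul_right, ← mul_assoc, ← sq,
        ← law_elim hμν i]
      congr 1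
      exact (covariance_map (e.measurable_g F j).aestronglyMeasurable
        (e.measurable_g F l).aestronglyMeasurable (e.measurable_elim i).aemeasurable).symm
    · intro i' _ hi'
      refine IndepFun.covariance_eq_zero ?_ ((hgZ i j).memLp _ 2) ((hgZ i' l).memLp _ 2)
      exact (e.indep.indepFun hi'.symm).comp ((e.measurable_g F j).const_mul _)
        ((e.measurable_g F l).const_mul _)
    · simp
  simp only [hdiag]
  rw [← Finset.sum_mul, sum_weight_sq hx hy, one_mul]

end Experiment

/-! ### The distribution function of `max_j |Z_j|` -/

/-- The distribution function of `max_j |Z_j|` for `Z ∼ N(0, I_m)`. -/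
noncomputable def maxCDF (m : ℕ) (t : ℝ) : ℝ := cubeProb m (max t 0)

theorem iSup_abs_le_iff {m : ℕ} (hm : 1 ≤ m) (z : Fin m → ℝ) (t : ℝ) :
    (⨆ j, |z j|) ≤ t ↔ ∀ j, |z j| ≤ t := by
  have : Nonempty (Fin m) := ⟨⟨0, hm⟩⟩
  exact ciSup_le_iff (Set.finite_range _).bddAbove

theorem maxCDF_of_nonpos {m : ℕ} (hm : 1 ≤ m) {t : ℝ} (ht : t ≤ 0) : maxCDF m t = 0 := by
  rw [maxCDF, max_eq_right ht, cubeProb, neg_zero, sub_self, zero_pow (by omega)]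

theorem stdNormal_real_iSup_abs_le {m : ℕ} (hm : 1 ≤ m) (t : ℝ) :
    (stdNormal m).real {z | (⨆ j, |z j|) ≤ t} = maxCDF m t := by
  have hset : {z : Fin m → ℝ | (⨆ j, |z j|) ≤ t} = Set.univ.pi fun _ => Set.Icc (-t) t := by
    ext z
    simp [iSup_abs_le_iff hm, abs_le, Pi.le_def, forall_and]
  rw [hset, measureReal_def, Measure.pi_pi, ENNReal.toReal_prod, Finset.prod_const,
    Finset.card_univ, Fintype.card_fin]
  rcases lt_or_ge t 0 with ht | ht
  · rw [maxCDF_of_nonpos hm ht.le, Set.Icc_eq_empty (by linarith)]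
    simp; omega
  · rw [maxCDF, max_eq_left ht, cubeProb]
    congr 1
    have := nullSingletonClass_gaussianReal (μ := 0) (v := 1) one_ne_zero
    rw [← measureReal_def, measureReal_congr Ioc_ae_eq_Icc.symm,
      show Set.Ioc (-t) t = Set.Iic t \ Set.Iic (-t) by ext; simp [and_comm],
      measureReal_sdiff (Set.Iic_subset_Iic.2 (by linarith)) measurableSet_Iic]
    rfl

theorem abs_maxCDF_sub_le (m : ℕ) (a b : ℝ) : |maxCDF m a - maxCDF m b| ≤ 2 * m * |a - b| := by
  refine (abs_cubeProb_sub_le_abs_sub m _ _).trans ?_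
  exact mul_le_mul_of_nonneg_left (abs_max_sub_max_le_abs a b 0) (by positivity)

theorem one_sub_maxCDF_le {m : ℕ} {M : ℝ} (hM : 0 ≤ M) :
    1 - maxCDF m M ≤ 2 * m * Real.exp (-M ^ 2 / 2) := by
  rw [maxCDF, max_eq_left hM, cubeProb]
  have h1 := one_sub_normalCDF_le hM
  have h2 := normalCDF_le_exp (z := -M) (by linarith)
  rw [neg_sq] at h2
  have h3 := one_add_mul_le_pow (a := normalCDF M - normalCDF (-M) - 1)
    (by linarith [monotone_normalCDF (show -M ≤ M by linarith)]) m
  rw [add_sub_cancel] at h3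
  have hm : (0:ℝ) ≤ m := Nat.cast_nonneg m
  nlinarith [mul_le_mul_of_nonneg_left h1 hm, mul_le_mul_of_nonneg_left h2 hm]

theorem maxCDF_mem_Icc {m : ℕ} (hm : 1 ≤ m) (t : ℝ) : maxCDF m t ∈ Set.Icc (0 : ℝ) 1 := by
  rw [← stdNormal_real_iSup_abs_le hm]
  exact ⟨measureReal_nonneg, measureReal_le_one⟩

theorem abs_iSup_abs_sub_le {m : ℕ} (hm : 1 ≤ m) {u v : Fin m → ℝ} {K : ℝ}
    (h : ∀ j, |u j - v j| ≤ K) : |(⨆ j, |u j|) - (⨆ j, |v j|)| ≤ K := by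
  have hu := (iSup_abs_le_iff hm u _).1 le_rfl
  have hv := (iSup_abs_le_iff hm v _).1 le_rfl
  have h1 : (⨆ j, |u j|) ≤ (⨆ j, |v j|) + K := (iSup_abs_le_iff hm u _).2 fun j => by
    linarith [hv j, h j, abs_sub_abs_le_abs_sub (u j) (v j)]
  have h2 : (⨆ j, |v j|) ≤ (⨆ j, |u j|) + K := (iSup_abs_le_iff hm v _).2 fun j => by
    linarith [hu j, h j, abs_sub_abs_le_abs_sub (v j) (u j), abs_sub_comm (u j) (v j)]
  exact abs_le.2 ⟨by linarith, by linarith⟩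

theorem StdSum.mono {Ω ι : Type*} [MeasurableSpace Ω] [Fintype ι] {P : Measure Ω} {m : ℕ}
    {ξ : ι → Ω → Fin m → ℝ} {β β' : ℝ} (h : StdSum P ξ β) (hβ : β ≤ β') : StdSum P ξ β' :=
  ⟨h.meas, h.indep, fun i ω j => (h.bound i ω j).trans hβ, h.mean, h.cov⟩

namespace Experiment

variable {m : ℕ} {e : Experiment m}

theorem statAt_eq (F : FitData e.nx e.ny e.d) (q : e.Sample) :
    e.statAt F q =
      ⨆ j, |(invSqrt (e.sigmaHatAt F q) *ᵥ fun l => e.scale F.1 * e.S F q l) j| := by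
  have h0 : 0 ≤ e.scale F.1 := Real.sqrt_nonneg _
  have h : (fun l => e.scale F.1 * e.S F q l) = e.scale F.1 • e.S F q := rfl
  simp only [statAt, h, Matrix.mulVec_smul, Pi.smul_apply, smul_eq_mul, abs_mul, abs_of_nonneg h0]

theorem abs_sigmaHatAt_sub_le {F : FitData e.nx e.ny e.d} (hx : 0 < e.nxTest F.1)
    (hy : 0 < e.nyTest F.1) {q : e.Sample} {C : Matrix (Fin m) (Fin m) ℝ} {r : ℝ} {j l : Fin m}
    (h1 : |empCov (testSet F.1.1) q.1 (e.g F j) (e.g F l) - C j l| ≤ r)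
    (h2 : |empCov (testSet F.1.2) q.2 (e.g F j) (e.g F l) - C j l| ≤ r) :
    |C j l - e.sigmaHatAt F q j l| ≤ r := by
  simp only [sigmaHatAt, Matrix.of_apply]
  set x := e.nxTest F.1
  set y := e.nyTest F.1
  set A := empCov (testSet F.1.1) q.1 (e.g F j) (e.g F l)
  set B := empCov (testSet F.1.2) q.2 (e.g F j) (e.g F l)
  have e1 : C j l - (y / (x + y) * A + x / (x + y) * B) =
      -(y / (x + y) * (A - C j l) + x / (x + y) * (B - C j l)) := by
    field_simp
    ring
  rw [e1, abs_neg]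
  have p1 : 0 ≤ y / (x + y) := by positivity
  have p2 : 0 ≤ x / (x + y) := by positivity
  calc _ ≤ |y / (x + y) * (A - C j l)| + |x / (x + y) * (B - C j l)| := abs_add_le _ _
    _ = y / (x + y) * |A - C j l| + x / (x + y) * |B - C j l| := by
      rw [abs_mul, abs_mul, abs_of_nonneg p1, abs_of_nonneg p2]
    _ ≤ y / (x + y) * r + x / (x + y) * r := by gcongr
    _ = r := by field_simp; ring

/-- Normal approximation of the statistic for fixed fitting data. -/
theorem abs_prob_statAt_le_sub_le (hm : 1 ≤ m) (hμν : e.μ = e.ν) {F : FitData e.nx e.ny e.d}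
    {k b c r M q β : ℝ} (hk : 0 < k) (hx : k ≤ e.nxTest F.1) (hy : k ≤ e.nyTest F.1)
    (hb : ∀ j x, |e.g F j x| ≤ b) (hc : 0 < c) (hs : spectrum ℝ (e.Sigma F) ⊆ Set.Ici c)
    (hβ0 : 0 < β) (hβ : m * ((√c)⁻¹ * ((√k)⁻¹ * (2 * b))) ≤ β) (hβ1 : β ≤ 1)
    (hr0 : 0 ≤ r) (hr : m * r ≤ c / 2) (hM : 0 ≤ M)
    (hqX : e.P.real {ω | ∃ j l, r < |empCov (testSet F.1.1) (fun i => e.X i ω) (e.g F j) (e.g F l)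
      - popCov e.μ (e.g F) j l|} ≤ q)
    (hqY : e.P.real {ω | ∃ j l, r < |empCov (testSet F.1.2) (fun i => e.Y i ω) (e.g F j) (e.g F l)
      - popCov e.μ (e.g F) j l|} ≤ q) (t : ℝ) :
    |e.P.real {ω | e.statAt F (e.sample ω) ≤ t} - maxCDF m t| ≤
      2 * (20000000 * m ^ 4 * β * (1 + Real.log (1 / β))) + 2 * m * (2 * m ^ 3 / c * r * M) +
        2 * m * Real.exp (-M ^ 2 / 2) + 2 * q := by
  have : Nonempty (Fin m) := ⟨⟨0, hm⟩⟩
  have hx0 : 0 < e.nxTest F.1 := hk.trans_le hx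
  have hy0 : 0 < e.nyTest F.1 := hk.trans_le hy
  rw [sigma_eq_popCov hμν hx0 hy0 hb] at hs
  set C := popCov e.μ (e.g F) with hC
  have hstd := (stdSum_of_iid e.measurable_elim e.indep (law_elim hμν) (e.measurable_g F) hb hc hs
    (sum_weight_sq hx0 hy0) (abs_weight_le hk hx hy)).mono hβ
  set ξ : Fin e.nx ⊕ Fin e.ny → e.Ω → Fin m → ℝ := fun i ω => invSqrt C *ᵥ
    fun l => e.weight F.1 i * (e.g F l (Sum.elim e.X e.Y i ω) - ∫ y, e.g F l y ∂e.μ) with hξ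
  have hsum : ∀ ω, ∑ i, ξ i ω = invSqrt C *ᵥ fun l => e.scale F.1 * e.S F (e.sample ω) l := by
    intro ω
    simp only [hξ]
    rw [← Matrix.mulVec_sum]
    congr 1
    ext l
    rw [Finset.sum_apply, scale_mul_S]
    simp only [mul_sub, Finset.sum_sub_distrib]
    rw [← Finset.sum_mul, sum_weight hx0 hy0, zero_mul, sub_zero]
    refine Finset.sum_congr rfl fun i _ => ?_
    rcases i with i | i <;> rfl
  have hWm : Measurable fun ω => ⨆ j, |(∑ i, ξ i ω) j| := by
    refine Measurable.iSup fun j => ?_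
    exact continuous_abs.measurable.comp ((measurable_pi_apply j).comp hstd.measurable_sum)
  have hH : ∀ a, |e.P.real {ω | (⨆ j, |(∑ i, ξ i ω) j|) ≤ a} - maxCDF m a| ≤
      20000000 * m ^ 4 * β * (1 + Real.log (1 / β)) := by
    intro a
    simp only [iSup_abs_le_iff hm]
    rcases lt_or_ge a 0 with ha | ha
    · have h0 : {ω | ∀ j, |(∑ i, ξ i ω) j| ≤ a} = ∅ := by
        ext ω
        simp only [Set.mem_ofPred_eq, Set.mem_empty_iff_false, iff_false]
        intro h
        linarith [h ⟨0, hm⟩, abs_nonneg ((∑ i, ξ i ω) ⟨0, hm⟩)]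
      rw [h0, maxCDF_of_nonpos hm ha.le]
      have : 0 ≤ Real.log (1 / β) := Real.log_nonneg (by rw [le_div_iff₀ hβ0]; linarith)
      rw [measureReal_empty, sub_zero, abs_zero]
      positivity
    · rw [maxCDF, max_eq_left ha]
      exact hstd.abs_prob_cube_sub_le hβ0 hβ1 ha
  have hbad := (measureReal_union_le (μ := e.P)
    {ω | ∃ j l, r < |empCov (testSet F.1.1) (fun i => e.X i ω) (e.g F j) (e.g F l) - C j l|}
    {ω | ∃ j l, r < |empCov (testSet F.1.2) (fun i => e.Y i ω) (e.g F j) (e.g F l) - C j l|}).trans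
    (add_le_add hqX hqY)
  refine (abs_prob_le_sub_le hWm hH (abs_maxCDF_sub_le m)
    (κ := 2 * m ^ 3 / c * r) (by positivity) hM hbad (fun ω hω => ?_) t).trans ?_
  · simp only [Set.mem_union, Set.mem_ofPred_eq, not_or, not_exists, not_lt] at hω
    rw [statAt_eq]
    refine abs_iSup_abs_sub_le hm fun j => ?_
    rw [hsum]
    have hΔ : ∀ i l, |C i l - e.sigmaHatAt F (e.sample ω) i l| ≤ r := fun i l =>
      abs_sigmaHatAt_sub_le (C := C) (q := e.sample ω) hx0 hy0 (hω.1 i l) (hω.2 i l)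
    refine abs_invSqrt_mulVec_sub_le (isHermitian_popCov _ _) (e.isHermitian_sigmaHatAt _ _) hc hs hr
      hΔ (fun l => ?_) j
    exact le_ciSup (f := fun l => |(invSqrt C *ᵥ fun l => e.scale F.1 * e.S F (e.sample ω) l) l|)
      (Set.finite_range _).bddAbove l
  · linarith [one_sub_maxCDF_le (m := m) hM]

end Experiment

/-! ### Conditioning on the fitting data -/

/-- Replacing some coordinates of a vector with product law by those of an independent copy does
not change the law. -/
theorem measurePreserving_merge {ι E : Type*} [Fintype ι] [MeasurableSpace E]
    (μ : ι → Measure E) [∀ i, IsProbabilityMeasure (μ i)] (b : ι → Bool) :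
    MeasurePreserving (fun p : (ι → E) × (ι → E) => fun i => if b i = true then p.1 i else p.2 i)
      ((Measure.pi μ).prod (Measure.pi μ)) (Measure.pi μ) := by
  have hmeas : Measurable
      (fun p : (ι → E) × (ι → E) => fun i => if b i = true then p.1 i else p.2 i) := by
    refine measurable_pi_lambda _ fun i => ?_
    by_cases h : b i = true
    · simp only [h, if_true]
      exact (measurable_pi_apply i).comp measurable_fst
    · simp only [h]
      exact (measurable_pi_apply i).comp measurable_snd
  refine ⟨hmeas, (Measure.pi_eq fun s hs => ?_).symm⟩
  rw [Measure.map_apply hmeas (MeasurableSet.univ_pi hs)]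
  have hpre : (fun p : (ι → E) × (ι → E) => fun i => if b i = true then p.1 i else p.2 i) ⁻¹'
      Set.univ.pi s = (Set.univ.pi fun i => if b i = true then s i else Set.univ) ×ˢ
        (Set.univ.pi fun i => if b i = true then Set.univ else s i) := by
    ext p
    simp only [Set.mem_preimage, Set.mem_pi, Set.mem_univ, true_implies, Set.mem_prod, ← forall_and]
    refine forall_congr' fun i => ?_
    by_cases h : b i = true <;> simp [h]
  rw [hpre, Measure.prod_prod, Measure.pi_pi, Measure.pi_pi, ← Finset.prod_mul_distrib]
  refine Finset.prod_congr rfl fun i _ => ?_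
  by_cases h : b i = true <;> simp [h]

/-- If a statistic computed from the split, a first sample and a second sample does not change
when both samples are replaced by their mixture along the split, then its law at a single sample
is a mixture of laws at independent samples. -/
theorem prob_le_eq_lintegral_of_merge {Ω ι E S : Type*} [MeasurableSpace Ω] {P : Measure Ω}
    [IsProbabilityMeasure P] [Fintype ι] [MeasurableSpace E] [MeasurableSpace S]
    {stat : S → (ι → E) → (ι → E) → ℝ}
    (hstat : Measurable fun p : (S × (ι → E)) × (ι → E) => stat p.1.1 p.1.2 p.2) (b : S → ι → Bool)
    (hmerge : ∀ s z z', stat s (fun i => if b s i = true then z i else z' i)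
      (fun i => if b s i = true then z i else z' i) = stat s z z')
    {μ : ι → Measure E} [∀ i, IsProbabilityMeasure (μ i)] {s : Ω → S} {z : Ω → ι → E}
    (hs : Measurable s) (hz : Measurable z) (hlaw : P.map z = Measure.pi μ)
    (hind : P.map (fun ω => (s ω, z ω)) = (P.map s).prod (P.map z)) (t : ℝ) :
    P {ω | stat (s ω) (z ω) (z ω) ≤ t} =
      ∫⁻ ω, P {ω' | stat (s ω) (z ω) (z ω') ≤ t} ∂P := by
  set Q := P.map z with hQ
  have hQp : IsProbabilityMeasure Q := Measure.isProbabilityMeasure_map hz.aemeasurable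
  have hcs : ∀ s, Measurable fun p : (ι → E) × (ι → E) => stat s p.1 p.2 := fun s =>
    hstat.comp ((measurable_const.prodMk measurable_fst).prodMk measurable_snd)
  have hin : Measurable fun p : S × (ι → E) => Q {z' | stat p.1 p.2 z' ≤ t} :=
    measurable_measure_prodMk_left (measurableSet_le hstat measurable_const)
  have hdiag : Measurable fun p : S × (ι → E) => stat p.1 p.2 p.2 :=
    hstat.comp (measurable_id.prodMk measurable_snd)
  have hsz := hs.prodMk hz
  have lhs : P {ω | stat (s ω) (z ω) (z ω) ≤ t} = ∫⁻ s, Q {z | stat s z z ≤ t} ∂P.map s := by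
    have h1 : P {ω | stat (s ω) (z ω) (z ω) ≤ t} = P.map (fun ω => (s ω, z ω))
        {p | stat p.1 p.2 p.2 ≤ t} := by
      rw [Measure.map_apply hsz (measurableSet_le hdiag measurable_const)]
      rfl
    rw [h1, hind, Measure.prod_apply (measurableSet_le hdiag measurable_const)]
    rfl
  have rhs : ∫⁻ ω, P {ω' | stat (s ω) (z ω) (z ω') ≤ t} ∂P =
      ∫⁻ s, ∫⁻ z, Q {z' | stat s z z' ≤ t} ∂Q ∂P.map s := by
    have h1 : ∀ ω, P {ω' | stat (s ω) (z ω) (z ω') ≤ t} =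
        Q {z' | stat (s ω) (z ω) z' ≤ t} := by
      intro ω
      have h2 : MeasurableSet {z' | stat (s ω) (z ω) z' ≤ t} := measurableSet_le
        ((hcs (s ω)).comp (measurable_const.prodMk measurable_id)) measurable_const
      rw [hQ, Measure.map_apply hz h2]
      rfl
    simp only [h1]
    rw [← lintegral_prod _ hin.aemeasurable, ← hind, lintegral_map hin hsz]
  rw [lhs, rhs]
  refine lintegral_congr fun s => ?_
  have hmp := measurePreserving_merge μ (b s)
  rw [← hlaw] at hmp
  have hd : MeasurableSet {z | stat s z z ≤ t} :=
    measurableSet_le ((hcs s).comp (measurable_id.prodMk measurable_id)) measurable_const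
  rw [← hmp.measure_preimage hd.nullMeasurableSet]
  have hpre : (fun p : (ι → E) × (ι → E) => fun i => if b s i = true then p.1 i else p.2 i) ⁻¹'
      {z | stat s z z ≤ t} = {p | stat s p.1 p.2 ≤ t} := by
    ext p
    change stat s _ _ ≤ t ↔ stat s p.1 p.2 ≤ t
    rw [hmerge]
  rw [hpre, Measure.prod_apply (measurableSet_le (hcs s) measurable_const)]
  rfl

theorem measurable_mask {Ω : Type*} [MeasurableSpace Ω] {a d : ℕ} {s : Ω → Fin a → Bool}
    {x : Ω → Fin a → EuclideanSpace ℝ (Fin d)} (hs : Measurable s) (hx : Measurable x) :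
    Measurable fun ω => mask (s ω) (x ω) := by
  refine measurable_pi_lambda _ fun i => ?_
  refine Measurable.ite ?_ ((measurable_pi_apply i).comp hx) measurable_const
  exact ((measurable_pi_apply i).comp hs) (measurableSet_singleton true)

theorem measurable_observed {Ω' : Type*} [MeasurableSpace Ω'] {a b d : ℕ} {s : Ω' → Split a b}
    {x : Ω' → Fin a → EuclideanSpace ℝ (Fin d)} {y : Ω' → Fin b → EuclideanSpace ℝ (Fin d)}
    (hs : Measurable s) (hx : Measurable x) (hy : Measurable y) :
    Measurable fun ω => observed (s ω) (x ω) (y ω) :=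
  hs.prodMk ((measurable_mask (measurable_fst.comp hs) hx).prodMk
    (measurable_mask (measurable_snd.comp hs) hy))

theorem mask_merge {a d : ℕ} (s : Fin a → Bool) (x y : Fin a → EuclideanSpace ℝ (Fin d)) :
    mask s (fun i => if s i = true then x i else y i) = mask s x := by
  ext1 i
  by_cases h : s i = true <;> simp [mask, h]

theorem meanDiff_congr {a b : ℕ} {E : Type*} {I : Finset (Fin a)} {J : Finset (Fin b)}
    {x x' : Fin a → E} {y y' : Fin b → E} (hx : ∀ i ∈ I, x i = x' i) (hy : ∀ i ∈ J, y i = y' i)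
    (g : E → ℝ) : meanDiff I J x y g = meanDiff I J x' y' g := by
  unfold meanDiff
  have h1 : ∑ i ∈ I, g (x i) = ∑ i ∈ I, g (x' i) := Finset.sum_congr rfl fun i hi => by rw [hx i hi]
  have h2 : ∑ i ∈ J, g (y i) = ∑ i ∈ J, g (y' i) := Finset.sum_congr rfl fun i hi => by rw [hy i hi]
  rw [h1, h2]

theorem empCov_congr {a : ℕ} {E : Type*} {I : Finset (Fin a)} {x x' : Fin a → E}
    (hx : ∀ i ∈ I, x i = x' i) (g h : E → ℝ) : empCov I x g h = empCov I x' g h := by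
  unfold empCov
  have h1 : ∀ f : E → ℝ, ∑ i ∈ I, f (x i) = ∑ i ∈ I, f (x' i) := fun f =>
    Finset.sum_congr rfl fun i hi => by rw [hx i hi]
  rw [h1 g, h1 h]
  congr 1
  exact Finset.sum_congr rfl fun i hi => by rw [hx i hi]

namespace Experiment

variable {m : ℕ} (e : Experiment m)

/-- The pooled sample. -/
def pooled (ω : e.Ω) : Fin e.nx ⊕ Fin e.ny → EuclideanSpace ℝ (Fin e.d) :=
  fun i => Sum.elim e.X e.Y i ω

variable {e} in
theorem statAt_congr {F : FitData e.nx e.ny e.d} {q q' : e.Sample}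
    (hx : ∀ i ∈ testSet F.1.1, q.1 i = q'.1 i) (hy : ∀ i ∈ testSet F.1.2, q.2 i = q'.2 i) :
    e.statAt F q = e.statAt F q' := by
  have h1 : e.sigmaHatAt F q = e.sigmaHatAt F q' := by
    ext j l
    simp only [sigmaHatAt, Matrix.of_apply]
    rw [empCov_congr hx, empCov_congr hy]
  have h2 : e.S F q = e.S F q' := by
    ext j
    exact meanDiff_congr hx hy _
  simp only [statAt, h1, h2]

/-- The statistic fitted on the pooled sample `z` and evaluated on another pooled sample. -/
noncomputable def crossStat (s : Split e.nx e.ny)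
    (z z' : Fin e.nx ⊕ Fin e.ny → EuclideanSpace ℝ (Fin e.d)) : ℝ :=
  e.statAt (observed s (fun i => z (.inl i)) fun i => z (.inr i))
    (fun i => z' (.inl i), fun i => z' (.inr i))

theorem crossStat_merge (s : Split e.nx e.ny)
    (z z' : Fin e.nx ⊕ Fin e.ny → EuclideanSpace ℝ (Fin e.d)) :
    e.crossStat s (fun i => if Sum.elim s.1 s.2 i = true then z i else z' i)
      (fun i => if Sum.elim s.1 s.2 i = true then z i else z' i) = e.crossStat s z z' := by
  have h1 : observed s (fun i => if s.1 i = true then z (.inl i) else z' (.inl i))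
      (fun i => if s.2 i = true then z (.inr i) else z' (.inr i)) =
      observed s (fun i => z (.inl i)) fun i => z (.inr i) := by
    simp only [observed, mask_merge]
  have h2 := e.statAt_congr (F := observed s (fun i => z (.inl i)) fun i => z (.inr i))
    (q := (fun i => if s.1 i = true then z (.inl i) else z' (.inl i),
      fun i => if s.2 i = true then z (.inr i) else z' (.inr i)))
    (q' := (fun i => z' (.inl i), fun i => z' (.inr i))) (fun i hi => by
      have h3 := (Finset.mem_filter.1 hi).2
      simp only [observed] at h3
      simp [h3]) (fun i hi => by
      have h3 := (Finset.mem_filter.1 hi).2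
      simp only [observed] at h3
      simp [h3])
  rw [← h1] at h2
  rw [crossStat, crossStat, ← h1]
  exact h2

theorem measurable_pooled : Measurable e.pooled :=
  measurable_pi_lambda _ e.measurable_elim

theorem measurable_crossStat : Measurable fun p : (Split e.nx e.ny ×
    (Fin e.nx ⊕ Fin e.ny → EuclideanSpace ℝ (Fin e.d))) ×
    (Fin e.nx ⊕ Fin e.ny → EuclideanSpace ℝ (Fin e.d)) => e.crossStat p.1.1 p.1.2 p.2 := by
  have hl : Measurable fun z : Fin e.nx ⊕ Fin e.ny → EuclideanSpace ℝ (Fin e.d) =>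
      fun i => z (Sum.inl i) := measurable_pi_lambda _ fun i => measurable_pi_apply _
  have hr : Measurable fun z : Fin e.nx ⊕ Fin e.ny → EuclideanSpace ℝ (Fin e.d) =>
      fun i => z (Sum.inr i) := measurable_pi_lambda _ fun i => measurable_pi_apply _
  have h1 := measurable_observed (measurable_fst.comp measurable_fst)
    (hl.comp (measurable_snd.comp measurable_fst)) (hr.comp (measurable_snd.comp measurable_fst))
    (Ω' := (Split e.nx e.ny × (Fin e.nx ⊕ Fin e.ny → EuclideanSpace ℝ (Fin e.d))) ×
      (Fin e.nx ⊕ Fin e.ny → EuclideanSpace ℝ (Fin e.d)))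
  have h := e.measurable_statAt.comp
    (h1.prodMk ((hl.comp measurable_snd).prodMk (hr.comp measurable_snd)))
  exact h

theorem measurable_T : Measurable e.T := by
  have h := e.measurable_crossStat.comp
    ((e.measurable_split.prodMk e.measurable_pooled).prodMk e.measurable_pooled)
  exact h

theorem map_pooled : e.P.map e.pooled = Measure.pi fun i => e.P.map (Sum.elim e.X e.Y i) :=
  (iIndepFun_iff_map_fun_eq_pi_map fun i => (e.measurable_elim i).aemeasurable).1 e.indep

theorem map_split_pooled : e.P.map (fun ω => (e.split ω, e.pooled ω)) =
    (e.P.map e.split).prod (e.P.map e.pooled) := by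
  refine (indepFun_iff_map_prod_eq_prod_map_map e.measurable_split.aemeasurable
    e.measurable_pooled.aemeasurable).1 ?_
  have h := e.indep_split.comp measurable_id (ψ := fun q : e.Sample => Sum.elim q.1 q.2) (by
    refine measurable_pi_lambda _ fun i => ?_
    rcases i with i | i
    · exact (measurable_pi_apply i).comp measurable_fst
    · exact (measurable_pi_apply i).comp measurable_snd)
  have hpool : e.pooled = (fun q : e.Sample => Sum.elim q.1 q.2) ∘
      fun ω => (fun i => e.X i ω, fun j => e.Y j ω) := by
    funext ω i
    rcases i with i | i <;> rfl
  rw [hpool]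
  exact h

/-- The law of the statistic is the mixture over the fitting data of its laws for fixed
fitting data. -/
theorem prob_T_le_eq_lintegral (t : ℝ) : e.P {ω | e.T ω ≤ t} =
    ∫⁻ ω, e.P {ω' | e.statAt (e.fitData ω) (e.sample ω') ≤ t} ∂e.P := by
  have hprob : ∀ i, IsProbabilityMeasure (e.P.map (Sum.elim e.X e.Y i)) := fun i =>
    Measure.isProbabilityMeasure_map (e.measurable_elim i).aemeasurable
  have h := prob_le_eq_lintegral_of_merge e.measurable_crossStat (fun s => Sum.elim s.1 s.2)
    e.crossStat_merge e.measurable_split e.measurable_pooled e.map_pooled e.map_split_pooled t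
  exact h

theorem measurable_prob_statAt_le (t : ℝ) :
    Measurable fun ω => e.P {ω' | e.statAt (e.fitData ω) (e.sample ω') ≤ t} := by
  have h1 : Measurable fun p : e.Ω × e.Ω => ((e.split p.1, e.pooled p.1), e.pooled p.2) :=
    ((e.measurable_split.prodMk e.measurable_pooled).comp measurable_fst).prodMk
      (e.measurable_pooled.comp measurable_snd)
  have h := measurable_measure_prodMk_left (ν := e.P)
    (measurableSet_le (e.measurable_crossStat.comp h1) (measurable_const (a := t)))
  exact h

variable {e} in
/-- Bounds that hold for almost all fitting data carry over to the statistic. -/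
theorem abs_prob_T_le_sub_le {t G δ : ℝ}
    (h : ∀ᵐ ω ∂e.P, |e.P.real {ω' | e.statAt (e.fitData ω) (e.sample ω') ≤ t} - G| ≤ δ) :
    |e.P.real {ω | e.T ω ≤ t} - G| ≤ δ := by
  have hm := e.measurable_prob_statAt_le t
  have h1 : e.P.real {ω | e.T ω ≤ t} =
      ∫ ω, e.P.real {ω' | e.statAt (e.fitData ω) (e.sample ω') ≤ t} ∂e.P := by
    simp only [measureReal_def]
    rw [integral_toReal hm.aemeasurable (ae_of_all _ fun ω => measure_lt_top _ _),
      prob_T_le_eq_lintegral]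
  have hint : Integrable (fun ω => e.P.real {ω' | e.statAt (e.fitData ω) (e.sample ω') ≤ t})
      e.P := by
    refine integrable_of_abs_le hm.ennreal_toReal (C := 1) ?_
    intro ω
    rw [abs_of_nonneg measureReal_nonneg]
    exact measureReal_le_one
  have h2 : e.P.real {ω | e.T ω ≤ t} - G =
      ∫ ω, (e.P.real {ω' | e.statAt (e.fitData ω) (e.sample ω') ≤ t} - G) ∂e.P := by
    rw [integral_sub hint (integrable_const _), h1]
    simp
  rw [h2]
  simpa using norm_integral_le_of_norm_le_const (μ := e.P) (f := fun ω =>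
    e.P.real {ω' | e.statAt (e.fitData ω) (e.sample ω') ≤ t} - G) h

end Experiment

/-! ### Normal approximation of the statistic -/

theorem card_fitSet_add_card_testSet {a : ℕ} (s : Fin a → Bool) :
    ((fitSet s).card : ℝ) + (testSet s).card = a := by
  have h : (fitSet s).card + (testSet s).card = a := by
    have h1 : testSet s = Finset.univ.filter fun i => ¬ s i = true := by
      simp [testSet]
    rw [fitSet, h1, Finset.card_filter_add_card_filter_not]
    simp
  exact_mod_cast h

theorem popCov_self_le {E : Type*} [MeasurableSpace E] {μ : Measure E} [IsProbabilityMeasure μ]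
    {m : ℕ} {g : Fin m → E → ℝ} {j : Fin m} (hg : Measurable (g j)) {b : ℝ}
    (hb : ∀ x, |g j x| ≤ b) : popCov μ g j j ≤ b ^ 2 := by
  have h1 : popCov μ g j j = Var[g j; μ] := covariance_self hg.aemeasurable
  rw [h1]
  refine (variance_le_expectation_sq hg.aestronglyMeasurable).trans ?_
  have hB : BddMeas (g j) := ⟨hg, b, hb⟩
  calc _ ≤ ∫ _, b ^ 2 ∂μ := by
        refine integral_mono ((hB.pow 2).integrable μ) (integrable_const _) fun x => ?_
        exact sq_le_sq' (abs_le.1 (hb x)).1 (abs_le.1 (hb x)).2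
    _ = _ := by simp

/-- A lower bound for the proportion of test observations of each sample. -/
noncomputable def testFraction (c₁ c₂ : ℝ) : ℝ := (1 - c₂) * min c₁ (1 - c₂)

namespace Experiment

variable {m : ℕ} {e : Experiment m} {c₁ c₂ c₁' c₂' : ℝ}

theorem SampleSizes.two_le (h : e.SampleSizes c₁ c₂) (hc₁ : 0 < c₁) (hc₂ : c₂ < 1) : 2 ≤ e.n := by
  have h1 := h.1.1
  have h2 := h.1.2
  have hx : e.nx ≠ 0 := by
    intro h0
    rw [h0] at h1
    simp at h1
    linarith
  have hy : e.ny ≠ 0 := by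
    intro h0
    rw [h0] at h2
    simp [hx] at h2
    linarith
  simp only [n]
  omega

theorem SampleSizes.ae_le (h : e.SampleSizes c₁ c₂) (hc₁ : 0 < c₁) (hc₂ : c₂ < 1) :
    ∀ᵐ ω ∂e.P, testFraction c₁ c₂ * e.n ≤ e.nxTest (e.fitData ω).1 ∧
      testFraction c₁ c₂ * e.n ≤ e.nyTest (e.fitData ω).1 := by
  have hn := h.two_le hc₁ hc₂
  have hn0 : (0 : ℝ) < e.n := by exact_mod_cast (by omega : 0 < e.n)
  have hncast : (e.n : ℝ) = e.nx + e.ny := by simp [n]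
  obtain ⟨⟨h1, h2⟩, h3⟩ := h
  rw [← hncast] at h1 h2
  rw [le_div_iff₀ hn0] at h1
  rw [div_le_iff₀ hn0] at h2
  have hx0 : (0 : ℝ) < e.nx := by nlinarith
  have hy1 : (1 - c₂) * e.n ≤ e.ny := by linarith
  have hy0 : (0 : ℝ) < e.ny := lt_of_lt_of_le (by nlinarith) hy1
  filter_upwards [h3] with ω hω
  have hfx := hω.1.2
  have hfy := hω.2.2
  rw [div_le_iff₀ hx0] at hfx
  rw [div_le_iff₀ hy0] at hfy
  have e1 := card_fitSet_add_card_testSet (e.split ω).1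
  have e2 := card_fitSet_add_card_testSet (e.split ω).2
  have t1 : (1 - c₂) * e.nx ≤ e.nxTest (e.fitData ω).1 := by
    change _ ≤ ((testSet (e.split ω).1).card : ℝ)
    linarith
  have t2 : (1 - c₂) * e.ny ≤ e.nyTest (e.fitData ω).1 := by
    change _ ≤ ((testSet (e.split ω).2).card : ℝ)
    linarith
  have hc : 0 ≤ 1 - c₂ := by linarith
  refine ⟨le_trans ?_ t1, le_trans ?_ t2⟩
  · rw [testFraction, mul_assoc]
    refine mul_le_mul_of_nonneg_left ?_ hc
    exact (mul_le_mul_of_nonneg_right (min_le_left _ _) hn0.le).trans h1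
  · rw [testFraction, mul_assoc]
    refine mul_le_mul_of_nonneg_left ?_ hc
    exact (mul_le_mul_of_nonneg_right (min_le_right _ _) hn0.le).trans hy1

variable (e) in
theorem ae_abs_g_le : ∀ᵐ ω ∂e.P, ∀ j x, |e.g (e.fitData ω) j x| ≤ e.B j := by
  have h := ae_all_iff.2 e.f_mem
  filter_upwards [h] with ω hω j x
  obtain ⟨_, _, _, _, _, _, h⟩ := hω j
  exact h _

variable (e) in
theorem indep_X : iIndepFun e.X e.P := by
  have h := iIndepFun.precomp Sum.inl_injective e.indep
  exact h

variable (e) in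
theorem indep_Y : iIndepFun e.Y e.P := by
  have h := iIndepFun.precomp Sum.inr_injective e.indep
  exact h

/-- Normal approximation of the statistic, given deviation bounds for the sample covariances. -/
theorem abs_prob_T_le_sub_maxCDF_le (hm : 1 ≤ m) (hμν : e.μ = e.ν) {k b r M q β : ℝ} (hk : 0 < k)
    (hk' : ∀ᵐ ω ∂e.P, k ≤ e.nxTest (e.fitData ω).1 ∧ k ≤ e.nyTest (e.fitData ω).1)
    (hb : ∀ᵐ ω ∂e.P, ∀ j x, |e.g (e.fitData ω) j x| ≤ b) (hc : 0 < c₁')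
    (hs : e.CovBounds c₁' c₂') (hβ0 : 0 < β) (hβ : m * ((√c₁')⁻¹ * ((√k)⁻¹ * (2 * b))) ≤ β)
    (hβ1 : β ≤ 1) (hr0 : 0 ≤ r) (hr : m * r ≤ c₁' / 2) (hM : 0 ≤ M)
    (hq : ∀ F : FitData e.nx e.ny e.d, k ≤ e.nxTest F.1 → k ≤ e.nyTest F.1 →
      (∀ j x, |e.g F j x| ≤ b) → spectrum ℝ (popCov e.μ (e.g F)) ⊆ Set.Icc c₁' c₂' →
      e.P.real {ω | ∃ j l, r < |empCov (testSet F.1.1) (fun i => e.X i ω) (e.g F j) (e.g F l)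
        - popCov e.μ (e.g F) j l|} ≤ q ∧
      e.P.real {ω | ∃ j l, r < |empCov (testSet F.1.2) (fun i => e.Y i ω) (e.g F j) (e.g F l)
        - popCov e.μ (e.g F) j l|} ≤ q) (t : ℝ) :
    |e.P.real {ω | e.T ω ≤ t} - maxCDF m t| ≤
      2 * (20000000 * m ^ 4 * β * (1 + Real.log (1 / β))) + 2 * m * (2 * m ^ 3 / c₁' * r * M) +
        2 * m * Real.exp (-M ^ 2 / 2) + 2 * q := by
  refine abs_prob_T_le_sub_le ?_
  filter_upwards [hk', hb, hs] with ω h1 h2 h3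
  have h4 := hq (e.fitData ω) h1.1 h1.2 h2
    (sigma_eq_popCov hμν (hk.trans_le h1.1) (hk.trans_le h1.2) h2 ▸ h3)
  exact abs_prob_statAt_le_sub_le hm hμν hk h1.1 h1.2 h2 hc
    (h3.trans Set.Icc_subset_Ici_self) hβ0 hβ hβ1 hr0 hr hM h4.1 h4.2 t

/-- The eigenvalue bounds force a lower bound on the sup-norm bound. -/
theorem CovBounds.le_sq (hs : e.CovBounds c₁' c₂') (hm : 1 ≤ m) (hμν : e.μ = e.ν) {k b : ℝ}
    (hk : 0 < k) (hk' : ∀ᵐ ω ∂e.P, k ≤ e.nxTest (e.fitData ω).1 ∧ k ≤ e.nyTest (e.fitData ω).1)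
    (hb : ∀ᵐ ω ∂e.P, ∀ j x, |e.g (e.fitData ω) j x| ≤ b) : c₁' ≤ b ^ 2 := by
  obtain ⟨ω, h1, h2, h3⟩ := (hk'.and (hb.and hs)).exists
  rw [sigma_eq_popCov hμν (hk.trans_le h1.1) (hk.trans_le h1.2) h2] at h3
  have h := mul_dotProduct_le (isHermitian_popCov e.μ (e.g (e.fitData ω)))
    (h3.trans Set.Icc_subset_Ici_self) (Pi.single ⟨0, hm⟩ 1)
  simp only [single_dotProduct, Matrix.mulVec_single, MulOpposite.op_one, one_smul, one_mul,
    Pi.single_eq_same, mul_one, Matrix.col_apply] at h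
  exact h.trans (popCov_self_le (e.measurable_g _ _) (h2 _))

end Experiment

theorem testFraction_pos {c₁ c₂ : ℝ} (hc₁ : 0 < c₁) (hc₂ : c₂ < 1) : 0 < testFraction c₁ c₂ :=
  mul_pos (by linarith) (lt_min hc₁ (by linarith))

theorem testFraction_le_one {c₁ c₂ : ℝ} (hc₁ : 0 < c₁) (hc₁₂ : c₁ ≤ c₂) (hc₂ : c₂ < 1) :
    testFraction c₁ c₂ ≤ 1 :=
  mul_le_one₀ (by linarith) (le_min hc₁.le (by linarith)) ((min_le_right _ _).trans (by linarith))

/-- The constant in the rate of convergence; `κ` is the fraction of test observations and `v` the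
lower bound for the eigenvalues. -/
noncomputable def rateConst (m : ℕ) (κ v : ℝ) : ℝ :=
  40000000 * m ^ 4 * (2 * m / (√v * √κ)) * (1 / v + 1 / √v) +
    4 * m ^ 4 / v * (2 * √(512 / κ)) + (2 * m + 4 * (m ^ 2 + m)) / (v * √v) +
    2 * m / (√v * √κ) / v + 2 * m / v * √(512 / κ) * (1 + 1 / √v)

theorem rateConst_pos {m : ℕ} (hm : 1 ≤ m) {κ v : ℝ} (hκ : 0 < κ) (hv : 0 < v) :
    0 < rateConst m κ v := by
  have hm' : (0 : ℝ) < m := by exact_mod_cast hm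
  unfold rateConst
  positivity

section Rate

variable {v b L x : ℝ}

theorem div_le_rate (hv : 0 < v) (hb : √v ≤ b) (hL : 0 ≤ L) (hx : 0 < x) :
    b / x ≤ 1 / v * ((b ^ 3 + b ^ 2 * L) / x) := by
  have hs : 0 < √v := Real.sqrt_pos.2 hv
  have hb0 : 0 < b := hs.trans_le hb
  have h1 : v ≤ b ^ 2 := by rw [← Real.sq_sqrt hv.le]; gcongr
  rw [← mul_div_assoc]
  gcongr
  rw [one_div, inv_mul_eq_div, le_div_iff₀ hv]
  nlinarith [mul_le_mul_of_nonneg_left h1 hb0.le, mul_nonneg (sq_nonneg b) hL]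

theorem mul_div_le_rate (hv : 0 < v) (hb : √v ≤ b) (hL : 0 ≤ L) (hx : 0 < x) :
    b * L / x ≤ 1 / √v * ((b ^ 3 + b ^ 2 * L) / x) := by
  have hs : 0 < √v := Real.sqrt_pos.2 hv
  have hb0 : 0 < b := hs.trans_le hb
  rw [← mul_div_assoc]
  refine div_le_div_of_nonneg_right ?_ hx.le
  rw [one_div, inv_mul_eq_div, le_div_iff₀ hs]
  nlinarith [mul_le_mul_of_nonneg_left hb (mul_nonneg hb0.le hL), pow_pos hb0 3]

theorem sq_mul_div_le_rate (hb : 0 ≤ b) (hx : 0 < x) :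
    b ^ 2 * L / x ≤ (b ^ 3 + b ^ 2 * L) / x := by
  gcongr
  nlinarith [pow_nonneg hb 3]

theorem sq_div_le_rate (hv : 0 < v) (hb : √v ≤ b) (hL : 0 ≤ L) (hx : 0 < x) :
    b ^ 2 / x ≤ 1 / √v * ((b ^ 3 + b ^ 2 * L) / x) := by
  have hs : 0 < √v := Real.sqrt_pos.2 hv
  have hb0 : 0 < b := hs.trans_le hb
  rw [← mul_div_assoc]
  gcongr
  rw [one_div, inv_mul_eq_div, le_div_iff₀ hs]
  nlinarith [mul_le_mul_of_nonneg_left hb (sq_nonneg b), mul_nonneg (sq_nonneg b) hL]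

theorem one_div_le_rate (hv : 0 < v) (hb : √v ≤ b) (hL : 0 ≤ L) (hx : 0 < x) :
    1 / x ≤ 1 / (v * √v) * ((b ^ 3 + b ^ 2 * L) / x) := by
  have hs : 0 < √v := Real.sqrt_pos.2 hv
  have hb0 : 0 < b := hs.trans_le hb
  have h1 : v ≤ b ^ 2 := by rw [← Real.sq_sqrt hv.le]; gcongr
  rw [← mul_div_assoc]
  gcongr
  rw [one_div (v * √v), inv_mul_eq_div, le_div_iff₀ (by positivity)]
  nlinarith [mul_le_mul h1 hb hs.le (sq_nonneg b), mul_nonneg (sq_nonneg b) hL]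

end Rate

namespace Experiment

variable {m : ℕ} {e : Experiment m} {c₁ c₂ c₁' c₂' : ℝ}

theorem abs_prob_sub_maxCDF_le_one (hm : 1 ≤ m) (t : ℝ) :
    |e.P.real {ω | e.T ω ≤ t} - maxCDF m t| ≤ 1 := by
  have h1 := maxCDF_mem_Icc hm t
  have h2 : 0 ≤ e.P.real {ω | e.T ω ≤ t} := measureReal_nonneg
  have h3 : e.P.real {ω | e.T ω ≤ t} ≤ 1 := measureReal_le_one
  exact abs_le.2 ⟨by linarith [h1.2], by linarith [h1.1]⟩

/-- Deviation of the sample covariances with Gaussian tails. -/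
theorem prob_dev_le_exp (hμν : e.μ = e.ν) {k b r q : ℝ} (hk : 0 < k) (hb0 : 0 < b) (hr : 0 ≤ r)
    (hq1 : 2 * Real.exp (-(k * r ^ 2 / (512 * b ^ 4))) ≤ q)
    (hq2 : 2 * Real.exp (-(k * r / (16 * b ^ 2))) ≤ q) {F : FitData e.nx e.ny e.d}
    (hx : k ≤ e.nxTest F.1) (hy : k ≤ e.nyTest F.1) (hb : ∀ j x, |e.g F j x| ≤ b) :
    e.P.real {ω | ∃ j l, r < |empCov (testSet F.1.1) (fun i => e.X i ω) (e.g F j) (e.g F l)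
      - popCov e.μ (e.g F) j l|} ≤ (m ^ 2 + m) * q ∧
    e.P.real {ω | ∃ j l, r < |empCov (testSet F.1.2) (fun i => e.Y i ω) (e.g F j) (e.g F l)
      - popCov e.μ (e.g F) j l|} ≤ (m ^ 2 + m) * q := by
  constructor
  · have hI : (0 : ℝ) < (testSet F.1.1).card := hk.trans_le hx
    have hx' : k ≤ ((testSet F.1.1).card : ℝ) := hx
    refine prob_empCov_dev_le_exp e.measurable_X e.indep_X e.law_X (e.measurable_g F) hb0 hb
      (by exact_mod_cast hI) hr (le_trans ?_ hq1) (le_trans ?_ hq2)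
    · gcongr
    · gcongr
  · have hI : (0 : ℝ) < (testSet F.1.2).card := hk.trans_le hy
    have hy' : k ≤ ((testSet F.1.2).card : ℝ) := hy
    refine prob_empCov_dev_le_exp e.measurable_Y e.indep_Y (fun i => hμν ▸ e.law_Y i)
      (e.measurable_g F) hb0 hb (by exact_mod_cast hI) hr (le_trans ?_ hq1) (le_trans ?_ hq2)
    · gcongr
    · gcongr

/-- Deviation of the sample covariances with polynomial tails. -/
theorem prob_dev_le_div (hμν : e.μ = e.ν) {k b r q : ℝ} (hk : 0 < k) (hr : 0 < r)
    (hc₁' : 0 ≤ c₁') (hc₂' : 0 ≤ c₂') (hq1 : 16 * b ^ 2 * c₂' / (k * r ^ 2) ≤ q)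
    (hq2 : 2 * c₂' / (k * r) ≤ q) {F : FitData e.nx e.ny e.d}
    (hx : k ≤ e.nxTest F.1) (hy : k ≤ e.nyTest F.1) (hb : ∀ j x, |e.g F j x| ≤ b)
    (hs : spectrum ℝ (popCov e.μ (e.g F)) ⊆ Set.Icc c₁' c₂') :
    e.P.real {ω | ∃ j l, r < |empCov (testSet F.1.1) (fun i => e.X i ω) (e.g F j) (e.g F l)
      - popCov e.μ (e.g F) j l|} ≤ (m ^ 2 + m) * q ∧
    e.P.real {ω | ∃ j l, r < |empCov (testSet F.1.2) (fun i => e.Y i ω) (e.g F j) (e.g F l)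
      - popCov e.μ (e.g F) j l|} ≤ (m ^ 2 + m) * q := by
  have hv : ∀ j, popCov e.μ (e.g F) j j ≤ c₂' := fun j => (le_abs_self _).trans
    (abs_apply_le_of_spectrum (isHermitian_popCov _ _) hc₂' (fun x hx => by
      rw [abs_of_nonneg (hc₁'.trans (hs hx).1)]
      exact (hs hx).2) j j)
  constructor
  · have hI : (0 : ℝ) < (testSet F.1.1).card := hk.trans_le hx
    have hx' : k ≤ ((testSet F.1.1).card : ℝ) := hx
    refine prob_empCov_dev_le_div e.measurable_X e.indep_X e.law_X (e.measurable_g F) hb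
      (by exact_mod_cast hI) hr hv (le_trans ?_ hq1) (le_trans ?_ hq2)
    · gcongr
    · gcongr
  · have hI : (0 : ℝ) < (testSet F.1.2).card := hk.trans_le hy
    have hy' : k ≤ ((testSet F.1.2).card : ℝ) := hy
    refine prob_empCov_dev_le_div e.measurable_Y e.indep_Y (fun i => hμν ▸ e.law_Y i)
      (e.measurable_g F) hb (by exact_mod_cast hI) hr hv (le_trans ?_ hq1) (le_trans ?_ hq2)
    · gcongr
    · gcongr

set_option maxHeartbeats 1000000 in
/-- Rate of convergence in terms of the sup-norm bound `b`. -/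
theorem abs_prob_T_le_sub_maxCDF_le_rate (hm : 1 ≤ m) (hμν : e.μ = e.ν) (hc₁ : 0 < c₁)
    (hc₁₂ : c₁ ≤ c₂) (hc₂ : c₂ < 1) (hc₁' : 0 < c₁') (hn : e.SampleSizes c₁ c₂)
    (hs : e.CovBounds c₁' c₂') {b : ℝ} (hb0 : 0 ≤ b)
    (hb : ∀ᵐ ω ∂e.P, ∀ j x, |e.g (e.fitData ω) j x| ≤ b) (t : ℝ) :
    |e.P.real {ω | e.T ω ≤ t} - maxCDF m t| ≤
      rateConst m (testFraction c₁ c₂) c₁' * ((b ^ 3 + b ^ 2 * Real.log e.n) / √e.n) := by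
  set κ := testFraction c₁ c₂ with hκdef
  have hκ : 0 < κ := testFraction_pos hc₁ hc₂
  have hκ1 : κ ≤ 1 := testFraction_le_one hc₁ hc₁₂ hc₂
  have hm' : (1 : ℝ) ≤ m := by exact_mod_cast hm
  have hn2 : (2 : ℝ) ≤ e.n := by exact_mod_cast hn.two_le hc₁ hc₂
  have hn0 : (0 : ℝ) < e.n := by linarith
  have hk : 0 < κ * e.n := by positivity
  have hae := hn.ae_le hc₁ hc₂
  have hbv : c₁' ≤ b ^ 2 := hs.le_sq hm hμν hk hae hb
  have hbs : √c₁' ≤ b := Real.sqrt_le_iff.2 ⟨hb0, hbv⟩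
  have hs0 : 0 < √c₁' := Real.sqrt_pos.2 hc₁'
  have hbp : 0 < b := hs0.trans_le hbs
  set L := Real.log e.n with hL
  have hL0 : 0 < L := Real.log_pos (by linarith)
  set x := √(e.n : ℝ) with hx
  have hx0 : 0 < x := Real.sqrt_pos.2 hn0
  have hxx : x ^ 2 = e.n := Real.sq_sqrt hn0.le
  have hx1 : 1 ≤ x := by rw [hx, Real.one_le_sqrt]; linarith
  have f1 := div_le_rate hc₁' hbs hL0.le hx0
  have f2 := mul_div_le_rate hc₁' hbs hL0.le hx0
  have f3 := sq_mul_div_le_rate (L := L) hbp.le hx0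
  have f4 := one_div_le_rate hc₁' hbs hL0.le hx0
  have f5 := sq_div_le_rate hc₁' hbs hL0.le hx0
  set R := (b ^ 3 + b ^ 2 * L) / x with hR
  have hR0 : 0 ≤ R := by positivity
  set A := 2 * m / (√c₁' * √κ) with hA
  set D := √(512 / κ) with hD
  have hD2 : D ^ 2 = 512 / κ := Real.sq_sqrt (by positivity)
  have hκs : 0 < √κ := Real.sqrt_pos.2 hκ
  have hA0 : 0 < A := by positivity
  have hD0 : 0 < D := Real.sqrt_pos.2 (by positivity)
  set β := A * (b / x) with hβ
  set r := b ^ 2 * D * √L / x with hr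
  have hsL : 0 < √L := Real.sqrt_pos.2 hL0
  have hsL2 : √L ^ 2 = L := Real.sq_sqrt hL0.le
  have hsL1 : √L ≤ L + 1 := by
    have h1 := sq_nonneg (√L - 1)
    rw [sub_sq, hsL2] at h1
    linarith
  have t1 : 0 ≤ 40000000 * m ^ 4 * A * (1 / c₁' + 1 / √c₁') * R := by positivity
  have t2 : 0 ≤ 4 * m ^ 4 / c₁' * (2 * D) * R := by positivity
  have t3 : 0 ≤ (2 * m + 4 * (m ^ 2 + m)) / (c₁' * √c₁') * R := by positivity
  have t4 : 0 ≤ A / c₁' * R := by positivity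
  have t5 : 0 ≤ 2 * m / c₁' * D * (1 + 1 / √c₁') * R := by positivity
  have hsplit : rateConst m κ c₁' * R = 40000000 * m ^ 4 * A * (1 / c₁' + 1 / √c₁') * R +
      4 * m ^ 4 / c₁' * (2 * D) * R + (2 * m + 4 * (m ^ 2 + m)) / (c₁' * √c₁') * R +
      A / c₁' * R + 2 * m / c₁' * D * (1 + 1 / √c₁') * R := by
    rw [rateConst]
    ring
  rw [hsplit]
  have htriv := abs_prob_sub_maxCDF_le_one (e := e) hm t
  by_cases hβ1 : β ≤ 1
  swap
  · have h1 : β ≤ A / c₁' * R := by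
      calc β ≤ A * (1 / c₁' * R) := by rw [hβ]; gcongr
        _ = _ := by ring
    linarith
  by_cases hr1 : m * r ≤ c₁' / 2
  swap
  · have h1 : m * r ≤ m * (D * (R + 1 / √c₁' * R)) := by
      have h2 : r ≤ D * (b ^ 2 * L / x + b ^ 2 / x) := by
        calc r = D * (b ^ 2 / x * √L) := by rw [hr]; ring
          _ ≤ D * (b ^ 2 / x * (L + 1)) := by gcongr
          _ = _ := by ring
      refine mul_le_mul_of_nonneg_left (h2.trans ?_) (by positivity)
      gcongr
    have h3 : 1 ≤ 2 * m / c₁' * D * (1 + 1 / √c₁') * R := by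
      have h4 : c₁' / 2 ≤ m * (D * (R + 1 / √c₁' * R)) := (not_le.1 hr1).le.trans h1
      calc (1 : ℝ) = 2 / c₁' * (c₁' / 2) := by field_simp
        _ ≤ 2 / c₁' * (m * (D * (R + 1 / √c₁' * R))) := by gcongr
        _ = _ := by ring
    linarith
  have hexpL : Real.exp (-L) = 1 / e.n := by
    rw [Real.exp_neg, hL, Real.exp_log hn0, one_div]
  have hr0 : 0 ≤ r := by positivity
  have hq1 : 2 * Real.exp (-(κ * e.n * r ^ 2 / (512 * b ^ 4))) ≤ 2 / e.n := by
    have h1 : κ * e.n * r ^ 2 / (512 * b ^ 4) = L := by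
      rw [hr, div_pow, mul_pow, mul_pow, hsL2, hD2, hxx]
      field_simp
    rw [h1, hexpL, mul_one_div]
  have hq2 : 2 * Real.exp (-(κ * e.n * r / (16 * b ^ 2))) ≤ 2 / e.n := by
    have h1 : D * √L / x ≤ 1 / 2 := by
      have h2 : c₁' * (D * √L / x) ≤ c₁' * (1 / 2) := by
        calc c₁' * (D * √L / x) ≤ b ^ 2 * (D * √L / x) := by gcongr
          _ = r := by rw [hr]; ring
          _ ≤ m * r := le_mul_of_one_le_left hr0 hm'
          _ ≤ c₁' * (1 / 2) := by linarith
      exact le_of_mul_le_mul_left h2 hc₁'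
    have h2 : L ≤ κ * e.n * r / (16 * b ^ 2) := by
      have h3 : κ * e.n * r / (16 * b ^ 2) = κ * x * (D * √L) / 16 := by
        rw [hr, ← hxx]
        field_simp
      rw [h3]
      have h4 : 2 * (D * √L) ≤ x := by
        rw [div_le_div_iff₀ hx0 two_pos] at h1
        linarith
      have h5 : κ * (2 * (D * √L)) * (D * √L) ≤ κ * x * (D * √L) := by gcongr
      have h6 : κ * (2 * (D * √L)) * (D * √L) = 1024 * L := by
        have : κ * (2 * (D * √L)) * (D * √L) = 2 * κ * D ^ 2 * √L ^ 2 := by ring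
        rw [this, hD2, hsL2]
        field_simp
        norm_num
      linarith
    calc _ ≤ 2 * Real.exp (-L) := by gcongr
      _ = _ := by rw [hexpL, mul_one_div]
  have hM : 0 ≤ √(2 * L) := Real.sqrt_nonneg _
  have hβk : m * ((√c₁')⁻¹ * ((√(κ * e.n))⁻¹ * (2 * b))) ≤ β := by
    rw [Real.sqrt_mul hκ.le, ← hx, hβ, hA]
    apply le_of_eq
    field_simp
  have main := abs_prob_T_le_sub_maxCDF_le hm hμν hk hae hb hc₁' hs (by positivity) hβk hβ1 hr0 hr1
    hM (fun F h1 h2 h3 _ => prob_dev_le_exp hμν hk hbp hr0 hq1 hq2 h1 h2 h3) t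
  have hlog : Real.log (1 / β) ≤ L := by
    refine Real.log_le_log (by positivity) ?_
    have h1 : 1 / x ≤ β := by
      rw [hβ, ← mul_div_assoc]
      gcongr
      have hk1 : √κ ≤ 1 := Real.sqrt_le_one.2 hκ1
      calc (1 : ℝ) ≤ 2 * m / (√κ) := by rw [le_div_iff₀ hκs]; linarith
        _ = A * √c₁' := by rw [hA]; field_simp
        _ ≤ A * b := by gcongr
    calc 1 / β ≤ 1 / (1 / x) := by gcongr
      _ = x := one_div_one_div x
      _ ≤ x ^ 2 := le_self_pow₀ hx1 two_ne_zero
      _ = _ := hxx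
  have b1 : 2 * (20000000 * m ^ 4 * β * (1 + Real.log (1 / β))) ≤
      40000000 * m ^ 4 * A * (1 / c₁' + 1 / √c₁') * R := by
    calc _ ≤ 2 * (20000000 * m ^ 4 * β * (1 + L)) := by gcongr
      _ = 40000000 * m ^ 4 * A * (b / x + b * L / x) := by rw [hβ]; ring
      _ ≤ 40000000 * m ^ 4 * A * (1 / c₁' * R + 1 / √c₁' * R) := by gcongr
      _ = _ := by ring
  have b2 : 2 * m * (2 * m ^ 3 / c₁' * r * √(2 * L)) ≤ 4 * m ^ 4 / c₁' * (2 * D) * R := by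
    have h1 : √(2 * L) ≤ 2 * √L := by
      rw [Real.sqrt_mul two_pos.le]
      gcongr
      rw [Real.sqrt_le_iff]
      norm_num
    calc _ ≤ 2 * m * (2 * m ^ 3 / c₁' * r * (2 * √L)) := by gcongr
      _ = 4 * m ^ 4 / c₁' * (2 * D) * (b ^ 2 * √L ^ 2 / x) := by rw [hr]; ring
      _ ≤ _ := by rw [hsL2]; gcongr
  have hnR : 1 / (e.n : ℝ) ≤ 1 / (c₁' * √c₁') * R := by
    refine le_trans ?_ f4
    rw [← hxx]
    gcongr
    exact le_self_pow₀ hx1 two_ne_zero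
  have b3 : 2 * m * Real.exp (-√(2 * L) ^ 2 / 2) + 2 * ((m ^ 2 + m) * (2 / e.n)) ≤
      (2 * m + 4 * (m ^ 2 + m)) / (c₁' * √c₁') * R := by
    rw [Real.sq_sqrt (by positivity), show -(2 * L) / 2 = -L by ring, hexpL]
    calc _ = (2 * m + 4 * (m ^ 2 + m)) * (1 / (e.n : ℝ)) := by ring
      _ ≤ (2 * m + 4 * (m ^ 2 + m)) * (1 / (c₁' * √c₁') * R) := by gcongr
      _ = _ := by ring
  linarith

end Experiment

/-! ### Convergence in distribution -/

theorem map_measureReal_Ioc {Ω : Type*} [MeasurableSpace Ω] {P : Measure Ω} [IsProbabilityMeasure P]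
    {X : Ω → ℝ} (hX : Measurable X) {a b : ℝ} (hab : a ≤ b) :
    (P.map X).real (Set.Ioc a b) = P.real {ω | X ω ≤ b} - P.real {ω | X ω ≤ a} := by
  have hsub : {ω | X ω ≤ a} ⊆ {ω | X ω ≤ b} := fun ω hω => le_trans hω hab
  rw [map_measureReal_apply hX measurableSet_Ioc, ← measureReal_sdiff hsub
    (measurableSet_le hX measurable_const)]
  congr 1
  ext ω
  simp [and_comm]

/-- Convergence of distribution functions at every point implies convergence in distribution. -/
theorem tendstoInDistribution_of_tendsto_cdf {ι Ω' : Type*} {Ω : ι → Type*} {l : Filter ι}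
    [l.IsCountablyGenerated] [∀ i, MeasurableSpace (Ω i)] [MeasurableSpace Ω']
    {P : ∀ i, Measure (Ω i)} [∀ i, IsProbabilityMeasure (P i)] {P' : Measure Ω'}
    [IsProbabilityMeasure P'] {X : ∀ i, Ω i → ℝ} {Z : Ω' → ℝ} (hX : ∀ i, Measurable (X i))
    (hZ : Measurable Z)
    (h : ∀ t, Tendsto (fun i => (P i).real {ω | X i ω ≤ t}) l (𝓝 (P'.real {ω | Z ω ≤ t}))) :
    TendstoInDistribution X l Z P P' := by
  refine ⟨fun i => (hX i).aemeasurable, hZ.aemeasurable, ?_⟩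
  refine IsPiSystem.tendsto_probabilityMeasure_of_tendsto_of_mem
    (S := {s | ∃ a b : ℝ, a < b ∧ Set.Ioc a b = s}) ?_ ?_ ?_ ?_
  · simpa using isPiSystem_Ioc (id : ℝ → ℝ) id
  · rintro _ ⟨a, b, _, rfl⟩
    exact measurableSet_Ioc
  · intro u hu x hx
    obtain ⟨ε, hε, hsub⟩ := Metric.isOpen_iff.1 hu x hx
    refine ⟨Set.Ioc (x - ε / 2) (x + ε / 2), ⟨_, _, by linarith, rfl⟩,
      Ioc_mem_nhds (by linarith) (by linarith), fun y hy => hsub ?_⟩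
    rw [Metric.mem_ball, Real.dist_eq, abs_lt]
    exact ⟨by linarith [hy.1], by linarith [hy.2]⟩
  · rintro _ ⟨a, b, hab, rfl⟩
    rw [← NNReal.tendsto_coe]
    change Tendsto (fun i => ((P i).map (X i)).real (Set.Ioc a b)) l
      (𝓝 ((P'.map Z).real (Set.Ioc a b)))
    have h2 := (h b).sub (h a)
    rw [← map_measureReal_Ioc hZ hab.le] at h2
    exact h2.congr fun i => (map_measureReal_Ioc (hX i) hab.le).symm

/-- Error bound for the normal approximation when the sup-norm bound is `w ^ 4 * √n`. -/
noncomputable def smallErr (m : ℕ) (κ v v' w : ℝ) : ℝ :=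
  40000000 * m ^ 4 * (2 * m / (√v * √κ) * w ^ 4 -
      (2 * m / (√v * √κ) * w ^ 4) * Real.log (2 * m / (√v * √κ) * w ^ 4)) +
    4 * m ^ 4 / v * w + 4 * m * w ^ 2 +
    2 * ((m ^ 2 + m) * (16 * v' / κ * w ^ 4 + 2 * v' / κ * w ^ 6))

theorem tendsto_smallErr (m : ℕ) (κ v v' : ℝ) :
    Tendsto (smallErr m κ v v') (𝓝 0) (𝓝 0) := by
  have h : Continuous (smallErr m κ v v') := by
    have h1 : Continuous fun w : ℝ => (2 * m / (√v * √κ) * w ^ 4) *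
        Real.log (2 * m / (√v * √κ) * w ^ 4) :=
      Real.continuous_mul_log.comp (f := fun w : ℝ => 2 * m / (√v * √κ) * w ^ 4) (by fun_prop)
    unfold smallErr
    fun_prop
  have h0 : smallErr m κ v v' 0 = 0 := by simp [smallErr]
  simpa [h0] using h.tendsto 0

theorem exp_neg_inv_sq_le {w : ℝ} (hw : 0 < w) : Real.exp (-(w⁻¹) ^ 2 / 2) ≤ 2 * w ^ 2 := by
  have h1 := Real.add_one_le_exp ((w⁻¹) ^ 2 / 2)
  have h2 : 0 < (w⁻¹) ^ 2 / 2 := by positivity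
  rw [neg_div, Real.exp_neg]
  calc (Real.exp ((w⁻¹) ^ 2 / 2))⁻¹ ≤ ((w⁻¹) ^ 2 / 2)⁻¹ := by
        gcongr
        linarith
    _ = _ := by field_simp

namespace Experiment

variable {m : ℕ} {e : Experiment m} {c₁ c₂ c₁' c₂' : ℝ}

theorem abs_prob_T_le_sub_maxCDF_le_smallErr (hm : 1 ≤ m) (hμν : e.μ = e.ν) (hc₁ : 0 < c₁)
    (hc₂ : c₂ < 1) (hc₁' : 0 < c₁') (hc₂' : 0 < c₂') (hn : e.SampleSizes c₁ c₂)
    (hs : e.CovBounds c₁' c₂') {b w : ℝ} (hb1 : 1 ≤ b)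
    (hb : ∀ᵐ ω ∂e.P, ∀ j x, |e.g (e.fitData ω) j x| ≤ b) (hw : 0 < w) (hbw : b ≤ w ^ 4 * √e.n)
    (hw1 : 2 * m / (√c₁' * √(testFraction c₁ c₂)) * w ^ 4 ≤ 1) (hw2 : m * w ^ 2 ≤ c₁' / 2)
    (t : ℝ) :
    |e.P.real {ω | e.T ω ≤ t} - maxCDF m t| ≤ smallErr m (testFraction c₁ c₂) c₁' c₂' w := by
  unfold smallErr
  set κ := testFraction c₁ c₂ with hκdef
  have hκ : 0 < κ := testFraction_pos hc₁ hc₂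
  have hm' : (0 : ℝ) < m := by exact_mod_cast hm
  have hn2 : (2 : ℝ) ≤ e.n := by exact_mod_cast hn.two_le hc₁ hc₂
  have hn0 : (0 : ℝ) < e.n := by linarith
  have hk : 0 < κ * e.n := by positivity
  have hae := hn.ae_le hc₁ hc₂
  have hs0 : 0 < √c₁' := Real.sqrt_pos.2 hc₁'
  have hκs : 0 < √κ := Real.sqrt_pos.2 hκ
  set A := 2 * m / (√c₁' * √κ) with hA
  have hA0 : 0 < A := by positivity
  set x := √(e.n : ℝ) with hx
  have hx0 : 0 < x := Real.sqrt_pos.2 hn0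
  have hxx : x ^ 2 = e.n := Real.sq_sqrt hn0.le
  have hb2 : b ^ 2 ≤ w ^ 8 * e.n := by
    calc b ^ 2 ≤ (w ^ 4 * x) ^ 2 := by gcongr
      _ = _ := by rw [← hxx]; ring
  have hq1 : 16 * b ^ 2 * c₂' / (κ * e.n * (w ^ 2) ^ 2) ≤
      16 * c₂' / κ * w ^ 4 + 2 * c₂' / κ * w ^ 6 := by
    calc _ ≤ 16 * (w ^ 8 * e.n) * c₂' / (κ * e.n * (w ^ 2) ^ 2) := by gcongr
      _ = 16 * c₂' / κ * w ^ 4 := by field_simp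
      _ ≤ _ := le_add_of_nonneg_right (by positivity)
  have hq2 : 2 * c₂' / (κ * e.n * w ^ 2) ≤ 16 * c₂' / κ * w ^ 4 + 2 * c₂' / κ * w ^ 6 := by
    have h1 : 1 ≤ w ^ 8 * e.n := (one_le_pow₀ hb1).trans hb2
    calc _ = 2 * c₂' / (κ * e.n * w ^ 2) * 1 := (mul_one _).symm
      _ ≤ 2 * c₂' / (κ * e.n * w ^ 2) * (w ^ 8 * e.n) := by gcongr
      _ = 2 * c₂' / κ * w ^ 6 := by field_simp
      _ ≤ _ := le_add_of_nonneg_left (by positivity)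
  have hβk : m * ((√c₁')⁻¹ * ((√(κ * e.n))⁻¹ * (2 * b))) ≤ A * w ^ 4 := by
    rw [Real.sqrt_mul hκ.le, ← hx]
    calc _ ≤ m * ((√c₁')⁻¹ * ((√κ * x)⁻¹ * (2 * (w ^ 4 * x)))) := by gcongr
      _ = _ := by rw [hA]; field_simp
  have main := abs_prob_T_le_sub_maxCDF_le hm hμν hk hae hb hc₁' hs (by positivity) hβk hw1
    (by positivity) hw2 (inv_pos.2 hw).le
    (fun F h1 h2 h3 h4 => prob_dev_le_div hμν hk (by positivity) hc₁'.le hc₂'.le hq1 hq2 h1 h2 h3 h4)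
    t
  have h3 : 2 * m ^ 3 / c₁' * w ^ 2 * w⁻¹ = 2 * m ^ 3 / c₁' * w := by field_simp
  rw [one_div, Real.log_inv, h3] at main
  have h4 := mul_le_mul_of_nonneg_left (exp_neg_inv_sq_le hw) (by positivity : (0 : ℝ) ≤ 2 * m)
  refine main.trans ?_
  have h5 : 2 * (20000000 * m ^ 4 * (A * w ^ 4) * (1 + -Real.log (A * w ^ 4))) =
      40000000 * m ^ 4 * (A * w ^ 4 - A * w ^ 4 * Real.log (A * w ^ 4)) := by ring
  have h6 : 2 * m * (2 * m ^ 3 / c₁' * w) = 4 * m ^ 4 / c₁' * w := by ring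
  rw [h5, h6]
  linarith

end Experiment

theorem tendstoInDistribution_T {m : ℕ} (hm : 1 ≤ m) {c₁ c₂ c₁' c₂' : ℝ} (hc₁ : 0 < c₁)
    (hc₂ : c₂ < 1) (hc₁' : 0 < c₁') (hc₂' : 0 < c₂') {e : ℕ → Experiment m}
    (hμν : ∀ r, (e r).μ = (e r).ν) (hn : ∀ r, (e r).SampleSizes c₁ c₂)
    (hs : ∀ r, (e r).CovBounds c₁' c₂') (hnt : Tendsto (fun r => (e r).n) atTop atTop)
    (hB : ∀ j, Tendsto (fun r => (e r).B j / √((e r).n : ℝ)) atTop (𝓝 0)) :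
    TendstoInDistribution (fun r => (e r).T) atTop (fun z : Fin m → ℝ => ⨆ j, |z j|)
      (fun r => (e r).P) (stdNormal m) := by
  refine tendstoInDistribution_of_tendsto_cdf (fun r => (e r).measurable_T)
    (Measurable.iSup fun j => continuous_abs.measurable.comp (measurable_pi_apply j)) fun t => ?_
  rw [stdNormal_real_iSup_abs_le hm]
  set b : ℕ → ℝ := fun r => ∑ j, |(e r).B j| + 1 with hbdef
  have hb1 : ∀ r, 1 ≤ b r := fun r => le_add_of_nonneg_left (Finset.sum_nonneg fun j _ => abs_nonneg _)
  have hn0 : ∀ r, (0 : ℝ) < (e r).n := fun r => by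
    have := (hn r).two_le hc₁ hc₂
    exact_mod_cast (by omega : 0 < (e r).n)
  have hsq : Tendsto (fun r => (√((e r).n : ℝ))⁻¹) atTop (𝓝 0) :=
    tendsto_inv_atTop_zero.comp (Real.tendsto_sqrt_atTop.comp
      (tendsto_natCast_atTop_atTop.comp hnt))
  have hu : Tendsto (fun r => b r / √((e r).n : ℝ)) atTop (𝓝 0) := by
    have h1 : Tendsto (fun r => ∑ j, |(e r).B j / √((e r).n : ℝ)| + (√((e r).n : ℝ))⁻¹) atTop
        (𝓝 (∑ _j : Fin m, |(0 : ℝ)| + 0)) :=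
      (tendsto_finsetSum _ fun j _ => (hB j).abs).add hsq
    simp only [abs_zero, Finset.sum_const_zero, add_zero] at h1
    refine h1.congr fun r => ?_
    simp only [hbdef, add_div, Finset.sum_div, abs_div, abs_of_nonneg (Real.sqrt_nonneg _), one_div]
  set w : ℕ → ℝ := fun r => √√(b r / √((e r).n : ℝ)) with hwdef
  have hwt : Tendsto w atTop (𝓝 0) := by
    have h := (Real.continuous_sqrt.comp Real.continuous_sqrt).tendsto 0
    simp only [Function.comp_apply, Real.sqrt_zero] at h
    exact h.comp hu
  have hw0 : ∀ r, 0 < w r := fun r => by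
    have h1 := hb1 r
    have h2 := Real.sqrt_pos.2 (hn0 r)
    simp only [hwdef]
    positivity
  have hw4 : ∀ r, b r = w r ^ 4 * √((e r).n : ℝ) := fun r => by
    have h1 := hb1 r
    have h2 := Real.sqrt_pos.2 (hn0 r)
    have h3 : w r ^ 4 = b r / √((e r).n : ℝ) := by
      simp only [hwdef]
      rw [show (4 : ℕ) = 2 * 2 from rfl, pow_mul, Real.sq_sqrt (Real.sqrt_nonneg _),
        Real.sq_sqrt (by positivity)]
    rw [h3, div_mul_cancel₀ _ h2.ne']
  have hbb : ∀ r, ∀ᵐ ω ∂(e r).P, ∀ j x, |(e r).g ((e r).fitData ω) j x| ≤ b r := fun r => by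
    filter_upwards [(e r).ae_abs_g_le] with ω hω j x
    have h1 : |(e r).B j| ≤ ∑ j, |(e r).B j| :=
      Finset.single_le_sum (f := fun j => |(e r).B j|) (fun _ _ => abs_nonneg _) (Finset.mem_univ j)
    simp only [hbdef]
    linarith [hω j x, le_abs_self ((e r).B j)]
  have ev1 : ∀ᶠ r in atTop, 2 * m / (√c₁' * √(testFraction c₁ c₂)) * w r ^ 4 ≤ 1 := by
    have h := (hwt.pow 4).const_mul (2 * m / (√c₁' * √(testFraction c₁ c₂)))
    rw [zero_pow (by norm_num), mul_zero] at h
    exact (h.eventually (gt_mem_nhds one_pos)).mono fun r hr => hr.le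
  have ev2 : ∀ᶠ r in atTop, m * w r ^ 2 ≤ c₁' / 2 := by
    have h := (hwt.pow 2).const_mul (m : ℝ)
    rw [zero_pow (by norm_num), mul_zero] at h
    exact (h.eventually (gt_mem_nhds (half_pos hc₁'))).mono fun r hr => hr.le
  rw [tendsto_iff_norm_sub_tendsto_zero]
  refine squeeze_zero' (Eventually.of_forall fun r => norm_nonneg _) ?_
    ((tendsto_smallErr m (testFraction c₁ c₂) c₁' c₂').comp hwt)
  filter_upwards [ev1, ev2] with r h1 h2
  exact Experiment.abs_prob_T_le_sub_maxCDF_le_smallErr hm (hμν r) hc₁ hc₂ hc₁' hc₂' (hn r) (hs r)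
    (hb1 r) (hbb r) (hw0 r) (hw4 r).le h1 h2 t


theorem sqrt_pow_three {x : ℝ} (hx : 0 ≤ x) : √x ^ 3 = x ^ (3 / 2 : ℝ) := by
  rw [Real.sqrt_eq_rpow, ← Real.rpow_natCast, ← Real.rpow_mul hx]
  norm_num

/-- The error in terms of the sup-norm bound `4 k^{1/2} τ θ_n`. -/
theorem rate_le {k τ η l L : ℝ} (hk : 0 ≤ k) (hτ : 0 ≤ τ) (hη : 0 ≤ η) (hl : 0 ≤ l) (hL : 0 ≤ L) :
    (4 * √k * τ * (η * √(2 * l))) ^ 3 + (4 * √k * τ * (η * √(2 * l))) ^ 2 * L ≤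
      192 * (k ^ (3 / 2 : ℝ) * (η * τ) ^ 3 * l ^ (3 / 2 : ℝ) + k * (η * τ) ^ 2 * l * L) := by
  have h2 : √(2 * l) ^ 3 ≤ 3 * l ^ (3 / 2 : ℝ) := by
    rw [Real.sqrt_mul two_pos.le, mul_pow, sqrt_pow_three hl]
    refine mul_le_mul_of_nonneg_right ?_ (by positivity)
    have h3 : √2 ≤ 3 / 2 := Real.sqrt_le_iff.2 ⟨by norm_num, by norm_num⟩
    calc √2 ^ 3 = 2 * √2 := by rw [pow_succ, Real.sq_sqrt two_pos.le]
      _ ≤ 3 := by linarith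
  have e1 : (4 * √k * τ * (η * √(2 * l))) ^ 3 =
      64 * (k ^ (3 / 2 : ℝ) * (η * τ) ^ 3 * √(2 * l) ^ 3) := by
    rw [← sqrt_pow_three hk]
    ring
  have e2 : (4 * √k * τ * (η * √(2 * l))) ^ 2 * L = 32 * (k * (η * τ) ^ 2 * l * L) := by
    calc _ = 16 * (√k ^ 2 * (η * τ) ^ 2 * √(2 * l) ^ 2 * L) := by ring
      _ = _ := by rw [Real.sq_sqrt hk, Real.sq_sqrt (by positivity)]; ring
  have h4 : 0 ≤ k * (η * τ) ^ 2 * l * L := by positivity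
  have h5 : k ^ (3 / 2 : ℝ) * (η * τ) ^ 3 * √(2 * l) ^ 3 ≤
      k ^ (3 / 2 : ℝ) * (η * τ) ^ 3 * (3 * l ^ (3 / 2 : ℝ)) :=
    mul_le_mul_of_nonneg_left h2 (by positivity)
  rw [e1, e2]
  linarith

namespace Experiment

variable {m : ℕ} {e : Experiment m} {c₁ c₂ c₁' c₂' : ℝ}

theorem abs_prob_T_le_sub_stdNormal_le (hm : 1 ≤ m) (hμν : e.μ = e.ν) (hc₁ : 0 < c₁)
    (hc₁₂ : c₁ ≤ c₂) (hc₂ : c₂ < 1) (hc₁' : 0 < c₁') (hn : e.SampleSizes c₁ c₂)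
    (hs : e.CovBounds c₁' c₂') {η : ℝ} (hη : 0 < η)
    (hB : ∀ j, e.B j = 4 * √(e.k j) * e.τ j * e.θ η) (t : ℝ) :
    |e.P.real {ω | e.T ω ≤ t} - (stdNormal m).real {z | (⨆ j, |z j|) ≤ t}| ≤
      192 * rateConst m (testFraction c₁ c₂) c₁' *
        ((e.kMax ^ (3 / 2 : ℝ) * (η * e.τMax) ^ 3 * Real.log (e.d * e.n) ^ (3 / 2 : ℝ) +
          e.kMax * (η * e.τMax) ^ 2 * Real.log (e.d * e.n) * Real.log e.n) / √(e.n : ℝ)) := by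
  rw [stdNormal_real_iSup_abs_le hm]
  have hn2 : (2 : ℝ) ≤ e.n := by exact_mod_cast hn.two_le hc₁ hc₂
  have hd : (1 : ℝ) ≤ e.d := by exact_mod_cast (e.one_le_k ⟨0, hm⟩).trans (e.k_le_d _)
  have hl : 0 ≤ Real.log (e.d * e.n) := Real.log_nonneg (one_le_mul_of_one_le_of_one_le hd (by linarith))
  have hL : 0 ≤ Real.log e.n := Real.log_nonneg (by linarith)
  have hkM : ∀ j, (e.k j : ℝ) ≤ e.kMax := fun j =>
    le_ciSup (f := fun j => (e.k j : ℝ)) (Set.finite_range _).bddAbove j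
  have hτM : ∀ j, e.τ j ≤ e.τMax := fun j => le_ciSup (Set.finite_range _).bddAbove j
  have hk0 : 0 ≤ e.kMax := (Nat.cast_nonneg _).trans (hkM ⟨0, hm⟩)
  have hτj : ∀ j, 0 ≤ e.τ j := fun j => (Nat.cast_nonneg _).trans (e.k_le_τ j)
  have hτ0 : 0 ≤ e.τMax := (hτj ⟨0, hm⟩).trans (hτM _)
  have hθ : 0 ≤ e.θ η := mul_nonneg hη.le (Real.sqrt_nonneg _)
  have hb : ∀ᵐ ω ∂e.P, ∀ j x, |e.g (e.fitData ω) j x| ≤ 4 * √e.kMax * e.τMax * e.θ η := by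
    filter_upwards [e.ae_abs_g_le] with ω hω j x
    refine (hω j x).trans ?_
    rw [hB j]
    refine mul_le_mul_of_nonneg_right ?_ hθ
    exact mul_le_mul (mul_le_mul_of_nonneg_left (Real.sqrt_le_sqrt (hkM j)) (by norm_num)) (hτM j)
      (hτj j) (by positivity)
  refine (abs_prob_T_le_sub_maxCDF_le_rate hm hμν hc₁ hc₁₂ hc₂ hc₁' hn hs (by positivity) hb
    t).trans ?_
  rw [mul_comm (192 : ℝ), mul_assoc (rateConst m (testFraction c₁ c₂) c₁')]
  refine mul_le_mul_of_nonneg_left ?_ (rateConst_pos hm (testFraction_pos hc₁ hc₂) hc₁').le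
  rw [← mul_div_assoc]
  exact div_le_div_of_nonneg_right (rate_le hk0 hτ0 hη.le hl hL) (Real.sqrt_nonneg _)

end Experiment
end NeuralWasserstein

universe u

theorem corollary1 (m : ℕ) (hm : 1 ≤ m) (c₁ c₂ c₁' c₂' : ℝ)
    (hc₁ : 0 < c₁) (hc₁₂ : c₁ ≤ c₂) (hc₂ : c₂ < 1) (hc₁' : 0 < c₁') (hc₂' : 0 < c₂') :
    (∀ e : ℕ → NeuralWasserstein.Experiment.{u} m,
      (∀ r, (e r).μ = (e r).ν) →
      (∀ r, (e r).SampleSizes c₁ c₂) →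
      (∀ r, (e r).CovBounds c₁' c₂') →
      Tendsto (fun r => (e r).n) atTop atTop →
      (∀ j, Tendsto (fun r => (e r).B j / √((e r).n : ℝ)) atTop (𝓝 0)) →
      TendstoInDistribution (fun r => (e r).T) atTop
        (fun z : Fin m → ℝ => ⨆ j, |z j|) (fun r => (e r).P)
        (NeuralWasserstein.stdNormal m)) ∧
    (∃ c : ℝ, 0 < c ∧ ∀ e : NeuralWasserstein.Experiment.{u} m,
      e.μ = e.ν → e.SampleSizes c₁ c₂ → e.CovBounds c₁' c₂' →
      ∀ (η a₁ a₂ : ℝ) (N : Fin m → ℕ), 0 < η → 0 < a₁ → e.NetworkStructure η a₁ a₂ N →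
      ∀ t : ℝ,
        |e.P.real {ω | e.T ω ≤ t} -
            (NeuralWasserstein.stdNormal m).real {z | (⨆ j, |z j|) ≤ t}| ≤
          c * ((e.kMax ^ (3 / 2 : ℝ) * (η * e.τMax) ^ 3 *
                  Real.log (e.d * e.n) ^ (3 / 2 : ℝ) +
                e.kMax * (η * e.τMax) ^ 2 * Real.log (e.d * e.n) * Real.log e.n) /
            √(e.n : ℝ))) := by
  refine ⟨fun e hμν hn hs hnt hB => NeuralWasserstein.tendstoInDistribution_T hm hc₁ hc₂ hc₁' hc₂'
    hμν hn hs hnt hB, 192 * NeuralWasserstein.rateConst m (NeuralWasserstein.testFraction c₁ c₂) c₁',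
    mul_pos (by norm_num) (NeuralWasserstein.rateConst_pos hm
      (NeuralWasserstein.testFraction_pos hc₁ hc₂) hc₁'), ?_⟩
  intro e hμν hn hs η a₁ a₂ N hη _ hN t
  exact NeuralWasserstein.Experiment.abs_prob_T_le_sub_stdNormal_le hm hμν hc₁ hc₁₂ hc₂ hc₁' hn hs
    hη (fun j => (hN j).2.2.2.2.1) t
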